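/- **Setting.** There are $m\ge1$ tasks, partitioned into $K$ nonempty latent clusters $S_1,\dots,S_K$. Task $j$ has a sample space with law $P_j$, a nuisance space $\mathcal H_j$ (a real normed space), a loss $\ell_j(\theta,\eta,z)$, and risk $\mathcal R_j(\theta,\eta)=\mathbb E_{P_j}\ell_j(\theta,\eta,Z)$. Its target $\theta_j^*$ minimizes $\mathcal R_j(\cdot,\eta_j^*)$ over $\Theta\subseteq\mathbb R^d$. We have $\theta_j^*=\beta_k^*$ for $j\in S_k$, and $\|\beta_k^*-\beta_{k'}^*\|_2\ge\delta>0$ for $k\ne k'$. For each $j$ there is an evaluation sample $Z_{j1},\dots,Z_{jn_j}$, $n_j\ge1$, of law $P_j$; all these observations are mutually independent. The nuisance estimators $(\hat\eta_j)_j$ are jointly independent of the evaluation samples; the pilot estimators $\hat\theta_j^{\rm init}$ are arbitrary. Let $\mathcal T_j\subseteq\mathcal H_j$ be the nuisance realization sets and $\pi=\mathbb P(\exists j:\hat\eta_j\notin\mathcal T_j)$. Write $n_{\min}=\min_jn_j$, $n_{\max}=\max_j n_j$, $N_k=\sum_{j\in S_k}n_j$, $N_{\min}=\min_kN_k$, $m_k=|S_k|$.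 Let $\mathcal B_{x,M}$ be the closed ball of radius $M>0$ about $x$, and let $D_\eta$, $D^2_\eta$ be Gâteaux derivatives in $\eta$. **Assumption 1 (loss regularity).** With constants $\rho,\kappa,\sigma_1,\sigma_2,\sigma_3,\sigma_5>0$ and $r_1,r_2>2$, for every $j$: $\mathcal B_{\theta_j^*,M}\subseteq\Theta$; $\ell_j(\cdot,\eta,z)$ is convex on $\Theta$ for $\eta\in\mathcal B_{\eta_j^*,M}$; on the two balls of radius $M$ the loss is twice differentiable in $\theta$ and integrable; $\mathcal R_j(\cdot,\eta_j^*)$ is twice differentiable on $\mathcal B_{\theta_j^*,M}$, with Hessian $H_j$; and 1. $\rho I\preceq H_j(\theta)\preceq\kappa I$ for $\theta\in\mathcal B_{\theta_j^*,M}$; 2. $\nabla_\theta\mathcal R_j(\theta_j^*,\eta_j^*)=0$ and $\mathbb E_{P_j}\|\nabla_\theta\ell_j(\theta_j^*,\eta_j^*,Z)\|_2^{r_1}\le\sigma_1$; 3. $\mathbb E_{P_j}|\langle v,(\nabla^2_\theta\ell_j(\theta,\eta_j^*,Z)-H_j(\theta))v\rangle|^{r_2}\le\sigma_2$ for all unit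 vectors $v$ and $\theta\in\mathcal B_{\theta_j^*,M}$; 4. $\displaystyle\mathbb E_{P_j}\Big[\sup\frac{\|\nabla_\theta^2\ell_j(\theta,\eta,Z)-\nabla_\theta^2\ell_j(\theta',\eta',Z)\|_2}{\|\theta-\theta'\|_2+\|\eta-\eta'\|_{\mathcal H_j}}\Big]\le\sigma_3$, the supremum being over $(\theta,\eta)\ne(\theta',\eta')$ in $\mathcal B_{\theta_j^*,M}\times\mathcal B_{\eta_j^*,M}$; 5. $D_\eta\nabla_\theta\mathcal R_j(\theta_j^*,\eta_j^*)[\eta-\eta_j^*]=0$ for $\eta\in\mathcal T_j$; 6. for $\eta\in\mathcal T_j$, $h=\eta-\eta_j^*$ and $\bar\eta$ on the segment from $\eta_j^*$ to $\eta$, the following derivatives exist and $\mathbb E_{P_j}\|D_\eta\nabla_\theta\ell_j(\theta_j^*,\bar\eta,Z)[h]\|_2^2$ and $\mathbb E_{P_j}\|D^2_\eta\nabla_\theta\ell_j(\theta_j^*,\bar\eta,Z)[h,h]\|_2$ are at most $\sigma_5\|h\|_{\mathcal H_j}^2$. **Assumption 2 (nuisance rate).** $\mathbb E\|\hat\eta_j-\eta_j^*\|^2_{\mathcal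 H_j}\le\sigma_4/s(n_j)^2$ for every $j$, where $\sigma_4>0$ and $s>0$ is a rate function with $n^{1/4}=o(s(n))$ and $s(n)=O(n^{1/2})$. **Assumption 3 (pilot consistency).** For some $\alpha\in(0,1/2]$ and every $\epsilon>0$, $\mathbb P(\forall j:\ n_j^\alpha\|\hat\theta_j^{\rm init}-\theta_j^*\|_2<\epsilon)\ge1-p_\epsilon(n_{\min})$, where $p_\epsilon(n)\to0$ as $n\to\infty$. **Estimator.** For $c_w>0$, $\gamma\ge0$, $\tau$ and $\varepsilon\ge0$ let $w_{jj'}=c_w\|\hat\theta_j^{\rm init}-\hat\theta_{j'}^{\rm init}\|_2^{-\gamma}\in[0,\infty]$, and $\lambda_{jj'}=\varepsilon$ if $w_{jj'}\le\tau$, $\lambda_{jj'}=w_{jj'}$ otherwise. The estimator $(\hat\theta_j)_j$ minimizes $$\sum_{j}\sum_{i\le n_j}\ell_j(\theta_j,\hat\eta_j,Z_{ji})+\sum_{j'<j}\lambda_{jj'}\|\theta_j-\theta_{j'}\|_2$$ over $\Theta^m$ whenever a minimizer exists (with $\infty\cdot0=0$). **Theorem.** There are constants $c_1,c,C,\tilde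 C>0$ depending only on $d,M,\delta,\rho,\kappa,\sigma_1,\dots,\sigma_5,r_1,r_2,s$, and constants $c_0,c_2>0$ depending in addition on $\alpha,\gamma,c_w$, such that the following holds for every experiment satisfying Assumptions 1–3, every $\zeta<1/2$, and all $\varepsilon\ge0$, $\tau$ with (i) $n_{\min}^{\alpha\gamma}\ge c_0n_{\max}$, (ii) $\varepsilon\le c_1m^{-2}N_{\min}^\zeta$, (iii) $\tau\in(c_2,\,c_2n_{\min}^{\alpha\gamma})$. Let $$a=c\,\min\Big\{m^{-1}\Big(n_{\min}^{\frac{r_2}{2(r_2+d)}}\wedge\min_js(n_j)\Big),\ \pi^{-1}\Big\},\qquad b_k=K\,m_k^{1/2}\max_{j\in S_k}n_j^{1/2}s(n_j)^{-2}.$$ For every $1<t<a$, with probability at least $1-t^{-1}-p_{\delta/4}(n_{\min})$, simultaneously: 1. (Exact clustering) $\hat\theta_j=\hat\theta_{j'}$ for all $j,j'$ in the same cluster, and $\hat\theta_j\ne\hat\theta_{j'}$ for all $j,j'$ in different clusters. 2. (Oracle rate) For every $k$ and $j\in S_k$, $\ \|\hat\theta_j-\theta_j^*\|_2\le C\,(K^{1/r_1}+b_k)\,N_k^{-1/2}\,t+\tilde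 C\,N_k^{\zeta-1}.$ Moreover, with $c_3=\max\{4,\,2(r_2+d)/r_2\}$, $a\to\infty$ along every sequence of experiments with $n_{\min}/m^{c_3}\to\infty$ and $\pi\to0$. Along every such sequence that satisfies the assumptions (with fixed constants) and conditions (i)–(iii), with $K$ bounded, and for every sequence of clusters $k$ with $b_k$ bounded, $\max_{j\in S_k}\|\hat\theta_j-\theta_j^*\|_2=O_P(N_k^{-1/2})$. -/

import Mathlib

open MeasureTheory ProbabilityTheory Filter Topology
open scoped ENNReal NNReal InnerProductSpace

universe u v w

noncomputable section

/-- The Euclidean space containing the target parameters. -/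
abbrev Vec (d : ℕ) : Type := EuclideanSpace ℝ (Fin d)

/-- The Hessian of a real function, as a continuous linear operator (its norm is the spectral norm):
the Fréchet derivative of the gradient. -/
def hessian {d : ℕ} (f : Vec d → ℝ) (x : Vec d) : Vec d →L[ℝ] Vec d :=
  fderiv ℝ (gradient f) x

/-- `f` and its gradient are differentiable at `x`, so that the gradient and the Hessian are
genuine derivatives. -/
def TwiceDifferentiableAt {d : ℕ} (f : Vec d → ℝ) (x : Vec d) : Prop :=
  DifferentiableAt ℝ f x ∧ DifferentiableAt ℝ (gradient f) x

section Gateaux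

variable {H F : Type*} [AddCommGroup H] [Module ℝ H] [NormedAddCommGroup F] [NormedSpace ℝ F]

/-- The Gâteaux derivative of `f` at `η` in direction `h` exists and equals `y`. -/
def HasGateauxDerivAt (f : H → F) (y : F) (η h : H) : Prop :=
  HasDerivAt (fun t : ℝ => f (η + t • h)) y 0

/-- The Gâteaux derivative `D f(η)[h] = d/dt f(η + t h)` at `t = 0`. -/
def gateauxDeriv (f : H → F) (η h : H) : F :=
  deriv (fun t : ℝ => f (η + t • h)) 0

/-- The second Gâteaux derivative `D² f(η)[h₁, h₂]`. -/
def gateauxDeriv₂ (f : H → F) (η h₁ h₂ : H) : F :=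
  gateauxDeriv (fun η' => gateauxDeriv f η' h₁) η h₂

/-- The derivatives `D f(η)[h]` and `D² f(η)[h, h]` exist. -/
def TwiceGateauxDifferentiableAt (f : H → F) (η h : H) : Prop :=
  HasGateauxDerivAt f (gateauxDeriv f η h) η h ∧
    HasGateauxDerivAt (fun η' => gateauxDeriv f η' h) (gateauxDeriv₂ f η h h) η h

end Gateaux

/-- A multitask experiment with `m` tasks in `K` latent clusters: the sample spaces, the laws of
the observations, the nuisance spaces, the orthogonal losses, the true parameters, the evaluation
samples, the nuisance estimators (independent of the evaluation samples) and the pilot estimators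
(arbitrary). -/
structure MTLExperiment (d : ℕ) where
  /-- number of tasks -/
  m : ℕ
  m_pos : 0 < m
  /-- size of the evaluation sample of each task -/
  n : Fin m → ℕ
  n_pos : ∀ j, 0 < n j
  /-- number of clusters -/
  K : ℕ
  /-- the cluster of a task; the clusters are the (nonempty) fibres -/
  cluster : Fin m → Fin K
  cluster_surjective : Function.Surjective cluster
  /-- parameter space -/
  Θ : Set (Vec d)
  /-- common target of the tasks of a cluster -/
  βstar : Fin K → Vec d
  /-- sample space of each task -/
  Sp : Fin m → Type v
  [measSp : ∀ j, MeasurableSpace (Sp j)]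
  /-- law of an observation of each task -/
  P : ∀ j, Measure (Sp j)
  [probP : ∀ j, IsProbabilityMeasure (P j)]
  /-- nuisance space of each task -/
  H : Fin m → Type w
  [normedH : ∀ j, NormedAddCommGroup (H j)]
  [spaceH : ∀ j, NormedSpace ℝ (H j)]
  [measH : ∀ j, MeasurableSpace (H j)]
  [borelH : ∀ j, BorelSpace (H j)]
  /-- true nuisance -/
  ηstar : ∀ j, H j
  /-- nuisance realization set -/
  T : ∀ j, Set (H j)
  measurableSet_T : ∀ j, MeasurableSet (T j)
  /-- the orthogonal loss -/
  loss : ∀ j, Vec d → H j → Sp j → ℝ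
  measurable_loss : ∀ j θ, Measurable (fun x : H j × Sp j => loss j θ x.1 x.2)
  /-- underlying probability space -/
  Ω : Type u
  [measΩ : MeasurableSpace Ω]
  Pr : Measure Ω
  [probΩ : IsProbabilityMeasure Pr]
  /-- the evaluation samples -/
  Z : ∀ j, Fin (n j) → Ω → Sp j
  measurable_Z : ∀ j i, Measurable (Z j i)
  law_Z : ∀ j i, Pr.map (Z j i) = P j
  indep_Z : iIndepFun (β := fun x : (Σ j, Fin (n j)) => Sp x.1) (fun x => Z x.1 x.2) Pr
  /-- the nuisance estimators -/
  ηhat : ∀ j, Ω → H j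
  measurable_ηhat : ∀ j, Measurable (ηhat j)
  /-- sample splitting -/
  indep_ηhat : IndepFun (fun ω j => ηhat j ω) (fun ω (x : Σ j, Fin (n j)) => Z x.1 x.2 ω) Pr
  /-- the pilot estimators -/
  θinit : Fin m → Ω → Vec d

attribute [instance] MTLExperiment.measSp MTLExperiment.probP MTLExperiment.normedH
  MTLExperiment.spaceH MTLExperiment.measH MTLExperiment.borelH MTLExperiment.measΩ
  MTLExperiment.probΩ

namespace MTLExperiment

variable {d : ℕ} (X : MTLExperiment.{u, v, w} d)

/-- True target of task `j`. -/
def θstar (j : Fin X.m) : Vec d := X.βstar (X.cluster j)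

/-- Smallest task sample size. -/
def nMin : ℕ := ⨅ j, X.n j

/-- Largest task sample size. -/
def nMax : ℕ := ⨆ j, X.n j

/-- Pooled sample size `N_k` of cluster `k`. -/
def N (k : Fin X.K) : ℕ := ∑ j with X.cluster j = k, X.n j

/-- Smallest pooled sample size. -/
def NMin : ℕ := ⨅ k, X.N k

/-- Number of tasks in cluster `k`. -/
def size (k : Fin X.K) : ℕ := (Finset.univ.filter fun j => X.cluster j = k).card

/-- `b_k = K m_k^{1/2} max_{j ∈ S_k} n_j^{1/2} s(n_j)^{-2}`. -/
def b (s : ℕ → ℝ) (k : Fin X.K) : ℝ :=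
  X.K * √(X.size k : ℝ) * ⨆ j : {j // X.cluster j = k}, √(X.n j : ℝ) * (s (X.n j) ^ 2)⁻¹

/-- Population risk. -/
def risk (j : Fin X.m) (θ : Vec d) (η : X.H j) : ℝ := ∫ z, X.loss j θ η z ∂X.P j

/-- Gradient of the population risk in the target parameter. -/
def gradRisk (j : Fin X.m) (θ : Vec d) (η : X.H j) : Vec d :=
  gradient (fun θ' => X.risk j θ' η) θ

/-- Population Hessian `H_j(θ)` at the true nuisance. -/
def hessRisk (j : Fin X.m) (θ : Vec d) : Vec d →L[ℝ] Vec d :=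
  hessian (fun θ' => X.risk j θ' (X.ηstar j)) θ

/-- Gradient of the loss in the target parameter. -/
def gradLoss (j : Fin X.m) (θ : Vec d) (η : X.H j) (z : X.Sp j) : Vec d :=
  gradient (fun θ' => X.loss j θ' η z) θ

/-- Hessian of the loss in the target parameter. -/
def hessLoss (j : Fin X.m) (θ : Vec d) (η : X.H j) (z : X.Sp j) : Vec d →L[ℝ] Vec d :=
  hessian (fun θ' => X.loss j θ' η z) θ

/-- The Lipschitz ratio of the Hessian of the loss over the two balls of radius `M`, for an
observation `z`. -/
def hessLip (M : ℝ) (j : Fin X.m) (z : X.Sp j) : ℝ≥0∞ :=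
  ⨆ (x : Vec d × X.H j) (y : Vec d × X.H j)
    (_ : x.1 ∈ Metric.closedBall (X.θstar j) M ∧ x.2 ∈ Metric.closedBall (X.ηstar j) M)
    (_ : y.1 ∈ Metric.closedBall (X.θstar j) M ∧ y.2 ∈ Metric.closedBall (X.ηstar j) M)
    (_ : x ≠ y),
    ‖X.hessLoss j x.1 x.2 z - X.hessLoss j y.1 y.2 z‖ₑ / (‖x.1 - y.1‖ₑ + ‖x.2 - y.2‖ₑ)

/-- The targets minimize the population risks, and those of different clusters are at distance at
least `δ`. -/
structure ClusteredTargets (δ : ℝ) : Prop where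
  mem : ∀ j, X.θstar j ∈ X.Θ
  integrable : ∀ j, ∀ θ ∈ X.Θ, Integrable (X.loss j θ (X.ηstar j)) (X.P j)
  isMin : ∀ j, IsMinOn (fun θ => X.risk j θ (X.ηstar j)) X.Θ (X.θstar j)
  separated : ∀ k k', k ≠ k' → δ ≤ ‖X.βstar k - X.βstar k'‖

/-- Loss regularity. The expectation in `hessian_lipschitz` is that of a measurable majorant, since
a supremum over an uncountable set need not be measurable. -/
structure LossRegular (M ρ κ σ₁ σ₂ σ₃ σ₅ r₁ r₂ : ℝ) : Prop where
  ball_subset : ∀ j, Metric.closedBall (X.θstar j) M ⊆ X.Θ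
  convex : ∀ j, ∀ η ∈ Metric.closedBall (X.ηstar j) M, ∀ z,
    ConvexOn ℝ X.Θ (fun θ => X.loss j θ η z)
  loss_twice_differentiable : ∀ j, ∀ θ ∈ Metric.closedBall (X.θstar j) M,
    ∀ η ∈ Metric.closedBall (X.ηstar j) M, ∀ z,
      TwiceDifferentiableAt (fun θ' => X.loss j θ' η z) θ
  loss_integrable : ∀ j, ∀ θ ∈ Metric.closedBall (X.θstar j) M,
    ∀ η ∈ Metric.closedBall (X.ηstar j) M, Integrable (X.loss j θ η) (X.P j)
  risk_twice_differentiable : ∀ j, ∀ θ ∈ Metric.closedBall (X.θstar j) M,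
    TwiceDifferentiableAt (fun θ' => X.risk j θ' (X.ηstar j)) θ
  curvature : ∀ j, ∀ θ ∈ Metric.closedBall (X.θstar j) M,
    (X.hessRisk j θ - ρ • ContinuousLinearMap.id ℝ (Vec d)).IsPositive ∧
      (κ • ContinuousLinearMap.id ℝ (Vec d) - X.hessRisk j θ).IsPositive
  score_mean : ∀ j, X.gradRisk j (X.θstar j) (X.ηstar j) = 0
  score_moment : ∀ j,
    ∫⁻ z, ‖X.gradLoss j (X.θstar j) (X.ηstar j) z‖ₑ ^ r₁ ∂X.P j ≤ ENNReal.ofReal σ₁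
  hessian_moment : ∀ j, ∀ v : Vec d, ‖v‖ = 1 → ∀ θ ∈ Metric.closedBall (X.θstar j) M,
    ∫⁻ z, ‖⟪v, (X.hessLoss j θ (X.ηstar j) z - X.hessRisk j θ) v⟫_ℝ‖ₑ ^ r₂ ∂X.P j
      ≤ ENNReal.ofReal σ₂
  hessian_lipschitz : ∀ j, ∃ L : X.Sp j → ℝ≥0∞, Measurable L ∧ (∀ z, X.hessLip M j z ≤ L z) ∧
    ∫⁻ z, L z ∂X.P j ≤ ENNReal.ofReal σ₃
  orthogonality : ∀ j, ∀ η ∈ X.T j,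
    HasGateauxDerivAt (fun η' => X.gradRisk j (X.θstar j) η') 0 (X.ηstar j) (η - X.ηstar j)
  twice_gateaux : ∀ j, ∀ η ∈ X.T j, ∀ ηbar ∈ segment ℝ (X.ηstar j) η, ∀ z,
    TwiceGateauxDifferentiableAt (fun η' => X.gradLoss j (X.θstar j) η' z) ηbar (η - X.ηstar j)
  first_moment_bound : ∀ j, ∀ η ∈ X.T j, ∀ ηbar ∈ segment ℝ (X.ηstar j) η,
    ∫⁻ z, ‖gateauxDeriv (fun η' => X.gradLoss j (X.θstar j) η' z) ηbar (η - X.ηstar j)‖ₑ ^ 2 ∂X.P j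
      ≤ ENNReal.ofReal (σ₅ * ‖η - X.ηstar j‖ ^ 2)
  second_moment_bound : ∀ j, ∀ η ∈ X.T j, ∀ ηbar ∈ segment ℝ (X.ηstar j) η,
    ∫⁻ z, ‖gateauxDeriv₂ (fun η' => X.gradLoss j (X.θstar j) η' z) ηbar
        (η - X.ηstar j) (η - X.ηstar j)‖ₑ ∂X.P j
      ≤ ENNReal.ofReal (σ₅ * ‖η - X.ηstar j‖ ^ 2)

/-- The nuisance estimators have mean square error at most `σ₄ / s(n_j)²`. -/
def NuisanceRate (σ₄ : ℝ) (s : ℕ → ℝ) : Prop :=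
  ∀ j, ∫⁻ ω, ‖X.ηhat j ω - X.ηstar j‖ₑ ^ 2 ∂X.Pr ≤ ENNReal.ofReal (σ₄ / s (X.n j) ^ 2)

/-- The pilot estimators are consistent at rate `n_j^α`, jointly over the tasks, with failure
probability at most `p ε n_min` at level `ε`. -/
def PilotConsistent (α : ℝ) (p : ℝ → ℕ → ℝ≥0) : Prop :=
  ∀ ε : ℝ, 0 < ε →
    X.Pr {ω | ¬ ∀ j, (X.n j : ℝ) ^ α * ‖X.θinit j ω - X.θstar j‖ < ε} ≤ p ε X.nMin

/-- Probability that some nuisance estimator is outside its realization set. -/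
def missProb : ℝ≥0∞ := X.Pr {ω | ∃ j, X.ηhat j ω ∉ X.T j}

/-- The upper end of the range of `t`. If the nuisance estimators lie in their realization sets
almost surely and `s` is nondecreasing, it is `c m⁻¹ min (n_min^{r₂/(2(r₂+d))}, s(n_min))`. -/
def tMax (c r₂ : ℝ) (s : ℕ → ℝ) : ℝ≥0∞ :=
  ENNReal.ofReal c *
    min (ENNReal.ofReal ((X.m : ℝ)⁻¹ * min ((X.nMin : ℝ) ^ (r₂ / (2 * (r₂ + d)))) (⨅ j, s (X.n j))))
      X.missProb⁻¹

/-- Adaptive weight `c_w ‖θ̂_j^init - θ̂_j'^init‖^{-γ}`, infinite if the pilot estimates agree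
and `γ > 0`. -/
def weight (cw γ : ℝ) (ω : X.Ω) (j j' : Fin X.m) : ℝ≥0∞ :=
  ENNReal.ofReal cw * ‖X.θinit j ω - X.θinit j' ω‖ₑ ^ (-γ)

/-- Thresholded penalty `λ_{jj'}`. -/
def penalty (cw γ τ ε : ℝ) (ω : X.Ω) (j j' : Fin X.m) : ℝ≥0∞ :=
  open Classical in
  if X.weight cw γ ω j j' ≤ ENNReal.ofReal τ then ENNReal.ofReal ε else X.weight cw γ ω j j'

/-- The fused criterion. An infinite penalty enforces equality (`∞ * 0 = 0`). -/
def criterion (cw γ τ ε : ℝ) (ω : X.Ω) (θ : Fin X.m → Vec d) : EReal :=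
  ((∑ j, ∑ i, X.loss j (θ j) (X.ηhat j ω) (X.Z j i ω) : ℝ) : EReal) +
    ((∑ j, ∑ j' with j' < j, X.penalty cw γ τ ε ω j j' * ‖θ j - θ j'‖ₑ : ℝ≥0∞) : EReal)

/-- `θ` minimizes the fused criterion over `Θ^m`. -/
def IsMinimizer (cw γ τ ε : ℝ) (ω : X.Ω) (θ : Fin X.m → Vec d) : Prop :=
  (∀ j, θ j ∈ X.Θ) ∧
    IsMinOn (X.criterion cw γ τ ε ω) {θ' | ∀ j, θ' j ∈ X.Θ} θ

/-- `θhat` is an adaptive fused orthogonal estimator: a minimizer of the fused criterion at every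
outcome at which there is one. -/
def IsFusedEstimator (cw γ τ ε : ℝ) (θhat : X.Ω → Fin X.m → Vec d) : Prop :=
  ∀ ω, (∃ θ, X.IsMinimizer cw γ τ ε ω θ) → X.IsMinimizer cw γ τ ε ω (θhat ω)

/-- The conditions on the tuning parameters `γ`, `ε`, `τ`. -/
def Tuned (c₀ c₁ c₂ α ζ γ τ ε : ℝ) : Prop :=
  c₀ * X.nMax ≤ (X.nMin : ℝ) ^ (α * γ) ∧
    0 ≤ ε ∧ ε ≤ c₁ * ((X.m : ℝ) ^ 2)⁻¹ * (X.NMin : ℝ) ^ ζ ∧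
    c₂ < τ ∧ τ < c₂ * (X.nMin : ℝ) ^ (α * γ)

end MTLExperiment

end

/-! ### Taylor expansions of order two along a segment -/

/-! The argument has a deterministic half, about convex functions joined by a fusion penalty, and a
probabilistic half, which shows that the sample losses meet its hypotheses.

Deterministic half (`fusedObjective_exact_clustering`). Suppose each task loss is convex, Lipschitz
with constant `G` on a ball of radius `r` around the target of its cluster, and lies above a
quadratic there. Let the penalty have weight `Λ` inside clusters and `ε` across. A minimizer over
cluster-wise constant vectors in these balls is pulled into their interior, because within a cluster
the pooled gradient is small against the pooled curvature. Any competitor can then be moved along a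
segment towards it until it enters the balls. Replacing each task there by a representative of its
cluster costs at most `G + 2εm` per unit of displacement and saves `Λ`. Hence for `Λ > G + 2εm`
every minimizer is constant on clusters, and its distance to the target is pooled gradient plus
`εm²`, over pooled curvature. If the pilots are accurate, the penalty is at least `Λ = c₂
n_min^{αγ}` inside clusters and equal to `ε` across. So the true criterion dominates this model and
agrees with it on cluster-wise constant vectors, whose within-cluster penalties vanish even when
infinite.

Probabilistic half, gathered in `SampleRegular` and `measure_not_sampleRegular_le`:

Curvature. Observations whose Hessian has Lipschitz ratio at most `A` give a quadratic lower bound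
with Hessian frozen at the truth; the others contribute nonnegatively by convexity. The truncated
mean form is still at least `3ρ/4`, and by polarization its fluctuation is controlled on finitely
many vectors, so Chebyshev suffices and no covering of the ball is needed.

Lipschitz bound. A convex function bounded above at the vertices of a cross-polytope is Lipschitz
near its centre, so only `2d` values per task are controlled.

Pooled score. At the true nuisance a moment inequality of order `r₁` gives `√N_k`, and a union over
clusters gives `K^{1/r₁}`. Replacing the true nuisance by the estimate changes the sum by a term
whose mean is quadratic in the nuisance error, by orthogonality, and whose variance is controlled by
the squared error too. Independence allows Chebyshev with the nuisance frozen, and integrating over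
it gives `b_k`.

For `t < a`, the number `W = m t / c` is below every `√n_j` and `s(n_j)`, so the per-task failures
sum to order `m / W = c / t`. The bias `εm²` is at most `√N_k` and is absorbed into the main term.
-/

theorem taylor_two_le {φ φ' φ'' : ℝ → ℝ} {B : ℝ}
    (h1 : ∀ t ∈ Set.Icc (0 : ℝ) 1, HasDerivAt φ (φ' t) t)
    (h2 : ∀ t ∈ Set.Icc (0 : ℝ) 1, HasDerivAt φ' (φ'' t) t)
    (hB : ∀ t ∈ Set.Icc (0 : ℝ) 1, φ'' t ≤ B) : φ 1 - φ 0 - φ' 0 ≤ B / 2 := by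
  have hd : ∀ t ∈ Set.Icc (0 : ℝ) 1,
      HasDerivAt (fun t => φ t - t * φ' 0 - B * t ^ 2 / 2) (φ' t - φ' 0 - B * t) t := by
    intro t ht
    have := ((h1 t ht).sub ((hasDerivAt_id t).mul_const (φ' 0))).sub
      ((((hasDerivAt_id t).pow 2).const_mul B).div_const 2)
    convert! this using 1
    simp; ring
  -- Two mean value steps: the excess over `B / 2` equals `φ' x - φ' 0 - B x` for some `x`, and `φ'
  -- x - φ' 0 = x φ'' y ≤ B x`. No integrability of `φ''` is involved.
  obtain ⟨x, hx, hx'⟩ := exists_hasDerivAt_eq_slope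
    (fun t => φ t - t * φ' 0 - B * t ^ 2 / 2) (fun t => φ' t - φ' 0 - B * t) zero_lt_one
    (fun t ht => (hd t ht).continuousAt.continuousWithinAt)
    (fun t ht => hd t (Set.Ioo_subset_Icc_self ht))
  have hsub : ∀ t ∈ Set.Icc 0 x, t ∈ Set.Icc (0 : ℝ) 1 := fun t ht => ⟨ht.1, ht.2.trans hx.2.le⟩
  obtain ⟨y, hy, hy'⟩ := exists_hasDerivAt_eq_slope φ' φ'' hx.1
    (fun t ht => (h2 t (hsub t ht)).continuousAt.continuousWithinAt)
    (fun t ht => h2 t (hsub t (Set.Ioo_subset_Icc_self ht)))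
  have hy2 := hB y (hsub y (Set.Ioo_subset_Icc_self hy))
  rw [hy', sub_zero, div_le_iff₀ hx.1] at hy2
  simp at hx'
  linarith

theorem abs_taylor_two_sub_le {φ φ' φ'' : ℝ → ℝ} {B D : ℝ}
    (h1 : ∀ t ∈ Set.Icc (0 : ℝ) 1, HasDerivAt φ (φ' t) t)
    (h2 : ∀ t ∈ Set.Icc (0 : ℝ) 1, HasDerivAt φ' (φ'' t) t)
    (hB : ∀ t ∈ Set.Icc (0 : ℝ) 1, |φ'' t - B| ≤ D) : |φ 1 - φ 0 - φ' 0 - B / 2| ≤ D / 2 := by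
  have a := taylor_two_le h1 h2 (B := B + D) fun t ht => by linarith [(abs_le.1 (hB t ht)).2]
  have b := taylor_two_le (fun t ht => (h1 t ht).neg) (fun t ht => (h2 t ht).neg) (B := D - B)
    fun t ht => by linarith [(abs_le.1 (hB t ht)).1]
  simp only [Pi.neg_apply] at b
  rw [abs_le]; constructor <;> linarith

/-! ### Moments of increments from moments of derivatives -/

section Increment

variable {S : Type*} [MeasurableSpace S]

theorem tendsto_slope_Icc {f : ℝ → ℝ} {f' t : ℝ} (hd : HasDerivWithinAt f f' (Set.Icc 0 1) t)
    {y : ℕ → ℝ} (hy : ∀ n, y n ∈ Set.Icc (0 : ℝ) 1) (hne : ∀ n, y n ≠ t)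
    (hlim : Tendsto y atTop (𝓝 t)) :
    Tendsto (fun n => (f (y n) - f t) / (y n - t)) atTop (𝓝 f') := by
  have h := hasDerivWithinAt_iff_tendsto_slope.1 hd
  have h2 : Tendsto y atTop (𝓝[Set.Icc 0 1 \ {t}] t) :=
    tendsto_nhdsWithin_iff.2 ⟨hlim, Eventually.of_forall fun n => ⟨hy n, hne n⟩⟩
  refine (h.comp h2).congr fun n => ?_
  simp [slope_def_field]

theorem tendsto_div_add_two (a : ℝ) : Tendsto (fun n : ℕ => a / ((n : ℝ) + 2)) atTop (𝓝 0) := by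
  refine tendsto_const_nhds.div_atTop ?_
  exact tendsto_atTop_add_const_right _ _ tendsto_natCast_atTop_atTop

theorem measurable_of_hasDerivWithinAt_Icc {φ φ' : ℝ → S → ℝ}
    (hm : ∀ t ∈ Set.Icc (0 : ℝ) 1, Measurable (φ t))
    (hd : ∀ z, ∀ t ∈ Set.Icc (0 : ℝ) 1,
      HasDerivWithinAt (fun t => φ t z) (φ' t z) (Set.Icc 0 1) t) :
    ∀ t ∈ Set.Icc (0 : ℝ) 1, Measurable (φ' t) := by
  intro t ht
  obtain ⟨y, hy, hne, hlim⟩ : ∃ y : ℕ → ℝ, (∀ n, y n ∈ Set.Icc (0 : ℝ) 1) ∧ (∀ n, y n ≠ t) ∧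
      Tendsto y atTop (𝓝 t) := by
    have key : ∀ b ∈ Set.Icc (0 : ℝ) 1, b ≠ t → ∃ y : ℕ → ℝ, (∀ n, y n ∈ Set.Icc (0 : ℝ) 1) ∧
        (∀ n, y n ≠ t) ∧ Tendsto y atTop (𝓝 t) := by
      intro b hb hbt
      refine ⟨fun n => t + (b - t) / ((n : ℝ) + 2), fun n => ?_, fun n => ?_, ?_⟩
      · have hn : (0 : ℝ) < (n : ℝ) + 2 := by positivity
        have := (convex_Icc (0 : ℝ) 1).add_smul_sub_mem ht hb
          (t := 1 / ((n : ℝ) + 2)) ⟨by positivity, by rw [div_le_one hn]; linarith [n.cast_nonneg (α := ℝ)]⟩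
        convert! this using 1
        simp; ring
      · have hn : (n : ℝ) + 2 ≠ 0 := by positivity
        simp [sub_eq_zero, hbt, hn]
      · simpa using (tendsto_div_add_two (b - t)).const_add t
    rcases eq_or_ne t 1 with rfl | h
    · exact key 0 (by simp) (by simp)
    · exact key 1 (by simp) h.symm
  refine measurable_of_tendsto_metrizable
    (f := fun n z => (φ (y n) z - φ t z) / (y n - t)) (fun n => ?_) ?_
  · exact ((hm _ (hy n)).sub (hm t ht)).div_const _
  · rw [tendsto_pi_nhds]
    exact fun z => tendsto_slope_Icc (hd z t ht) hy hne hlim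

/-- The derivative is the limit of jointly measurable right difference quotients with nodes `t + (1
- t) / (n + 2)`, which stay in the unit interval. At `t = 1` they degenerate, hence the half-open
interval. -/
theorem measurable_uncurry_deriv_Ico {φ φ' : ℝ → S → ℝ}
    (hm : ∀ t ∈ Set.Icc (0 : ℝ) 1, Measurable (φ t))
    (hd : ∀ z, ∀ t ∈ Set.Icc (0 : ℝ) 1,
      HasDerivWithinAt (fun t => φ t z) (φ' t z) (Set.Icc 0 1) t) :
    Measurable ((Set.Ico (0 : ℝ) 1 ×ˢ (Set.univ : Set S)).indicator (Function.uncurry φ')) := by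
  -- Clamping `t` to the unit interval makes the process continuous in `t` on the whole line, so
  -- that continuity in `t` and measurability in `z` give joint measurability.
  set ψ : ℝ → S → ℝ := fun t => φ (Set.projIcc 0 1 zero_le_one t) with hψ
  have hmψ : Measurable (Function.uncurry ψ) := by
    refine measurable_uncurry_of_continuous_of_measurable (fun z => ?_)
      fun t => hm _ (Set.projIcc 0 1 zero_le_one t).2
    have : ContinuousOn (fun t => φ t z) (Set.Icc 0 1) := fun t ht => (hd z t ht).continuousWithinAt
    exact (continuousOn_iff_continuous_domRestrict.1 this).comp continuous_projIcc
  have hset : MeasurableSet (Set.Ico (0 : ℝ) 1 ×ˢ (Set.univ : Set S)) :=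
    measurableSet_Ico.prod MeasurableSet.univ
  refine measurable_of_tendsto_metrizable
    (f := fun (n : ℕ) => (Set.Ico (0 : ℝ) 1 ×ˢ (Set.univ : Set S)).indicator fun x : ℝ × S =>
      (ψ (x.1 + (1 - x.1) / ((n : ℝ) + 2)) x.2 - ψ x.1 x.2)
        / (x.1 + (1 - x.1) / ((n : ℝ) + 2) - x.1)) (fun n => ?_) ?_
  · refine Measurable.indicator ?_ hset
    have h1 : Measurable fun x : ℝ × S => (x.1 + (1 - x.1) / ((n : ℝ) + 2), x.2) := by fun_prop
    exact ((hmψ.comp h1).sub hmψ).div (by fun_prop)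
  · rw [tendsto_pi_nhds]
    rintro ⟨t, z⟩
    by_cases ht : t ∈ Set.Ico (0 : ℝ) 1
    · have hmem : (t, z) ∈ Set.Ico (0 : ℝ) 1 ×ˢ (Set.univ : Set S) := ⟨ht, trivial⟩
      simp only [Set.indicator_of_mem hmem, Function.uncurry]
      have hy : ∀ n : ℕ, t + (1 - t) / ((n : ℝ) + 2) ∈ Set.Icc (0 : ℝ) 1 := by
        intro n
        have hn : (1 : ℝ) ≤ (n : ℝ) + 2 := by linarith [n.cast_nonneg (α := ℝ)]
        have h0 : 0 ≤ (1 - t) / ((n : ℝ) + 2) := div_nonneg (by linarith [ht.2]) (by linarith)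
        have h1 := div_le_self (show 0 ≤ 1 - t by linarith [ht.2]) hn
        exact ⟨by linarith [ht.1], by linarith⟩
      have := tendsto_slope_Icc (hd z t ⟨ht.1, ht.2.le⟩) hy (fun n => by
        have hn : (n : ℝ) + 2 ≠ 0 := by positivity
        have h1 : 1 - t ≠ 0 := by linarith [ht.2]
        simp [h1, hn]) (by simpa using (tendsto_div_add_two (1 - t)).const_add t)
      refine this.congr fun n => ?_
      simp only [hψ]
      rw [Set.projIcc_of_mem _ (hy n), Set.projIcc_of_mem _ (⟨ht.1, ht.2.le⟩ : t ∈ Set.Icc (0:ℝ) 1)]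
    · have hmem : (t, z) ∉ Set.Ico (0 : ℝ) 1 ×ˢ (Set.univ : Set S) := fun h => ht h.1
      simp [Set.indicator_of_notMem hmem]

/-- The fundamental theorem of calculus writes the increment as an average of the derivative over
the unit interval; Jensen moves the power inside and Tonelli exchanges the integrals. This turns
moments of derivatives at fixed points into moments of increments without any uniform domination. -/
theorem lintegral_enorm_sub_rpow_le {μ : Measure S} [SFinite μ] {φ φ' : ℝ → S → ℝ}
    (hm : ∀ t ∈ Set.Icc (0 : ℝ) 1, Measurable (φ t))
    (hd : ∀ z, ∀ t ∈ Set.Icc (0 : ℝ) 1,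
      HasDerivWithinAt (fun t => φ t z) (φ' t z) (Set.Icc 0 1) t)
    {p : ℝ} (hp : 1 ≤ p) {B : ℝ≥0∞}
    (hB : ∀ t ∈ Set.Icc (0 : ℝ) 1, ∫⁻ z, ‖φ' t z‖ₑ ^ p ∂μ ≤ B) :
    ∫⁻ z, ‖φ 1 z - φ 0 z‖ₑ ^ p ∂μ ≤ B := by
  have hp0 : 0 ≤ p := by linarith
  set ψ := (Set.Ico (0 : ℝ) 1 ×ˢ (Set.univ : Set S)).indicator (Function.uncurry φ') with hψ
  have hmψ : Measurable ψ := measurable_uncurry_deriv_Ico hm hd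
  have hψ_eq : ∀ t ∈ Set.Ico (0 : ℝ) 1, ∀ z, ψ (t, z) = φ' t z := fun t ht z =>
    Set.indicator_of_mem (s := Set.Ico (0 : ℝ) 1 ×ˢ (Set.univ : Set S)) ⟨ht, trivial⟩ _
  set ν : Measure ℝ := volume.restrict (Set.Ico 0 1)
  have hν : ν Set.univ = 1 := by simp [ν]
  have : IsProbabilityMeasure ν := ⟨hν⟩
  have hpt : ∀ z, ‖φ 1 z - φ 0 z‖ₑ ^ p ≤ ∫⁻ t, ‖ψ (t, z)‖ₑ ^ p ∂ν := by
    intro z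
    have hmz : Measurable fun t => ψ (t, z) := hmψ.comp (by fun_prop)
    have h1 : ‖φ 1 z - φ 0 z‖ₑ ≤ ∫⁻ t, ‖ψ (t, z)‖ₑ ∂ν := by
      -- If the derivative is not integrable in `t`, the fundamental theorem may fail, but the right
      -- side is infinite.
      by_cases htop : ∫⁻ t, ‖ψ (t, z)‖ₑ ∂ν = ∞
      · simp [htop]
      have hint : Integrable (fun t => ψ (t, z)) ν :=
        ⟨hmz.aestronglyMeasurable, lt_top_iff_ne_top.2 htop⟩
      have hint' : IntervalIntegrable (fun t => ψ (t, z)) volume 0 1 := by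
        rw [intervalIntegrable_iff_integrableOn_Ico_of_le zero_le_one]; exact hint
      have hftc := intervalIntegral.integral_eq_sub_of_hasDerivAt_of_le (f := fun t => φ t z)
        zero_le_one (fun t ht => (hd z t ht).continuousWithinAt) (fun t ht => by
          rw [hψ_eq t ⟨ht.1.le, ht.2⟩ z]
          exact (hd z t (Set.Ioo_subset_Icc_self ht)).hasDerivAt (Icc_mem_nhds ht.1 ht.2)) hint'
      rw [← hftc, intervalIntegral.integral_of_le zero_le_one, ← integral_Ico_eq_integral_Ioc]
      exact enorm_integral_le_lintegral_enorm _
    refine (ENNReal.rpow_le_rpow h1 hp0).trans ?_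
    have h2 := eLpNorm'_le_eLpNorm'_of_exponent_le (μ := ν) zero_lt_one hp
      hmz.aestronglyMeasurable
    simp only [eLpNorm', ENNReal.rpow_one, div_one, one_div] at h2
    calc _ ≤ ((∫⁻ t, ‖ψ (t, z)‖ₑ ^ p ∂ν) ^ p⁻¹) ^ p := ENNReal.rpow_le_rpow h2 hp0
      _ = _ := by rw [← ENNReal.rpow_mul, inv_mul_cancel₀ (by linarith), ENNReal.rpow_one]
  calc ∫⁻ z, ‖φ 1 z - φ 0 z‖ₑ ^ p ∂μ ≤ ∫⁻ z, ∫⁻ t, ‖ψ (t, z)‖ₑ ^ p ∂ν ∂μ := lintegral_mono hpt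
    _ = ∫⁻ t, ∫⁻ z, ‖ψ (t, z)‖ₑ ^ p ∂μ ∂ν := by
        refine lintegral_lintegral_swap ?_
        exact (((hmψ.comp measurable_swap).enorm).pow_const p).aemeasurable
    _ ≤ ∫⁻ _, B ∂ν := by
        refine lintegral_mono_ae ?_
        filter_upwards [ae_restrict_mem measurableSet_Ico] with t ht
        simp_rw [hψ_eq t ht]
        exact hB t ⟨ht.1, ht.2.le⟩
    _ = B := by simp

theorem hasDerivWithinAt_Icc_comp_mul {f : ℝ → ℝ} {f' : ℝ} {t s : ℝ} (ht : t ∈ Set.Icc (0 : ℝ) 1)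
    (h : HasDerivWithinAt f f' (Set.Icc 0 1) (t * s)) :
    HasDerivWithinAt (fun s => f (t * s)) (t * f') (Set.Icc 0 1) s := by
  have h2 : HasDerivWithinAt (fun s : ℝ => t * s) t (Set.Icc 0 1) s := by
    simpa using ((hasDerivAt_id s).const_mul t).hasDerivWithinAt
  have := h.comp s h2 (fun x hx => ⟨mul_nonneg ht.1 hx.1, mul_le_one₀ ht.2 hx.1 hx.2⟩)
  rw [mul_comm]
  exact this

theorem mul_mem_Icc_zero_one {t s : ℝ} (ht : t ∈ Set.Icc (0 : ℝ) 1) (hs : s ∈ Set.Icc (0 : ℝ) 1) :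
    t * s ∈ Set.Icc (0 : ℝ) 1 := ⟨mul_nonneg ht.1 hs.1, mul_le_one₀ ht.2 hs.1 hs.2⟩

theorem lintegral_enorm_sub_zero_rpow_le {μ : Measure S} [SFinite μ] {φ φ' : ℝ → S → ℝ}
    (hm : ∀ t ∈ Set.Icc (0 : ℝ) 1, Measurable (φ t))
    (hd : ∀ z, ∀ t ∈ Set.Icc (0 : ℝ) 1,
      HasDerivWithinAt (fun t => φ t z) (φ' t z) (Set.Icc 0 1) t)
    {p : ℝ} (hp : 1 ≤ p) {B : ℝ≥0∞}
    (hB : ∀ t ∈ Set.Icc (0 : ℝ) 1, ∫⁻ z, ‖φ' t z‖ₑ ^ p ∂μ ≤ B) {t : ℝ}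
    (ht : t ∈ Set.Icc (0 : ℝ) 1) : ∫⁻ z, ‖φ t z - φ 0 z‖ₑ ^ p ∂μ ≤ B := by
  have := lintegral_enorm_sub_rpow_le (μ := μ) (φ := fun s => φ (t * s))
    (φ' := fun s z => t * φ' (t * s) z) (fun s hs => hm _ (mul_mem_Icc_zero_one ht hs))
    (fun z s hs => hasDerivWithinAt_Icc_comp_mul (f := fun s => φ s z) ht
      (hd z _ (mul_mem_Icc_zero_one ht hs))) hp (B := B) (fun s hs => by
      refine le_trans (lintegral_mono fun z => ?_) (hB _ (mul_mem_Icc_zero_one ht hs))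
      refine ENNReal.rpow_le_rpow ?_ (by linarith)
      rw [enorm_mul]
      refine mul_le_of_le_one_left' ?_
      rw [Real.enorm_eq_ofReal ht.1]
      exact ENNReal.ofReal_le_one.2 ht.2)
  simpa using this

/-- The increment bound is used twice: for `φ'`, and then for `φ s - s φ' 0`, whose derivative is
`φ' s - φ' 0`. The factor one half of Taylor's formula is given up. -/
theorem lintegral_enorm_taylor_two_rpow_le {μ : Measure S} [SFinite μ] {φ φ' φ'' : ℝ → S → ℝ}
    (hm : ∀ t ∈ Set.Icc (0 : ℝ) 1, Measurable (φ t))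
    (hd : ∀ z, ∀ t ∈ Set.Icc (0 : ℝ) 1,
      HasDerivWithinAt (fun t => φ t z) (φ' t z) (Set.Icc 0 1) t)
    (hd' : ∀ z, ∀ t ∈ Set.Icc (0 : ℝ) 1,
      HasDerivWithinAt (fun t => φ' t z) (φ'' t z) (Set.Icc 0 1) t)
    {p : ℝ} (hp : 1 ≤ p) {B : ℝ≥0∞}
    (hB : ∀ t ∈ Set.Icc (0 : ℝ) 1, ∫⁻ z, ‖φ'' t z‖ₑ ^ p ∂μ ≤ B) :
    ∫⁻ z, ‖φ 1 z - φ 0 z - φ' 0 z‖ₑ ^ p ∂μ ≤ B := by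
  have hm' := measurable_of_hasDerivWithinAt_Icc hm hd
  have h0 : (0 : ℝ) ∈ Set.Icc (0 : ℝ) 1 := by simp
  have step : ∀ t ∈ Set.Icc (0 : ℝ) 1, ∫⁻ z, ‖φ' t z - φ' 0 z‖ₑ ^ p ∂μ ≤ B := fun t ht =>
    lintegral_enorm_sub_zero_rpow_le hm' hd' hp hB ht
  have := lintegral_enorm_sub_rpow_le (μ := μ) (φ := fun s z => φ s z - s * φ' 0 z)
      (φ' := fun s z => φ' s z - φ' 0 z)
      (fun s hs => (hm s hs).sub ((hm' 0 h0).const_mul s)) (fun z s hs => by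
        have h2 : HasDerivWithinAt (fun s : ℝ => s * φ' 0 z) (φ' 0 z) (Set.Icc 0 1) s := by
          simpa using ((hasDerivAt_id s).mul_const (φ' 0 z)).hasDerivWithinAt
        exact (hd z s hs).sub h2) hp step
  refine le_of_eq_of_le (lintegral_congr fun z => ?_) this
  congr 2
  ring

/-- Along the slowed path `s ↦ φ (t s)` the second derivative gains `t²`. This makes the remainder
negligible against `t`, which identifies a derivative of an integral without differentiating under
it. -/
theorem lintegral_enorm_taylor_two_scaled_le {μ : Measure S} [SFinite μ] {φ φ' φ'' : ℝ → S → ℝ}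
    (hm : ∀ t ∈ Set.Icc (0 : ℝ) 1, Measurable (φ t))
    (hd : ∀ z, ∀ t ∈ Set.Icc (0 : ℝ) 1,
      HasDerivWithinAt (fun t => φ t z) (φ' t z) (Set.Icc 0 1) t)
    (hd' : ∀ z, ∀ t ∈ Set.Icc (0 : ℝ) 1,
      HasDerivWithinAt (fun t => φ' t z) (φ'' t z) (Set.Icc 0 1) t) {B : ℝ≥0∞}
    (hB : ∀ t ∈ Set.Icc (0 : ℝ) 1, ∫⁻ z, ‖φ'' t z‖ₑ ∂μ ≤ B) {t : ℝ} (ht : t ∈ Set.Icc (0 : ℝ) 1) :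
    ∫⁻ z, ‖φ t z - φ 0 z - t * φ' 0 z‖ₑ ∂μ ≤ ENNReal.ofReal (t ^ 2) * B := by
  have := lintegral_enorm_taylor_two_rpow_le (μ := μ) (φ := fun s => φ (t * s))
      (φ' := fun s z => t * φ' (t * s) z) (φ'' := fun s z => t * (t * φ'' (t * s) z))
      (fun s hs => hm _ (mul_mem_Icc_zero_one ht hs))
      (fun z s hs => hasDerivWithinAt_Icc_comp_mul (f := fun s => φ s z) ht
        (hd z _ (mul_mem_Icc_zero_one ht hs)))
      (fun z s hs => (hasDerivWithinAt_Icc_comp_mul (f := fun s => φ' s z) ht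
        (hd' z _ (mul_mem_Icc_zero_one ht hs))).const_mul t) le_rfl
      (B := ENNReal.ofReal (t ^ 2) * B) (fun s hs => by
        simp only [ENNReal.rpow_one, ← mul_assoc, ← sq, enorm_mul]
        rw [lintegral_const_mul' _ _ (by simp), enorm_pow, Real.enorm_eq_ofReal ht.1,
          ← ENNReal.ofReal_pow ht.1]
        gcongr
        exact hB _ (mul_mem_Icc_zero_one ht hs))
  simpa using this

end Increment

/-! ### Derivatives along lines -/

section Line

variable {d : ℕ}

theorem hasDerivAt_line (x v : Vec d) (t : ℝ) : HasDerivAt (fun t : ℝ => x + t • v) v t := by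
  simpa using ((hasDerivAt_id t).smul_const v).const_add x

theorem DifferentiableAt.hasDerivAt_line {f : Vec d → ℝ} {x v : Vec d} {t : ℝ}
    (h : DifferentiableAt ℝ f (x + t • v)) :
    HasDerivAt (fun t : ℝ => f (x + t • v)) ⟪gradient f (x + t • v), v⟫_ℝ t := by
  have := h.hasFDerivAt.comp_hasDerivAt t (_root_.hasDerivAt_line x v t)
  have h2 : ⟪gradient f (x + t • v), v⟫_ℝ = fderiv ℝ f (x + t • v) v := by simp [gradient]
  rw [h2]
  exact this

theorem TwiceDifferentiableAt.hasDerivAt_line {f : Vec d → ℝ} {x v : Vec d} {t : ℝ}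
    (h : TwiceDifferentiableAt f (x + t • v)) :
    HasDerivAt (fun t : ℝ => ⟪gradient f (x + t • v), v⟫_ℝ) ⟪hessian f (x + t • v) v, v⟫_ℝ t := by
  have := h.2.hasFDerivAt.comp_hasDerivAt t (_root_.hasDerivAt_line x v t)
  have h2 := this.inner ℝ (hasDerivAt_const t v)
  simp only [inner_zero_right, zero_add] at h2
  exact h2

theorem ConvexOn.add_inner_gradient_le {Θ : Set (Vec d)} {f : Vec d → ℝ} (hf : ConvexOn ℝ Θ f)
    {x y : Vec d} (hx : x ∈ Θ) (hy : y ∈ Θ) (hd : DifferentiableAt ℝ f x) :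
    f x + ⟪gradient f x, y - x⟫_ℝ ≤ f y := by
  have h1 : HasDerivAt (fun t : ℝ => f (x + t • (y - x))) ⟪gradient f x, y - x⟫_ℝ 0 := by
    have := DifferentiableAt.hasDerivAt_line (f := f) (x := x) (v := y - x) (t := 0) (by simpa using hd)
    simpa using this
  have h2 := (hasDerivAt_iff_tendsto_slope_left_right.1 h1).2
  have : ⟪gradient f x, y - x⟫_ℝ ≤ f y - f x := by
    refine le_of_tendsto h2 ?_
    filter_upwards [Ioo_mem_nhdsGT (zero_lt_one (α := ℝ))] with t ht
    rw [slope_def_field]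
    simp only [zero_smul, add_zero, sub_zero]
    rw [div_le_iff₀ ht.1]
    have := hf.2 hx hy (show 0 ≤ 1 - t by linarith [ht.2]) ht.1.le (by ring)
    rw [show (1 - t) • x + t • y = x + t • (y - x) by module] at this
    simp only [smul_eq_mul] at this
    linarith
  linarith

end Line

/-! ### Moments and deviation inequalities for independent sums -/

section Moments

variable {Ω : Type*} [MeasurableSpace Ω] {μ : Measure Ω}

theorem memLp_of_lintegral_rpow_le {f : Ω → ℝ} {p B : ℝ} (hf : Measurable f) (hp : 0 < p)
    (hB : 0 ≤ B) (h : ∫⁻ x, ‖f x‖ₑ ^ p ∂μ ≤ ENNReal.ofReal B) :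
    MemLp f (ENNReal.ofReal p) μ ∧ ∫ x, |f x| ^ p ∂μ ≤ B := by
  have hlt : ∫⁻ x, ‖f x‖ₑ ^ p ∂μ < ∞ := h.trans_lt ENNReal.ofReal_lt_top
  refine ⟨⟨hf.aestronglyMeasurable, ?_⟩, ?_⟩
  · rw [eLpNorm_lt_top_iff_lintegral_rpow_enorm_lt_top (by simpa using hp) (by simp),
      ENNReal.toReal_ofReal hp.le]
    exact hlt
  · rw [integral_eq_lintegral_of_nonneg_ae (Eventually.of_forall fun x => by positivity)
      (hf.abs.pow_const p).aestronglyMeasurable]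
    refine ENNReal.toReal_le_of_le_ofReal hB (le_trans (le_of_eq ?_) h)
    refine lintegral_congr fun x => ?_
    rw [← ENNReal.ofReal_rpow_of_nonneg (abs_nonneg _) hp.le, ← Real.enorm_eq_ofReal_abs]

theorem memLp_two_of_lintegral_le {f : Ω → ℝ} {B : ℝ} (hf : Measurable f) (hB : 0 ≤ B)
    (h : ∫⁻ x, ‖f x‖ₑ ^ (2 : ℝ) ∂μ ≤ ENNReal.ofReal B) :
    MemLp f 2 μ ∧ ∫ x, f x ^ 2 ∂μ ≤ B := by
  have := memLp_of_lintegral_rpow_le hf two_pos hB h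
  simpa using this

theorem integrable_of_lintegral_le {f : Ω → ℝ} {B : ℝ} (hf : Measurable f) (hB : 0 ≤ B)
    (h : ∫⁻ x, ‖f x‖ₑ ∂μ ≤ ENNReal.ofReal B) :
    Integrable f μ ∧ |∫ x, f x ∂μ| ≤ B := by
  refine ⟨⟨hf.aestronglyMeasurable, h.trans_lt ENNReal.ofReal_lt_top⟩, ?_⟩
  rw [← Real.norm_eq_abs]
  refine (norm_integral_le_lintegral_norm f).trans ?_
  refine ENNReal.toReal_le_of_le_ofReal hB (le_trans (le_of_eq ?_) h)
  exact lintegral_congr fun x => by rw [← ofReal_norm]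

theorem measure_abs_sum_sub_ge_le [IsProbabilityMeasure μ] {ι : Type*} {X : ι → Ω → ℝ}
    (s : Finset ι) (hX : ∀ i, MemLp (X i) 2 μ) (h : iIndepFun X μ) {c : ℝ} (hc : 0 < c) :
    μ {ω | c ≤ |∑ i ∈ s, X i ω - ∑ i ∈ s, ∫ ω, X i ω ∂μ|} ≤
      ENNReal.ofReal ((∑ i ∈ s, ∫ ω, X i ω ^ 2 ∂μ) / c ^ 2) := by
  have h1 := meas_ge_le_variance_div_sq (μ := μ) (memLp_finsetSum' s fun i _ => hX i) hc
  have h2 : ∫ ω, ∑ i ∈ s, X i ω ∂μ = ∑ i ∈ s, ∫ ω, X i ω ∂μ := by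
    exact integral_finsetSum _ fun i _ => (hX i).integrable (by norm_num)
  simp only [Finset.sum_apply, h2] at h1
  refine h1.trans (ENNReal.ofReal_le_ofReal ?_)
  gcongr
  rw [IndepFun.variance_sum (fun i _ => hX i) fun i _ j _ hij => h.indepFun hij]
  refine Finset.sum_le_sum fun i _ => ?_
  exact variance_le_expectation_sq (hX i).aestronglyMeasurable

theorem hasDerivAt_abs_rpow_mul_self {p : ℝ} (hp : 0 < p) (x : ℝ) :
    HasDerivAt (fun x : ℝ => |x| ^ p * x) ((p + 1) * |x| ^ p) x := by
  rcases eq_or_ne x 0 with rfl | hx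
  · rw [hasDerivAt_iff_tendsto_slope_zero]
    simp only [zero_add, abs_zero, mul_zero, sub_zero, smul_eq_mul,
      Real.zero_rpow hp.ne']
    have : Tendsto (fun t : ℝ => |t| ^ p) (𝓝[≠] 0) (𝓝 0) := by
      have : ContinuousAt (fun t : ℝ => |t| ^ p) 0 :=
        (continuous_abs.continuousAt).rpow_const (Or.inr hp.le)
      have h := this.tendsto
      simp only [abs_zero, Real.zero_rpow hp.ne'] at h
      exact h.mono_left nhdsWithin_le_nhds
    refine this.congr' ?_
    filter_upwards [self_mem_nhdsWithin] with t ht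
    have ht : t ≠ 0 := ht
    field_simp
  · have h1 := ((hasDerivAt_abs hx).rpow_const (p := p) (Or.inl (abs_ne_zero.2 hx))).mul
      (hasDerivAt_id x)
    refine h1.congr_deriv ?_
    have h2 : (SignType.sign x : ℝ) * x = |x| := by rw [mul_comm]; exact self_mul_sign x
    have h3 : |x| ^ (p - 1) * |x| = |x| ^ p := by
      rw [Real.rpow_sub_one (abs_ne_zero.2 hx), div_mul_cancel₀ _ (abs_ne_zero.2 hx)]
    simp only [id, mul_one]
    calc _ = p * (|x| ^ (p - 1) * ((SignType.sign x : ℝ) * x)) + |x| ^ p := by ring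
      _ = _ := by rw [h2, h3]; ring

/-- The linear term in `y` is kept exactly, since it integrates to zero when `y` is centred and
independent of `x`. The rest is the second order Taylor bound, with `|x + t y| ≤ 2 max |x| |y|`
producing the power of two. -/
theorem abs_add_rpow_le {r : ℝ} (hr : 2 < r) (x y : ℝ) :
    |x + y| ^ r ≤ |x| ^ r + r * (|x| ^ (r - 2) * x) * y
      + r * (r - 1) * 2 ^ (r - 2) * (|x| ^ (r - 2) * y ^ 2 + |y| ^ r) := by
  have hr2 : 0 < r - 2 := by linarith
  have hline : ∀ t : ℝ, HasDerivAt (fun t : ℝ => x + t * y) y t := fun t => by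
    simpa using ((hasDerivAt_id t).mul_const y).const_add x
  have h := taylor_two_le (φ := fun t => |x + t * y| ^ r)
    (φ' := fun t => r * (|x + t * y| ^ (r - 2) * (x + t * y)) * y)
    (φ'' := fun t => r * ((r - 2 + 1) * |x + t * y| ^ (r - 2) * y) * y)
    (B := r * (r - 1) * 2 ^ (r - 2) * (|x| ^ (r - 2) * y ^ 2 + |y| ^ r))
    (fun t _ => by
      refine ((hasDerivAt_abs_rpow (x + t * y) (by linarith : 1 < r)).comp t (hline t)).congr_deriv ?_
      ring)
    (fun t _ => by
      have := (hasDerivAt_abs_rpow_mul_self hr2 (x + t * y)).comp t (hline t)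
      exact (this.const_mul r).mul_const y)
    (fun t ht => by
      have hy : |y| ^ r = |y| ^ (r - 2) * y ^ 2 := by
        rw [← sq_abs y, ← Real.rpow_natCast, ← Real.rpow_add_of_nonneg (abs_nonneg _) hr2.le
          (by norm_num)]
        norm_num
      have h1 : |x + t * y| ≤ 2 * max |x| |y| := by
        have : |t * y| ≤ |y| := by
          rw [abs_mul, abs_of_nonneg ht.1]
          exact mul_le_of_le_one_left (abs_nonneg _) ht.2
        linarith [abs_add_le x (t * y), le_max_left |x| |y|, le_max_right |x| |y|]
      have h2 : |x + t * y| ^ (r - 2) ≤ 2 ^ (r - 2) * (|x| ^ (r - 2) + |y| ^ (r - 2)) := by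
        refine (Real.rpow_le_rpow (abs_nonneg _) h1 hr2.le).trans ?_
        rw [Real.mul_rpow (by norm_num) (by positivity)]
        gcongr
        have := Real.rpow_nonneg (abs_nonneg x) (r - 2)
        have := Real.rpow_nonneg (abs_nonneg y) (r - 2)
        rcases max_cases |x| |y| with h | h <;> rw [h.1] <;> linarith
      have h3 : 0 ≤ r * (r - 1) * y ^ 2 := by
        have : 0 ≤ r - 1 := by linarith
        positivity
      calc _ = r * (r - 1) * y ^ 2 * |x + t * y| ^ (r - 2) := by ring
        _ ≤ r * (r - 1) * y ^ 2 * (2 ^ (r - 2) * (|x| ^ (r - 2) + |y| ^ (r - 2))) := by gcongr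
        _ = _ := by rw [hy]; ring)
  simp only [one_mul, zero_mul, add_zero] at h
  have h0 : 0 ≤ r * (r - 1) * 2 ^ (r - 2) * (|x| ^ (r - 2) * y ^ 2 + |y| ^ r) := by
    have : 0 ≤ r - 1 := by linarith
    positivity
  linarith

/-- A constant in the moment inequality of Marcinkiewicz and Zygmund. -/
noncomputable def mzConst (r V : ℝ) : ℝ :=
  2 * (r * (r - 1) * 2 ^ (r - 2) * (1 + V)) * Real.exp (r * (r - 1) * 2 ^ (r - 2) * (1 + V))

theorem mzConst_nonneg {r V : ℝ} (hr : 2 < r) (hV : 0 ≤ V) : 0 ≤ mzConst r V := by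
  have : 0 ≤ r - 1 := by linarith
  unfold mzConst; positivity

/-- According to whether `x²` is below or above `n`, one of the two terms dominates. With `n` the
number of summands, the factor `1 / n` is what keeps the recursion for the moments of partial sums
bounded. -/
theorem rpow_sub_two_le {r n x : ℝ} (hr : 2 < r) (hn : 0 < n) (hx : 0 ≤ x) :
    x ^ (r - 2) ≤ n ^ (r / 2 - 1) + x ^ r / n := by
  have hx2 : x ^ r = x ^ (r - 2) * x ^ 2 := by
    rw [← Real.rpow_natCast, ← Real.rpow_add_of_nonneg hx (by linarith) (by norm_num)]
    norm_num
  rcases le_total (x ^ 2) n with h | h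
  · have h1 : x ^ (r - 2) = (x ^ 2) ^ (r / 2 - 1) := by
      rw [← Real.rpow_natCast, ← Real.rpow_mul hx]
      congr 1
      push_cast
      ring
    have h2 : (x ^ 2) ^ (r / 2 - 1) ≤ n ^ (r / 2 - 1) :=
      Real.rpow_le_rpow (by positivity) h (by linarith)
    have : 0 ≤ x ^ r / n := by positivity
    linarith
  · have h1 : x ^ (r - 2) ≤ x ^ r / n := by
      rw [le_div_iff₀ hn, hx2]
      gcongr
    have : 0 ≤ n ^ (r / 2 - 1) := by positivity
    linarith

theorem sq_le_one_add_rpow {r : ℝ} (hr : 2 < r) (x : ℝ) : x ^ 2 ≤ 1 + |x| ^ r := by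
  rw [← sq_abs]
  rcases le_total |x| 1 with h | h
  · have : |x| ^ 2 ≤ 1 := pow_le_one₀ (abs_nonneg _) h
    have : 0 ≤ |x| ^ r := by positivity
    linarith
  · have := Real.rpow_le_rpow_of_exponent_le h hr.le
    simp only [Real.rpow_two] at this
    linarith

/-- One step of the moment recursion. Independence kills the linear term and factorizes the
quadratic one, where `rpow_sub_two_le` trades the moment of order `r - 2` for that of order `r`. -/
theorem integral_abs_add_rpow_le [IsProbabilityMeasure μ] {S X : Ω → ℝ} {r V n : ℝ} (hr : 2 < r)
    (hn : 1 ≤ n) (hV : 0 ≤ V) (hSX : IndepFun S X μ) (hS : MemLp S (ENNReal.ofReal r) μ)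
    (hX : MemLp X (ENNReal.ofReal r) μ) (hX0 : ∫ ω, X ω ∂μ = 0)
    (hXV : ∫ ω, |X ω| ^ r ∂μ ≤ V) :
    ∫ ω, |S ω + X ω| ^ r ∂μ ≤
      (1 + r * (r - 1) * 2 ^ (r - 2) * (1 + V) / n) * ∫ ω, |S ω| ^ r ∂μ
        + 2 * (r * (r - 1) * 2 ^ (r - 2) * (1 + V)) * n ^ (r / 2 - 1) := by
  have hr0 : 0 < r := by linarith
  have hr1 : 0 ≤ r - 1 := by linarith
  have hpz : ENNReal.ofReal r ≠ 0 := by simpa using hr0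
  have hint : ∀ {Y : Ω → ℝ}, MemLp Y (ENNReal.ofReal r) μ → Integrable (fun ω => |Y ω| ^ r) μ := by
    intro Y hY
    have := hY.integrable_norm_rpow hpz (by simp)
    simpa [ENNReal.toReal_ofReal hr0.le] using this
  have hone : (1 : ℝ≥0∞) ≤ ENNReal.ofReal r := by
    rw [← ENNReal.ofReal_one]; exact ENNReal.ofReal_le_ofReal (by linarith)
  have htwo : (2 : ℝ≥0∞) ≤ ENNReal.ofReal r := by
    rw [← ENNReal.ofReal_ofNat]; exact ENNReal.ofReal_le_ofReal hr.le
  have hXi : Integrable X μ := hX.integrable hone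
  have hX2 : Integrable (fun ω => X ω ^ 2) μ := (hX.mono_exponent htwo).integrable_sq
  have hX2V : ∫ ω, X ω ^ 2 ∂μ ≤ 1 + V := by
    calc ∫ ω, X ω ^ 2 ∂μ ≤ ∫ ω, (1 + |X ω| ^ r) ∂μ :=
          integral_mono hX2 ((integrable_const 1).add (hint hX)) fun ω => sq_le_one_add_rpow hr _
      _ = 1 + ∫ ω, |X ω| ^ r ∂μ := by
          rw [integral_add (integrable_const 1) (hint hX)]; simp
      _ ≤ 1 + V := by linarith
  have hmS := hS.aestronglyMeasurable.aemeasurable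
  have hbound : ∀ x : ℝ, |x| ^ (r - 2) ≤ n ^ (r / 2 - 1) + |x| ^ r / n := fun x =>
    rpow_sub_two_le hr (by linarith) (abs_nonneg x)
  have hSr2' : Integrable (fun ω => n ^ (r / 2 - 1) + |S ω| ^ r / n) μ :=
    (integrable_const _).add ((hint hS).div_const n)
  have hSr2 : Integrable (fun ω => |S ω| ^ (r - 2)) μ := by
    refine hSr2'.mono' (hmS.abs.pow_const _).aestronglyMeasurable (Eventually.of_forall fun ω => ?_)
    rw [Real.norm_of_nonneg (by positivity)]
    exact hbound _
  have hSr1 : Integrable (fun ω => |S ω| ^ (r - 2) * S ω) μ := by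
    refine ((integrable_const (1 : ℝ)).add (hint hS)).mono' ((hmS.abs.pow_const _).mul hmS).aestronglyMeasurable
      (Eventually.of_forall fun ω => ?_)
    rw [Real.norm_eq_abs, abs_mul, abs_of_nonneg (by positivity)]
    have h1 : |S ω| ^ (r - 2) * |S ω| = |S ω| ^ (r - 1) := by
      nth_rewrite 2 [← Real.rpow_one |S ω|]
      rw [← Real.rpow_add_of_nonneg (abs_nonneg _) (by linarith) (by norm_num)]
      congr 1; ring
    rw [h1]
    simp only [Pi.add_apply]
    rcases le_total |S ω| 1 with h | h
    · have := Real.rpow_le_one (abs_nonneg (S ω)) h hr1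
      have : 0 ≤ |S ω| ^ r := by positivity
      linarith
    · have := Real.rpow_le_rpow_of_exponent_le h (show r - 1 ≤ r by linarith)
      linarith
  have hind1 : IndepFun (fun ω => |S ω| ^ (r - 2) * S ω) X μ :=
    hSX.comp (φ := fun x => |x| ^ (r - 2) * x) (ψ := id) ((measurable_id.abs.pow_const _).mul measurable_id) measurable_id
  have hind2 : IndepFun (fun ω => |S ω| ^ (r - 2)) (fun ω => X ω ^ 2) μ :=
    hSX.comp (φ := fun x => |x| ^ (r - 2)) (ψ := fun x => x ^ 2) (measurable_id.abs.pow_const _) (by fun_prop)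
  have hi1 : Integrable (fun ω => |S ω| ^ (r - 2) * S ω * X ω) μ := hind1.integrable_mul hSr1 hXi
  have hi2 : Integrable (fun ω => |S ω| ^ (r - 2) * X ω ^ 2) μ := hind2.integrable_mul hSr2 hX2
  have he1 : ∫ ω, |S ω| ^ (r - 2) * S ω * X ω ∂μ = 0 := by
    rw [hind1.integral_fun_mul_eq_mul_integral hSr1.aestronglyMeasurable hXi.aestronglyMeasurable,
      hX0, mul_zero]
  have he2 : ∫ ω, |S ω| ^ (r - 2) * X ω ^ 2 ∂μ
      ≤ (n ^ (r / 2 - 1) + (∫ ω, |S ω| ^ r ∂μ) / n) * (1 + V) := by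
    rw [hind2.integral_fun_mul_eq_mul_integral hSr2.aestronglyMeasurable hX2.aestronglyMeasurable]
    have h1 : ∫ ω, |S ω| ^ (r - 2) ∂μ ≤ n ^ (r / 2 - 1) + (∫ ω, |S ω| ^ r ∂μ) / n := by
      calc _ ≤ ∫ ω, (n ^ (r / 2 - 1) + |S ω| ^ r / n) ∂μ :=
            integral_mono hSr2 hSr2' fun ω => hbound _
        _ = _ := by
          rw [integral_add (integrable_const _) ((hint hS).div_const n), integral_div]
          simp
    have h0 : 0 ≤ ∫ ω, |S ω| ^ r ∂μ := integral_nonneg fun ω => by positivity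
    have h2 : 0 ≤ ∫ ω, X ω ^ 2 ∂μ := integral_nonneg fun ω => by positivity
    exact mul_le_mul h1 hX2V h2 (by positivity)
  set c := r * (r - 1) * 2 ^ (r - 2) with hc
  have hc0 : 0 ≤ c := by positivity
  have hA : Integrable (fun ω => |S ω| ^ r + r * (|S ω| ^ (r - 2) * S ω * X ω)) μ :=
    (hint hS).add (hi1.const_mul r)
  have hB : Integrable (fun ω => |S ω| ^ (r - 2) * X ω ^ 2 + |X ω| ^ r) μ := hi2.add (hint hX)
  calc ∫ ω, |S ω + X ω| ^ r ∂μ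
      ≤ ∫ ω, ((|S ω| ^ r + r * (|S ω| ^ (r - 2) * S ω * X ω))
          + c * (|S ω| ^ (r - 2) * X ω ^ 2 + |X ω| ^ r)) ∂μ := by
        refine integral_mono (hint (hS.add hX)) (hA.add (hB.const_mul c)) fun ω => ?_
        have := abs_add_rpow_le hr (S ω) (X ω)
        simp only
        linarith
    _ = ∫ ω, |S ω| ^ r ∂μ + c * (∫ ω, |S ω| ^ (r - 2) * X ω ^ 2 ∂μ + ∫ ω, |X ω| ^ r ∂μ) := by
        rw [integral_add hA (hB.const_mul c),
          integral_add (hint hS) (hi1.const_mul r), integral_const_mul, integral_const_mul, he1,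
          integral_add hi2 (hint hX)]
        ring
    _ ≤ ∫ ω, |S ω| ^ r ∂μ + c * ((n ^ (r / 2 - 1) + (∫ ω, |S ω| ^ r ∂μ) / n) * (1 + V)
          + (1 + V) * n ^ (r / 2 - 1)) := by
        have : 1 ≤ n ^ (r / 2 - 1) := Real.one_le_rpow hn (by linarith)
        gcongr
        nlinarith
    _ = _ := by ring

theorem integral_abs_sum_rpow_le [IsProbabilityMeasure μ] {ι : Type*} {X : ι → Ω → ℝ} {r V : ℝ}
    (hr : 2 < r) (hV : 0 ≤ V) (h : iIndepFun X μ) (hm : ∀ i, Measurable (X i))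
    (hX : ∀ i, MemLp (X i) (ENNReal.ofReal r) μ)
    (hX0 : ∀ i, ∫ ω, X i ω ∂μ = 0) (hXV : ∀ i, ∫ ω, |X i ω| ^ r ∂μ ≤ V) (s : Finset ι) :
    ∫ ω, |∑ i ∈ s, X i ω| ^ r ∂μ ≤ mzConst r V * (s.card : ℝ) ^ (r / 2) := by
  classical
  have hr0 : 0 < r := by linarith
  rcases s.eq_empty_or_nonempty with rfl | hs
  · simp [Real.zero_rpow hr0.ne', Real.zero_rpow (show r / 2 ≠ 0 by positivity)]
  obtain ⟨n, hn⟩ : ∃ n : ℝ, n = s.card := ⟨_, rfl⟩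
  have hn1 : 1 ≤ n := by
    rw [hn]; exact_mod_cast hs.card_pos
  set a := r * (r - 1) * 2 ^ (r - 2) * (1 + V) with ha
  have ha0 : 0 ≤ a := by
    have : 0 ≤ r - 1 := by linarith
    positivity
  -- Here `n` is the size of the full set throughout the induction, so each summand multiplies by `1
  -- + a / n` and the product is at most `exp a`.
  have key : ∀ t : Finset ι, ∫ ω, |∑ i ∈ t, X i ω| ^ r ∂μ ≤
      (1 + a / n) ^ t.card * (t.card * (2 * a * n ^ (r / 2 - 1))) := by
    intro t
    induction t using Finset.induction_on with
    | empty => simp [Real.zero_rpow hr0.ne']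
    | insert i t hi ih =>
      have hind : IndepFun (fun ω => ∑ i ∈ t, X i ω) (X i) μ := by
        have := h.indepFun_finsetSum_of_notMem hm hi
        convert! this using 1
        ext ω; simp
      have hS : MemLp (fun ω => ∑ i ∈ t, X i ω) (ENNReal.ofReal r) μ :=
        memLp_finsetSum t fun i _ => hX i
      have step := integral_abs_add_rpow_le hr hn1 hV hind hS (hX i) (hX0 i) (hXV i)
      rw [← ha] at step
      have heq : ∀ ω, ∑ i ∈ insert i t, X i ω = ∑ i ∈ t, X i ω + X i ω := fun ω => by
        rw [Finset.sum_insert hi, add_comm]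
      simp only [heq, Finset.card_insert_of_notMem hi]
      refine step.trans ?_
      have h1 : 1 ≤ (1 + a / n) ^ (t.card + 1) := one_le_pow₀ (by
        have : 0 ≤ a / n := by positivity
        linarith)
      have h2 : 0 ≤ 2 * a * n ^ (r / 2 - 1) := by positivity
      calc _ ≤ (1 + a / n) * ((1 + a / n) ^ t.card * (t.card * (2 * a * n ^ (r / 2 - 1))))
            + (1 + a / n) ^ (t.card + 1) * (2 * a * n ^ (r / 2 - 1)) := by
              exact add_le_add (mul_le_mul_of_nonneg_left ih (by positivity))
                (le_mul_of_one_le_left h2 h1)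
        _ = _ := by push_cast; ring
  refine (key s).trans ?_
  have h1 : (1 + a / n) ^ s.card ≤ Real.exp a := by
    calc (1 + a / n) ^ s.card ≤ Real.exp (a / n) ^ s.card := by
          gcongr
          linarith [Real.add_one_le_exp (a / n)]
      _ = Real.exp a := by
          rw [← Real.exp_nat_mul, ← hn, mul_div_cancel₀ _ (by linarith)]
  have h2 : n * n ^ (r / 2 - 1) = n ^ (r / 2) := by
    nth_rewrite 1 [← Real.rpow_one n]
    rw [← Real.rpow_add (by linarith)]
    congr 1; ring
  calc _ ≤ Real.exp a * (n * (2 * a * n ^ (r / 2 - 1))) := by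
        rw [← hn]; gcongr
    _ = 2 * a * Real.exp a * (n * n ^ (r / 2 - 1)) := by ring
    _ = _ := by rw [h2, mzConst, ← ha, hn]

theorem measure_abs_sum_ge_le_rpow [IsProbabilityMeasure μ] {ι : Type*} {X : ι → Ω → ℝ} {r V : ℝ}
    (hr : 2 < r) (hV : 0 ≤ V) (h : iIndepFun X μ) (hm : ∀ i, Measurable (X i))
    (hX : ∀ i, MemLp (X i) (ENNReal.ofReal r) μ)
    (hX0 : ∀ i, ∫ ω, X i ω ∂μ = 0) (hXV : ∀ i, ∫ ω, |X i ω| ^ r ∂μ ≤ V) (s : Finset ι)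
    {c : ℝ} (hc : 0 < c) :
    μ {ω | c ≤ |∑ i ∈ s, X i ω|} ≤
      ENNReal.ofReal (mzConst r V * (s.card : ℝ) ^ (r / 2) / c ^ r) := by
  have hr0 : 0 < r := by linarith
  have hS : MemLp (fun ω => ∑ i ∈ s, X i ω) (ENNReal.ofReal r) μ :=
    memLp_finsetSum s fun i _ => hX i
  have hint : Integrable (fun ω => |∑ i ∈ s, X i ω| ^ r) μ := by
    have := hS.integrable_norm_rpow (by simpa using hr0) (by simp)
    simpa [ENNReal.toReal_ofReal hr0.le] using this
  have hmk := mul_meas_ge_le_integral_of_nonneg (μ := μ)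
    (Eventually.of_forall fun ω => by positivity) hint (c ^ r)
  have hsub : {ω | c ≤ |∑ i ∈ s, X i ω|} ⊆ {ω | c ^ r ≤ |∑ i ∈ s, X i ω| ^ r} := fun ω hω =>
    Real.rpow_le_rpow hc.le hω hr0.le
  refine (measure_mono hsub).trans ?_
  rw [← ofReal_measureReal]
  refine ENNReal.ofReal_le_ofReal ?_
  rw [le_div_iff₀ (by positivity), mul_comm]
  exact hmk.trans (integral_abs_sum_rpow_le hr hV h hm hX hX0 hXV s)

end Moments

/-! ### Exact clustering for a fused convex criterion -/

section Fusion

variable {m K : ℕ} {E : Type*} [NormedAddCommGroup E]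

/-- The fusion penalty with weight `Λ` inside and `ε` across clusters. -/
def fusionPenalty (cl : Fin m → Fin K) (Λ ε : ℝ) (θ : Fin m → E) : ℝ :=
  ∑ j, ∑ j' with j' < j, (if cl j = cl j' then Λ else ε) * ‖θ j - θ j'‖

/-- The sum of the task losses and of the fusion penalty. -/
def fusedObjective (f : Fin m → E → ℝ) (cl : Fin m → Fin K) (Λ ε : ℝ) (θ : Fin m → E) : ℝ :=
  ∑ j, f j (θ j) + fusionPenalty cl Λ ε θ

/-- Moving the common value of a single cluster leaves the within-cluster terms at zero; each of the
at most `m²` cross terms changes by at most `ε ‖x - y‖`. -/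
theorem fusionPenalty_update_le (cl : Fin m → Fin K) {Λ ε : ℝ} (hε : 0 ≤ ε) (β : Fin K → E)
    (k : Fin K) (x y : E) :
    fusionPenalty cl Λ ε (fun j => Function.update β k x (cl j)) ≤
      fusionPenalty cl Λ ε (fun j => Function.update β k y (cl j)) + ε * m ^ 2 * ‖x - y‖ := by
  have h1 : ∀ j j' : Fin m, (if cl j = cl j' then Λ else ε) *
      ‖Function.update β k x (cl j) - Function.update β k x (cl j')‖ ≤
      (if cl j = cl j' then Λ else ε) *
        ‖Function.update β k y (cl j) - Function.update β k y (cl j')‖ + ε * ‖x - y‖ := by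
    intro j j'
    have h0 : 0 ≤ ε * ‖x - y‖ := by positivity
    by_cases hjj : cl j = cl j'
    · simp [hjj, h0]
    rw [if_neg hjj, ← mul_add]
    refine mul_le_mul_of_nonneg_left ?_ hε
    simp only [Function.update_apply]
    by_cases hj : cl j = k
    · have hj' : cl j' ≠ k := fun h => hjj (hj.trans h.symm)
      simp only [hj, hj', if_true, if_false]
      linarith [norm_sub_le_norm_sub_add_norm_sub x y (β (cl j'))]
    · by_cases hj' : cl j' = k
      · simp only [hj, hj', if_true, if_false]
        linarith [norm_sub_le_norm_sub_add_norm_sub (β (cl j)) y x, norm_sub_rev x y]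
      · simp [hj, hj']
  have h2 : ∑ j : Fin m, ∑ j' with j' < j, ε * ‖x - y‖ ≤ ε * m ^ 2 * ‖x - y‖ := by
    calc _ ≤ ∑ j : Fin m, ∑ _j' : Fin m, ε * ‖x - y‖ :=
          Finset.sum_le_sum fun j _ => Finset.sum_le_sum_of_subset_of_nonneg
            (Finset.filter_subset _ _) fun _ _ _ => by positivity
      _ = _ := by simp; ring
  calc _ ≤ ∑ j : Fin m, ∑ j' with j' < j, ((if cl j = cl j' then Λ else ε) *
        ‖Function.update β k y (cl j) - Function.update β k y (cl j')‖ + ε * ‖x - y‖) :=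
        Finset.sum_le_sum fun j _ => Finset.sum_le_sum fun j' _ => h1 j j'
    _ ≤ _ := by
        simp only [Finset.sum_add_distrib]
        exact add_le_add le_rfl h2

/-- The gain from collapsing every task to its representative: the pair of a task with its
representative saves `Λ` times their distance, other pairs inside the cluster cannot increase, and
each cross pair loses at most `ε` times the two displacements. -/
theorem fusionPenalty_rep_le (cl : Fin m → Fin K) {Λ ε : ℝ} (hε : 0 ≤ ε) (hΛ : 0 ≤ Λ)
    (rep : Fin K → Fin m) (hrep : ∀ k, cl (rep k) = k) (hle : ∀ j, rep (cl j) ≤ j)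
    (θ : Fin m → E) :
    fusionPenalty cl Λ ε (fun j => θ (rep (cl j))) +
      (Λ - 2 * ε * m) * ∑ j, ‖θ j - θ (rep (cl j))‖ ≤ fusionPenalty cl Λ ε θ := by
  set u : Fin m → ℝ := fun j => ‖θ j - θ (rep (cl j))‖ with hu
  have h1 : ∀ j j' : Fin m, (if cl j = cl j' then Λ else ε) * ‖θ (rep (cl j)) - θ (rep (cl j'))‖
      + (if j' = rep (cl j) then Λ * u j else 0) ≤
      (if cl j = cl j' then Λ else ε) * ‖θ j - θ j'‖ + ε * (u j + u j') := by
    intro j j'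
    have h0 : 0 ≤ ε * (u j + u j') := by positivity
    by_cases hjj : cl j = cl j'
    · by_cases hj' : j' = rep (cl j)
      · simp only [if_pos hjj, if_pos hj', hu]
        rw [← hjj, sub_self, norm_zero, mul_zero, zero_add, ← hj']
        exact le_add_of_nonneg_right (by positivity)
      · simp only [if_pos hjj, if_neg hj']
        rw [← hjj, sub_self, norm_zero, mul_zero, zero_add]
        positivity
    · have hj' : j' ≠ rep (cl j) := fun h => hjj (by rw [h, hrep])
      simp only [if_neg hjj, if_neg hj', add_zero]
      rw [← mul_add]
      refine mul_le_mul_of_nonneg_left ?_ hε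
      have a := norm_sub_le_norm_sub_add_norm_sub (θ (rep (cl j))) (θ j) (θ (rep (cl j')))
      have b := norm_sub_le_norm_sub_add_norm_sub (θ j) (θ j') (θ (rep (cl j')))
      rw [norm_sub_rev (θ (rep (cl j))) (θ j)] at a
      simp only [hu]
      linarith
  have h2 : ∑ j : Fin m, ∑ j' with j' < j, ε * (u j + u j') ≤ 2 * ε * m * ∑ j, u j := by
    calc _ ≤ ∑ j : Fin m, ∑ j' : Fin m, ε * (u j + u j') :=
          Finset.sum_le_sum fun j _ => Finset.sum_le_sum_of_subset_of_nonneg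
            (Finset.filter_subset _ _) fun _ _ _ => by positivity
      _ = _ := by
        simp only [← Finset.mul_sum, Finset.sum_add_distrib, Finset.sum_const, Finset.card_univ,
          Fintype.card_fin, nsmul_eq_mul]
        ring
  -- The pair with the representative occurs in the sum over `j' < j` unless `j` is its own
  -- representative, in which case its displacement is zero.
  have h3 : ∀ j : Fin m, ∑ j' with j' < j, (if j' = rep (cl j) then Λ * u j else 0) = Λ * u j := by
    intro j
    rw [Finset.sum_ite_eq']
    split_ifs with h
    · rfl
    · have : rep (cl j) = j := le_antisymm (hle j) (by simpa using h)
      simp [hu, this]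
  have h4 := Finset.sum_le_sum fun j (_ : j ∈ (Finset.univ : Finset (Fin m))) =>
    Finset.sum_le_sum fun j' (_ : j' ∈ (Finset.univ.filter fun j' => j' < j)) => h1 j j'
  simp only [Finset.sum_add_distrib, h3, ← Finset.mul_sum] at h4
  simp only [← Finset.mul_sum, Finset.sum_add_distrib] at h2
  unfold fusionPenalty
  linarith

variable [InnerProductSpace ℝ E]

theorem fusedObjective_combo_le {f : Fin m → E → ℝ} {Θ : Set E} (hf : ∀ j, ConvexOn ℝ Θ (f j))
    (cl : Fin m → Fin K) {Λ ε : ℝ} (hΛ : 0 ≤ Λ) (hε : 0 ≤ ε) {θ θ' : Fin m → E}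
    (hθ : ∀ j, θ j ∈ Θ) (hθ' : ∀ j, θ' j ∈ Θ) {s : ℝ} (hs0 : 0 ≤ s) (hs1 : s ≤ 1) :
    fusedObjective f cl Λ ε (fun j => (1 - s) • θ j + s • θ' j) ≤
      (1 - s) * fusedObjective f cl Λ ε θ + s * fusedObjective f cl Λ ε θ' := by
  have hs : 0 ≤ 1 - s := by linarith
  have h1 : ∑ j, f j ((1 - s) • θ j + s • θ' j) ≤
      (1 - s) * ∑ j, f j (θ j) + s * ∑ j, f j (θ' j) := by
    rw [Finset.mul_sum, Finset.mul_sum, ← Finset.sum_add_distrib]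
    exact Finset.sum_le_sum fun j _ => (hf j).2 (hθ j) (hθ' j) hs hs0 (by ring)
  have h2 : fusionPenalty cl Λ ε (fun j => (1 - s) • θ j + s • θ' j) ≤
      (1 - s) * fusionPenalty cl Λ ε θ + s * fusionPenalty cl Λ ε θ' := by
    simp only [fusionPenalty, Finset.mul_sum, ← Finset.sum_add_distrib]
    refine Finset.sum_le_sum fun j _ => Finset.sum_le_sum fun j' _ => ?_
    set l := if cl j = cl j' then Λ else ε with hl
    have hl0 : 0 ≤ l := by rw [hl]; split_ifs <;> assumption
    have : ‖(1 - s) • θ j + s • θ' j - ((1 - s) • θ j' + s • θ' j')‖ ≤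
        (1 - s) * ‖θ j - θ j'‖ + s * ‖θ' j - θ' j'‖ := by
      rw [show (1 - s) • θ j + s • θ' j - ((1 - s) • θ j' + s • θ' j') =
        (1 - s) • (θ j - θ j') + s • (θ' j - θ' j') by module]
      refine (norm_add_le _ _).trans (le_of_eq ?_)
      rw [norm_smul, norm_smul, Real.norm_of_nonneg hs, Real.norm_of_nonneg hs0]
    calc _ ≤ l * ((1 - s) * ‖θ j - θ j'‖ + s * ‖θ' j - θ' j'‖) := by gcongr
      _ = _ := by ring
  unfold fusedObjective
  linarith

/-- Quadratic growth against linear gain: not exceeding the value at the target forces curvature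
times squared distance to be at most (pooled gradient plus `ε m²`) times distance. Only one cluster
moves, so the others need not be near their targets. -/
theorem norm_sub_le_of_fusedObjective_update_le {f : Fin m → E → ℝ} {cl : Fin m → Fin K}
    (hcl : Function.Surjective cl) {Λ ε r : ℝ} (hε : 0 ≤ ε) {β₀ : Fin K → E}
    {g : Fin m → E} {q : Fin m → ℝ} {R : Fin K → ℝ} (hq : ∀ j, 0 < q j)
    (hquad : ∀ j, ∀ x ∈ Metric.closedBall (β₀ (cl j)) r,
      f j (β₀ (cl j)) + ⟪g j, x - β₀ (cl j)⟫_ℝ + q j * ‖x - β₀ (cl j)‖ ^ 2 ≤ f j x)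
    (hR : ∀ k, ‖∑ j with cl j = k, g j‖ + ε * m ^ 2 ≤ (∑ j with cl j = k, q j) * R k)
    (β : Fin K → E) (k : Fin K) {x : E} (hx : x ∈ Metric.closedBall (β₀ k) r)
    (hle : fusedObjective f cl Λ ε (fun j => Function.update β k x (cl j)) ≤
      fusedObjective f cl Λ ε (fun j => Function.update β k (β₀ k) (cl j))) :
    ‖x - β₀ k‖ ≤ R k := by
  have hpen := fusionPenalty_update_le cl (Λ := Λ) hε β k (β₀ k) x
  have hsum : ∀ y, ∑ j, f j (Function.update β k y (cl j)) =
      ∑ j with cl j = k, f j y + ∑ j with ¬ cl j = k, f j (β (cl j)) := by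
    intro y
    rw [← Finset.sum_filter_add_sum_filter_not Finset.univ (fun j => cl j = k)]
    congr 1
    · refine Finset.sum_congr rfl fun j hj => ?_
      rw [(Finset.mem_filter.1 hj).2, Function.update_self]
    · refine Finset.sum_congr rfl fun j hj => ?_
      rw [Function.update_of_ne (Finset.mem_filter.1 hj).2]
  have hlow : ∑ j with cl j = k, f j (β₀ k) + ⟪∑ j with cl j = k, g j, x - β₀ k⟫_ℝ +
      (∑ j with cl j = k, q j) * ‖x - β₀ k‖ ^ 2 ≤ ∑ j with cl j = k, f j x := by
    rw [sum_inner, Finset.sum_mul, ← Finset.sum_add_distrib, ← Finset.sum_add_distrib]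
    refine Finset.sum_le_sum fun j hj => ?_
    have := (Finset.mem_filter.1 hj).2
    subst this
    exact hquad j x hx
  have hin : -(‖∑ j with cl j = k, g j‖ * ‖x - β₀ k‖) ≤ ⟪∑ j with cl j = k, g j, x - β₀ k⟫_ℝ :=
    (abs_le.1 (abs_real_inner_le_norm _ _)).1
  unfold fusedObjective at hle
  rw [hsum, hsum] at hle
  rw [norm_sub_rev (β₀ k) x] at hpen
  have hQ : 0 < ∑ j with cl j = k, q j := by
    obtain ⟨j, hj⟩ := hcl k
    exact Finset.sum_pos (fun j _ => hq j) ⟨j, by simp [hj]⟩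
  have hR0 : 0 ≤ R k := by
    have h0 : 0 ≤ ‖∑ j with cl j = k, g j‖ + ε * m ^ 2 := by positivity
    exact nonneg_of_mul_nonneg_right (h0.trans (hR k)) hQ
  set u := ‖x - β₀ k‖ with hu
  have hu0 : 0 ≤ u := norm_nonneg _
  rcases hu0.eq_or_lt with h | h
  · rw [← h]; exact hR0
  have hmain : (∑ j with cl j = k, q j) * u ^ 2 ≤ (∑ j with cl j = k, q j) * R k * u := by
    nlinarith [mul_le_mul_of_nonneg_right (hR k) hu0]
  have hmain' : (∑ j with cl j = k, q j) * u * u ≤ (∑ j with cl j = k, q j) * u * R k := by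
    linarith [hmain]
  exact le_of_mul_le_mul_left hmain' (by positivity)

/-- The smallest index of each cluster is chosen, since the penalty sums only over `j' < j`. -/
theorem exists_rep {cl : Fin m → Fin K} (hcl : Function.Surjective cl) :
    ∃ rep : Fin K → Fin m, (∀ k, cl (rep k) = k) ∧ ∀ j, rep (cl j) ≤ j := by
  have hne : ∀ k, (Finset.univ.filter fun j => cl j = k).Nonempty := fun k => by
    obtain ⟨j, hj⟩ := hcl k
    exact ⟨j, by simp [hj]⟩
  refine ⟨fun k => (Finset.univ.filter fun j => cl j = k).min' (hne k), fun k => ?_, fun j => ?_⟩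
  · exact (Finset.mem_filter.1 (Finset.min'_mem _ (hne k))).2
  · exact Finset.min'_le _ _ (by simp)

/-- Local information suffices because the objective is convex. A restricted fused minimizer lies
strictly inside the balls; any competitor that is no worse can be pulled in along a segment, and
collapsing it there would strictly lower the objective unless it were already fused. -/
theorem fusedObjective_exact_clustering [ProperSpace E] {f : Fin m → E → ℝ} {cl : Fin m → Fin K}
    {Θ : Set E} (hcl : Function.Surjective cl) (hf : ∀ j, ConvexOn ℝ Θ (f j))
    {Λ ε r G : ℝ} (hε : 0 ≤ ε) (hr : 0 < r) (hG : 0 ≤ G) {β₀ : Fin K → E}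
    (hball : ∀ k, Metric.closedBall (β₀ k) r ⊆ Θ)
    {g : Fin m → E} {q : Fin m → ℝ} {R : Fin K → ℝ} (hq : ∀ j, 0 < q j)
    (hlip : ∀ j, ∀ x ∈ Metric.closedBall (β₀ (cl j)) r, ∀ y ∈ Metric.closedBall (β₀ (cl j)) r,
      |f j x - f j y| ≤ G * ‖x - y‖)
    (hquad : ∀ j, ∀ x ∈ Metric.closedBall (β₀ (cl j)) r,
      f j (β₀ (cl j)) + ⟪g j, x - β₀ (cl j)⟫_ℝ + q j * ‖x - β₀ (cl j)‖ ^ 2 ≤ f j x)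
    (hR : ∀ k, ‖∑ j with cl j = k, g j‖ + ε * m ^ 2 ≤ (∑ j with cl j = k, q j) * R k)
    (hRr : ∀ k, R k < r) (hΛ : G + 2 * ε * m < Λ) :
    (∃ θ : Fin m → E, (∀ j, θ j ∈ Θ) ∧ (∀ j j', cl j = cl j' → θ j = θ j') ∧
      ∀ θ' : Fin m → E, (∀ j, θ' j ∈ Θ) →
        fusedObjective f cl Λ ε θ ≤ fusedObjective f cl Λ ε θ') ∧
    ∀ θ : Fin m → E, (∀ j, θ j ∈ Θ) → (∀ θ' : Fin m → E, (∀ j, θ' j ∈ Θ) →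
        fusedObjective f cl Λ ε θ ≤ fusedObjective f cl Λ ε θ') →
      (∀ j j', cl j = cl j' → θ j = θ j') ∧ ∀ j, ‖θ j - β₀ (cl j)‖ ≤ R (cl j) := by
  obtain ⟨rep, hrep, hrep_le⟩ := exists_rep hcl
  have hΛ0 : 0 ≤ Λ := by
    have : 0 ≤ 2 * ε * m := by positivity
    linarith
  -- minimizer of the fused criterion over a product of balls
  obtain ⟨βh, hβmem, hβmin⟩ : ∃ βh : Fin K → E, (∀ k, βh k ∈ Metric.closedBall (β₀ k) r) ∧
      ∀ β : Fin K → E, (∀ k, β k ∈ Metric.closedBall (β₀ k) r) →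
        fusedObjective f cl Λ ε (fun j => βh (cl j)) ≤
          fusedObjective f cl Λ ε (fun j => β (cl j)) := by
    have hcomp : IsCompact (Set.pi Set.univ fun k => Metric.closedBall (β₀ k) r) :=
      isCompact_univ_pi fun k => isCompact_closedBall _ _
    have hcont : ContinuousOn (fun β : Fin K → E => fusedObjective f cl Λ ε (fun j => β (cl j)))
        (Set.pi Set.univ fun k => Metric.closedBall (β₀ k) r) := by
      unfold fusedObjective fusionPenalty
      refine ContinuousOn.add (continuousOn_finsetSum _ fun j _ => ?_) (by fun_prop)
      have h1 : ContinuousOn (f j) (Metric.closedBall (β₀ (cl j)) r) := by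
        have : LipschitzOnWith G.toNNReal (f j) (Metric.closedBall (β₀ (cl j)) r) := by
          refine LipschitzOnWith.of_dist_le_mul fun x hx y hy => ?_
          rw [Real.dist_eq, dist_eq_norm, Real.coe_toNNReal _ hG]
          exact hlip j x hx y hy
        exact this.continuousOn
      exact h1.comp (continuous_apply (cl j)).continuousOn fun β hβ => hβ (cl j) trivial
    obtain ⟨βh, h1, h2⟩ := hcomp.exists_isMinOn
      ⟨β₀, fun k _ => Metric.mem_closedBall_self hr.le⟩ hcont
    exact ⟨βh, fun k => h1 k trivial, fun β hβ => h2 (fun k _ => hβ k)⟩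
  have hβR : ∀ k, ‖βh k - β₀ k‖ ≤ R k := by
    intro k
    refine norm_sub_le_of_fusedObjective_update_le hcl hε hq hquad hR βh k (hβmem k) (Λ := Λ) ?_
    rw [Function.update_eq_self]
    refine hβmin _ fun k' => ?_
    rcases eq_or_ne k' k with rfl | h
    · simp [hr.le]
    · rw [Function.update_of_ne h]; exact hβmem k'
  have hβΘ : ∀ j, βh (cl j) ∈ Θ := fun j => hball _ (hβmem _)
  -- No competitor beats the restricted minimizer, and one that ties with it is fused. This yields
  -- both the existence of a global minimizer and the structure of all of them.
  have key : ∀ θ : Fin m → E, (∀ j, θ j ∈ Θ) →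
      fusedObjective f cl Λ ε θ ≤ fusedObjective f cl Λ ε (fun j => βh (cl j)) →
      (∀ j, θ j = θ (rep (cl j))) ∧
        fusedObjective f cl Λ ε (fun j => βh (cl j)) ≤ fusedObjective f cl Λ ε θ := by
    intro θ hθ hle
    -- `R k < r` leaves room around the restricted minimizer, so a small positive step towards any
    -- point of `Θ^m` stays in all the balls.
    obtain ⟨s, hs0, hs1, hsball⟩ : ∃ s : ℝ, 0 < s ∧ s ≤ 1 ∧
        ∀ j, (1 - s) • βh (cl j) + s • θ j ∈ Metric.closedBall (β₀ (cl j)) r := by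
      have h1 : ∀ j, ∀ᶠ s : ℝ in 𝓝[>] 0,
          (1 - s) • βh (cl j) + s • θ j ∈ Metric.closedBall (β₀ (cl j)) r := by
        intro j
        have hc : Continuous fun s : ℝ => ‖(1 - s) • βh (cl j) + s • θ j - β₀ (cl j)‖ := by
          fun_prop
        have h0 : ‖(1 - (0 : ℝ)) • βh (cl j) + (0 : ℝ) • θ j - β₀ (cl j)‖ < r := by
          simpa using (hβR (cl j)).trans_lt (hRr _)
        have h2 : ∀ᶠ s : ℝ in 𝓝 0, ‖(1 - s) • βh (cl j) + s • θ j - β₀ (cl j)‖ < r :=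
          hc.continuousAt.eventually_lt_const h0
        filter_upwards [h2.filter_mono nhdsWithin_le_nhds] with s hs
        rw [mem_closedBall_iff_norm]; exact hs.le
      have h2 := (eventually_all.2 h1).and (Ioo_mem_nhdsGT (zero_lt_one (α := ℝ)))
      obtain ⟨s, hs, hs'⟩ := h2.exists
      exact ⟨s, hs'.1, hs'.2.le, hs⟩
    set θs : Fin m → E := fun j => (1 - s) • βh (cl j) + s • θ j with hθs
    have hcombo := fusedObjective_combo_le hf cl hΛ0 hε hβΘ hθ hs0.le hs1
    rw [← hθs] at hcombo
    have hmin := hβmin (fun k => θs (rep k)) fun k => by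
      have := hsball (rep k)
      rw [hrep] at this
      simp only [hθs, hrep]
      exact this
    have hpen := fusionPenalty_rep_le cl hε hΛ0 rep hrep hrep_le θs
    have hfs : ∑ j, f j (θs (rep (cl j))) ≤
        ∑ j, f j (θs j) + G * ∑ j, ‖θs j - θs (rep (cl j))‖ := by
      rw [Finset.mul_sum, ← Finset.sum_add_distrib]
      refine Finset.sum_le_sum fun j _ => ?_
      have h1 := hsball (rep (cl j))
      rw [hrep] at h1
      have h1' : θs (rep (cl j)) ∈ Metric.closedBall (β₀ (cl j)) r := by
        simp only [hθs, hrep]; exact h1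
      have := (abs_le.1 (hlip j _ (hsball j) _ h1')).1
      simp only [hθs] at this ⊢
      linarith
    set U := ∑ j, ‖θs j - θs (rep (cl j))‖ with hU
    have hU0 : 0 ≤ U := Finset.sum_nonneg fun j _ => norm_nonneg _
    have hcomb2 : fusedObjective f cl Λ ε (fun j => θs (rep (cl j))) + (Λ - 2 * ε * m - G) * U ≤
        fusedObjective f cl Λ ε θs := by
      unfold fusedObjective
      linarith
    have hle2 : fusedObjective f cl Λ ε θs ≤ fusedObjective f cl Λ ε (fun j => βh (cl j)) := by
      nlinarith
    have hUz : U = 0 := by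
      refine le_antisymm ?_ hU0
      have : (Λ - 2 * ε * m - G) * U ≤ 0 := by linarith
      by_contra hcon
      push Not at hcon
      have : 0 < (Λ - 2 * ε * m - G) * U := mul_pos (by linarith) hcon
      linarith
    constructor
    · intro j
      have h1 := (Finset.sum_eq_zero_iff_of_nonneg fun j _ => norm_nonneg _).1 hUz j
        (Finset.mem_univ j)
      have h2 := sub_eq_zero.1 (norm_eq_zero.1 h1)
      simp only [hθs, hrep] at h2
      exact smul_right_injective E hs0.ne' (add_left_cancel h2)
    · have : fusedObjective f cl Λ ε (fun j => βh (cl j)) ≤ fusedObjective f cl Λ ε θs := by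
        rw [hUz] at hcomb2; linarith
      nlinarith
  refine ⟨⟨fun j => βh (cl j), hβΘ, fun j j' h => by simp only [h], fun θ' hθ' => ?_⟩, ?_⟩
  · by_contra hcon
    push Not at hcon
    exact absurd (key θ' hθ' hcon.le).2 (not_le.2 hcon)
  · intro θ hθ hmin
    have hfus := (key θ hθ (hmin _ hβΘ)).1
    refine ⟨fun j j' h => by rw [hfus j, hfus j', h], fun j => ?_⟩
    set k := cl j with hk
    set β : Fin K → E := fun k => θ (rep k) with hβ
    have hθβ : θ = fun j => β (cl j) := funext hfus
    have hΘu : ∀ x ∈ Θ, ∀ j', Function.update β k x (cl j') ∈ Θ := by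
      intro x hx j'
      rcases eq_or_ne (cl j') k with h | h
      · rw [h, Function.update_self]; exact hx
      · rw [Function.update_of_ne h]; exact hθ _
    have hβ₀Θ : β₀ k ∈ Θ := hball k (Metric.mem_closedBall_self hr.le)
    have hle0 := hmin _ (hΘu _ hβ₀Θ)
    have hjk : θ j = β k := hfus j
    rcases le_or_gt ‖θ j - β₀ k‖ r with h | h
    · refine norm_sub_le_of_fusedObjective_update_le hcl hε hq hquad hR β k (Λ := Λ)
        (mem_closedBall_iff_norm.2 h) ?_
      rw [hjk, Function.update_eq_self, ← hθβ]
      exact hle0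
    · exfalso
      have hpos : 0 < ‖θ j - β₀ k‖ := hr.trans h
      -- A fused minimizer outside the ball is impossible: its cluster value is pulled to distance
      -- exactly `r` from the target. By convexity the objective there is still no larger than at
      -- the target, which forces `r ≤ R k`.
      set s := r / ‖θ j - β₀ k‖ with hs
      have hs0 : 0 < s := by positivity
      have hs1 : s ≤ 1 := (div_le_one hpos).2 h.le
      set x := β₀ k + s • (θ j - β₀ k) with hx
      have hxn : ‖x - β₀ k‖ = r := by
        rw [hx, add_sub_cancel_left, norm_smul, Real.norm_of_nonneg hs0.le, hs,
          div_mul_cancel₀ _ hpos.ne']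
      have hc := fusedObjective_combo_le hf cl hΛ0 hε (hΘu _ hβ₀Θ) hθ hs0.le hs1
      have heq : (fun j' => (1 - s) • Function.update β k (β₀ k) (cl j') + s • θ j') =
          fun j' => Function.update β k x (cl j') := by
        funext j'
        rcases eq_or_ne (cl j') k with h | h
        · have : θ j' = θ j := by rw [hfus j', hjk, h]
          rw [h, Function.update_self, Function.update_self, this, hx]
          module
        · rw [Function.update_of_ne h, Function.update_of_ne h, hfus j']
          simp only [hβ]
          module
      rw [heq] at hc
      have := norm_sub_le_of_fusedObjective_update_le hcl hε hq hquad hR β k (Λ := Λ)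
        (mem_closedBall_iff_norm.2 hxn.le) (hc.trans (by nlinarith))
      linarith [hRr k]

end Fusion

/-! ### Euclidean coordinates -/

section Coordinates

variable {d : ℕ}

theorem abs_coord_le_norm (x : Vec d) (a : Fin d) : |x a| ≤ ‖x‖ := PiLp.norm_apply_le x a

theorem norm_le_sum_abs_coord (x : Vec d) : ‖x‖ ≤ ∑ a, |x a| := by
  have h : x = ∑ a, x a • EuclideanSpace.single a (1 : ℝ) := by
    simpa using ((EuclideanSpace.basisFun (Fin d) ℝ).sum_repr x).symm
  calc ‖x‖ = ‖∑ a, x a • EuclideanSpace.single a (1 : ℝ)‖ := by rw [← h]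
    _ ≤ ∑ a, ‖x a • EuclideanSpace.single a (1 : ℝ)‖ := norm_sum_le _ _
    _ = ∑ a, |x a| := by simp [norm_smul]

/-- The vector `e_a + e_b`. -/
noncomputable def pairVec (a b : Fin d) : Vec d :=
  EuclideanSpace.single a (1 : ℝ) + EuclideanSpace.single b (1 : ℝ)

theorem norm_pairVec_le (a b : Fin d) : ‖pairVec a b‖ ≤ 2 := by
  refine (norm_add_le _ _).trans ?_
  simp; norm_num

/-- Polarization: only the symmetric part of `B` enters, and `pairVec a a` is twice a basis vector,
hence the quarters. Controlling a random quadratic form on the unit sphere thus reduces to finitely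
many scalar sums. -/
theorem inner_apply_eq_sum_pairVec (B : Vec d →L[ℝ] Vec d) (v : Vec d) :
    ⟪B v, v⟫_ℝ = ∑ a, ∑ b, v a * v b / 2 * (⟪B (pairVec a b), pairVec a b⟫_ℝ
      - ⟪B (pairVec a a), pairVec a a⟫_ℝ / 4 - ⟪B (pairVec b b), pairVec b b⟫_ℝ / 4) := by
  set e : Fin d → Vec d := fun a => EuclideanSpace.single a (1 : ℝ) with he
  have h : v = ∑ a, v a • e a := by
    simpa using ((EuclideanSpace.basisFun (Fin d) ℝ).sum_repr v).symm
  have h1 : ⟪B v, v⟫_ℝ = ∑ a, ∑ b, v a * v b * ⟪B (e a), e b⟫_ℝ := by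
    conv_lhs => rw [h]
    rw [map_sum, sum_inner]
    refine Finset.sum_congr rfl fun a _ => ?_
    rw [inner_sum]
    refine Finset.sum_congr rfl fun b _ => ?_
    rw [map_smul, inner_smul_left, inner_smul_right]
    simp; ring
  have h2 : ⟪B v, v⟫_ℝ = ∑ a, ∑ b, v a * v b * ⟪B (e b), e a⟫_ℝ := by
    rw [h1, Finset.sum_comm]
    exact Finset.sum_congr rfl fun a _ => Finset.sum_congr rfl fun b _ => by ring
  have h3 : ∀ a b, ⟪B (pairVec a b), pairVec a b⟫_ℝ = ⟪B (e a), e a⟫_ℝ + ⟪B (e a), e b⟫_ℝ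
      + ⟪B (e b), e a⟫_ℝ + ⟪B (e b), e b⟫_ℝ := by
    intro a b
    simp only [pairVec, map_add, inner_add_left, inner_add_right, he]
    ring
  have h4 : ⟪B v, v⟫_ℝ = (⟪B v, v⟫_ℝ + ⟪B v, v⟫_ℝ) / 2 := by ring
  rw [h4]
  nth_rewrite 1 [h1]
  rw [h2, ← Finset.sum_add_distrib, Finset.sum_div]
  refine Finset.sum_congr rfl fun a _ => ?_
  rw [← Finset.sum_add_distrib, Finset.sum_div]
  refine Finset.sum_congr rfl fun b _ => ?_
  rw [h3, h3, h3]
  ring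

theorem abs_sum_pairVec_le (v : Vec d) (q : Fin d → Fin d → ℝ) {c : ℝ} (hc : ∀ a b, |q a b| ≤ c) :
    |∑ a, ∑ b, v a * v b / 2 * (q a b - q a a / 4 - q b b / 4)| ≤ d ^ 2 * c * ‖v‖ ^ 2 := by
  have h1 : ∀ a b, |v a * v b / 2 * (q a b - q a a / 4 - q b b / 4)| ≤ c * ‖v‖ ^ 2 := by
    intro a b
    have hc0 : 0 ≤ c := (abs_nonneg _).trans (hc a b)
    have h2 : |q a b - q a a / 4 - q b b / 4| ≤ 2 * c := by
      have := abs_le.1 (hc a b)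
      have := abs_le.1 (hc a a)
      have := abs_le.1 (hc b b)
      rw [abs_le]; constructor <;> linarith
    have h3 : |v a * v b / 2| ≤ ‖v‖ ^ 2 / 2 := by
      rw [abs_div, abs_mul, abs_two, sq]
      have := abs_coord_le_norm v a
      have := abs_coord_le_norm v b
      gcongr
    rw [abs_mul]
    calc _ ≤ ‖v‖ ^ 2 / 2 * (2 * c) := by gcongr
      _ = _ := by ring
  calc _ ≤ ∑ a, |∑ b, v a * v b / 2 * (q a b - q a a / 4 - q b b / 4)| :=
        Finset.abs_sum_le_sum_abs _ _
    _ ≤ ∑ a : Fin d, ∑ b : Fin d, c * ‖v‖ ^ 2 := by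
        refine Finset.sum_le_sum fun a _ => (Finset.abs_sum_le_sum_abs _ _).trans ?_
        exact Finset.sum_le_sum fun b _ => h1 a b
    _ = _ := by simp; ring

end Coordinates

/-! ### The loss of a single observation -/

namespace MTLExperiment

variable {d : ℕ} (X : MTLExperiment.{u, v, w} d)

/-- Coordinate `a` of the gradient of the loss at the true target. -/
noncomputable def score (j : Fin X.m) (a : Fin d) (η : X.H j) (z : X.Sp j) : ℝ :=
  (X.gradLoss j (X.θstar j) η z) a

/-- The quadratic form of the Hessian of the loss at the true parameters. -/
noncomputable def quadForm (j : Fin X.m) (v : Vec d) (z : X.Sp j) : ℝ :=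
  ⟪X.hessLoss j (X.θstar j) (X.ηstar j) z v, v⟫_ℝ

/-- The remainder of the first order expansion of the loss at the true target. -/
noncomputable def lossRem (j : Fin X.m) (x : Vec d) (η : X.H j) (z : X.Sp j) : ℝ :=
  X.loss j (X.θstar j + x) η z - X.loss j (X.θstar j) η z
    - ⟪X.gradLoss j (X.θstar j) η z, x⟫_ℝ

variable {X}

theorem inner_gradLoss_eq_sum (j : Fin X.m) (η : X.H j) (z : X.Sp j) (x : Vec d) :
    ⟪X.gradLoss j (X.θstar j) η z, x⟫_ℝ = ∑ a, x a * X.score j a η z := by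
  rw [PiLp.inner_apply]
  exact Finset.sum_congr rfl fun a _ => by simp [score]

theorem enorm_hessLoss_sub_le {M : ℝ} {j : Fin X.m} {θ θ' : Vec d} {η η' : X.H j}
    (hθ : θ ∈ Metric.closedBall (X.θstar j) M) (hη : η ∈ Metric.closedBall (X.ηstar j) M)
    (hθ' : θ' ∈ Metric.closedBall (X.θstar j) M) (hη' : η' ∈ Metric.closedBall (X.ηstar j) M)
    (z : X.Sp j) :
    ‖X.hessLoss j θ η z - X.hessLoss j θ' η' z‖ₑ ≤
      X.hessLip M j z * (‖θ - θ'‖ₑ + ‖η - η'‖ₑ) := by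
  by_cases h : (θ, η) = (θ', η')
  · obtain ⟨rfl, rfl⟩ := Prod.mk.inj h
    rw [sub_self, ← ofReal_norm, norm_zero, ENNReal.ofReal_zero]
    exact zero_le
  have h1 : ‖X.hessLoss j θ η z - X.hessLoss j θ' η' z‖ₑ / (‖θ - θ'‖ₑ + ‖η - η'‖ₑ)
      ≤ X.hessLip M j z :=
    le_iSup₂_of_le (θ, η) (θ', η') (le_iSup₂_of_le ⟨hθ, hη⟩ ⟨hθ', hη'⟩ (le_iSup_of_le h le_rfl))
  refine (ENNReal.div_le_iff ?_ ?_).1 h1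
  · intro h0
    have := add_eq_zero.1 h0
    simp only [enorm_eq_zero, sub_eq_zero] at this
    exact h (Prod.ext this.1 this.2)
  · simp

theorem add_smul_mem_closedBall {E : Type*} [SeminormedAddCommGroup E] [NormedSpace ℝ E] {x u : E}
    {M t : ℝ} (hu : ‖u‖ ≤ M) (ht : t ∈ Set.Icc (0 : ℝ) 1) :
    x + t • u ∈ Metric.closedBall x M := by
  rw [mem_closedBall_iff_norm, add_sub_cancel_left, norm_smul, Real.norm_of_nonneg ht.1]
  exact (mul_le_of_le_one_left (norm_nonneg _) ht.2).trans hu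

theorem inner_apply_le (B : Vec d →L[ℝ] Vec d) (v : Vec d) : |⟪B v, v⟫_ℝ| ≤ ‖B‖ * ‖v‖ ^ 2 := by
  refine (abs_real_inner_le_norm _ _).trans ?_
  rw [sq, ← mul_assoc]
  exact mul_le_mul_of_nonneg_right (B.le_opNorm v) (norm_nonneg _)

theorem measurable_loss_line {j : Fin X.m} (η : X.H j) (θ : Vec d) :
    Measurable (X.loss j θ η) :=
  (X.measurable_loss j θ).comp (measurable_const.prodMk measurable_id)

namespace LossRegular

variable {M ρ κ σ₁ σ₂ σ₃ σ₅ r₁ r₂ : ℝ} (hX : X.LossRegular M ρ κ σ₁ σ₂ σ₃ σ₅ r₁ r₂)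
include hX

theorem hasDerivAt_loss {j : Fin X.m} {η : X.H j} (hη : η ∈ Metric.closedBall (X.ηstar j) M)
    {x : Vec d} (hx : ‖x‖ ≤ M) {t : ℝ} (ht : t ∈ Set.Icc (0 : ℝ) 1) (z : X.Sp j) :
    HasDerivAt (fun t : ℝ => X.loss j (X.θstar j + t • x) η z)
      ⟪X.gradLoss j (X.θstar j + t • x) η z, x⟫_ℝ t :=
  DifferentiableAt.hasDerivAt_line
    (hX.loss_twice_differentiable j _ (add_smul_mem_closedBall hx ht) η hη z).1

theorem hasDerivAt_gradLoss {j : Fin X.m} {η : X.H j} (hη : η ∈ Metric.closedBall (X.ηstar j) M)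
    {x : Vec d} (hx : ‖x‖ ≤ M) {t : ℝ} (ht : t ∈ Set.Icc (0 : ℝ) 1) (z : X.Sp j) :
    HasDerivAt (fun t : ℝ => ⟪X.gradLoss j (X.θstar j + t • x) η z, x⟫_ℝ)
      ⟪X.hessLoss j (X.θstar j + t • x) η z x, x⟫_ℝ t :=
  TwiceDifferentiableAt.hasDerivAt_line
    (hX.loss_twice_differentiable j _ (add_smul_mem_closedBall hx ht) η hη z)

/-- Taylor along the segment in the target parameter, with the Hessian compared to its value at the
true parameters; the Lipschitz ratio accounts for the moves in both arguments. -/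
theorem abs_lossRem_sub_le (hM : 0 < M) {j : Fin X.m} {η : X.H j}
    (hη : η ∈ Metric.closedBall (X.ηstar j) M) {x : Vec d} (hx : ‖x‖ ≤ M) {z : X.Sp j} {A : ℝ}
    (hA : 0 ≤ A) (hL : X.hessLip M j z ≤ ENNReal.ofReal A) :
    |X.lossRem j x η z - X.quadForm j x z / 2| ≤
      A * (‖x‖ + ‖η - X.ηstar j‖) * ‖x‖ ^ 2 / 2 := by
  have h := abs_taylor_two_sub_le (φ := fun t : ℝ => X.loss j (X.θstar j + t • x) η z)
    (B := X.quadForm j x z) (D := A * (‖x‖ + ‖η - X.ηstar j‖) * ‖x‖ ^ 2)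
    (fun t ht => hX.hasDerivAt_loss hη hx ht z) (fun t ht => hX.hasDerivAt_gradLoss hη hx ht z)
    (fun t ht => by
      rw [quadForm, ← inner_sub_left, ← _root_.sub_apply]
      refine (inner_apply_le _ _).trans ?_
      gcongr
      have h1 := enorm_hessLoss_sub_le (add_smul_mem_closedBall hx ht) hη
        (Metric.mem_closedBall_self hM.le) (Metric.mem_closedBall_self hM.le) z
      have h2 : ‖X.θstar j + t • x - X.θstar j‖ₑ ≤ ‖x‖ₑ := by
        rw [add_sub_cancel_left, enorm_smul]
        refine mul_le_of_le_one_left' ?_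
        rw [Real.enorm_eq_ofReal ht.1]
        exact ENNReal.ofReal_le_one.2 ht.2
      have h3 := h1.trans (mul_le_mul' hL (add_le_add_left h2 _))
      rw [← ofReal_norm, ← ofReal_norm, ← ofReal_norm,
        ← ENNReal.ofReal_add (norm_nonneg _) (norm_nonneg _), ← ENNReal.ofReal_mul hA] at h3
      exact (ENNReal.ofReal_le_ofReal_iff (by positivity)).1 h3)
  simpa [lossRem] using h

/-- Taylor for the difference of the losses at the two nuisances, where the Hessians are compared at
the same target point. Only the product of the Lipschitz ratio and the nuisance error enters, and
its mean is small by independence. -/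
theorem abs_lossRem_sub_lossRem_le (hM : 0 < M) {j : Fin X.m} {η : X.H j}
    (hη : η ∈ Metric.closedBall (X.ηstar j) M) {x : Vec d} (hx : ‖x‖ ≤ M) {z : X.Sp j} {c : ℝ}
    (hc : 0 ≤ c) (hL : X.hessLip M j z * ‖η - X.ηstar j‖ₑ ≤ ENNReal.ofReal c) :
    |X.lossRem j x η z - X.lossRem j x (X.ηstar j) z| ≤ c * ‖x‖ ^ 2 / 2 := by
  have hη' : X.ηstar j ∈ Metric.closedBall (X.ηstar j) M := Metric.mem_closedBall_self hM.le
  have h := abs_taylor_two_sub_le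
    (φ := fun t : ℝ => X.loss j (X.θstar j + t • x) η z
      - X.loss j (X.θstar j + t • x) (X.ηstar j) z) (B := 0) (D := c * ‖x‖ ^ 2)
    (fun t ht => (hX.hasDerivAt_loss hη hx ht z).sub (hX.hasDerivAt_loss hη' hx ht z))
    (fun t ht => (hX.hasDerivAt_gradLoss hη hx ht z).sub (hX.hasDerivAt_gradLoss hη' hx ht z))
    (fun t ht => by
      rw [sub_zero, ← inner_sub_left, ← _root_.sub_apply]
      refine (inner_apply_le _ _).trans ?_
      gcongr
      have h1 := enorm_hessLoss_sub_le (add_smul_mem_closedBall hx ht) hη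
        (add_smul_mem_closedBall hx ht) hη' z
      rw [sub_self, enorm_zero, zero_add] at h1
      have h3 := h1.trans hL
      rw [← ofReal_norm] at h3
      exact (ENNReal.ofReal_le_ofReal_iff hc).1 h3)
  simp only [zero_smul, add_zero, one_smul, zero_div, sub_zero] at h
  refine le_of_eq_of_le ?_ h
  unfold lossRem
  congr 1; ring

theorem lossRem_nonneg (hM : 0 < M) {j : Fin X.m} {η : X.H j}
    (hη : η ∈ Metric.closedBall (X.ηstar j) M) {x : Vec d} (hx : ‖x‖ ≤ M) (z : X.Sp j) :
    0 ≤ X.lossRem j x η z := by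
  have h1 : X.θstar j ∈ Metric.closedBall (X.θstar j) M := Metric.mem_closedBall_self hM.le
  have h2 : X.θstar j + x ∈ Metric.closedBall (X.θstar j) M := by
    rwa [mem_closedBall_iff_norm, add_sub_cancel_left]
  have := (hX.convex j η hη z).add_inner_gradient_le (hX.ball_subset j h1) (hX.ball_subset j h2)
    (hX.loss_twice_differentiable j _ h1 η hη z).1
  rw [add_sub_cancel_left] at this
  unfold lossRem gradLoss
  linarith

/-! Measurability of the derivatives. -/

/-- Joint measurability in nuisance and observation is needed to freeze the nuisance estimator by
Fubini. It comes from difference quotients of the loss, and the indicator confines it to where the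
loss is known to be differentiable. -/
theorem measurable_score_indicator (hM : 0 < M) (j : Fin X.m) (a : Fin d) :
    Measurable ((Metric.closedBall (X.ηstar j) M ×ˢ (Set.univ : Set (X.Sp j))).indicator
      fun x => X.score j a x.1 x.2) := by
  set s := Metric.closedBall (X.ηstar j) M ×ˢ (Set.univ : Set (X.Sp j)) with hs
  have hms : MeasurableSet s := Metric.isClosed_closedBall.measurableSet.prod MeasurableSet.univ
  -- Length `M` keeps the whole segment in the ball of differentiability; the factor `M⁻¹` below
  -- undoes the scaling.
  set e : Vec d := M • EuclideanSpace.single a (1 : ℝ) with he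
  have hen : ‖e‖ ≤ M := by simp [he, norm_smul, abs_of_pos hM]
  have h := measurable_of_hasDerivWithinAt_Icc
    (φ := fun t => s.indicator fun x => X.loss j (X.θstar j + t • e) x.1 x.2)
    (φ' := fun t => s.indicator fun x => ⟪X.gradLoss j (X.θstar j + t • e) x.1 x.2, e⟫_ℝ)
    (fun t _ => (X.measurable_loss j _).indicator hms) (fun x t ht => by
      by_cases hx : x ∈ s
      · simp only [Set.indicator_of_mem hx]
        exact (hX.hasDerivAt_loss hx.1 hen ht x.2).hasDerivWithinAt
      · simp only [Set.indicator_of_notMem hx]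
        exact hasDerivWithinAt_const _ _ _) 0 (by simp)
  have h2 := h.const_mul M⁻¹
  convert! h2 using 1
  funext x
  by_cases hx : x ∈ s
  · simp only [Set.indicator_of_mem hx, zero_smul, add_zero, he, inner_smul_right,
      EuclideanSpace.inner_single_right, score]
    simp [hM.ne']
  · simp [Set.indicator_of_notMem hx]

theorem measurable_score (hM : 0 < M) {j : Fin X.m} (a : Fin d) {η : X.H j}
    (hη : η ∈ Metric.closedBall (X.ηstar j) M) : Measurable (X.score j a η) := by
  have h := (hX.measurable_score_indicator hM j a).comp
    (measurable_const.prodMk measurable_id : Measurable fun z : X.Sp j => (η, z))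
  convert! h using 1
  funext z
  have hmem : (η, z) ∈ Metric.closedBall (X.ηstar j) M ×ˢ (Set.univ : Set (X.Sp j)) :=
    ⟨hη, trivial⟩
  simp only [Function.comp_apply]
  rw [Set.indicator_of_mem hmem]

theorem measurable_inner_gradLoss {j : Fin X.m} {η : X.H j}
    (hη : η ∈ Metric.closedBall (X.ηstar j) M) {x : Vec d} (hx : ‖x‖ ≤ M) :
    ∀ t ∈ Set.Icc (0 : ℝ) 1, Measurable fun z => ⟪X.gradLoss j (X.θstar j + t • x) η z, x⟫_ℝ :=
  measurable_of_hasDerivWithinAt_Icc (φ := fun t => X.loss j (X.θstar j + t • x) η)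
    (fun _ _ => measurable_loss_line η _)
    fun z _ ht => (hX.hasDerivAt_loss hη hx ht z).hasDerivWithinAt

theorem measurable_lossRem {j : Fin X.m} {η : X.H j}
    (hη : η ∈ Metric.closedBall (X.ηstar j) M) {x : Vec d} (hx : ‖x‖ ≤ M) :
    Measurable (X.lossRem j x η) := by
  refine ((measurable_loss_line η _).sub (measurable_loss_line η _)).sub ?_
  simpa using hX.measurable_inner_gradLoss hη hx 0 (by simp)

theorem measurable_quadForm (hM : 0 < M) (j : Fin X.m) (x : Vec d) :
    Measurable (X.quadForm j x) := by
  have hη : X.ηstar j ∈ Metric.closedBall (X.ηstar j) M := Metric.mem_closedBall_self hM.le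
  set c := M / (‖x‖ + M) with hc
  have hpos : 0 < ‖x‖ + M := by positivity
  have hc0 : 0 < c := by positivity
  have hcx : ‖c • x‖ ≤ M := by
    rw [norm_smul, Real.norm_of_nonneg hc0.le, hc, div_mul_eq_mul_div, div_le_iff₀ hpos]
    nlinarith [norm_nonneg x]
  have h := measurable_of_hasDerivWithinAt_Icc
    (φ := fun t z => ⟪X.gradLoss j (X.θstar j + t • c • x) (X.ηstar j) z, c • x⟫_ℝ)
    (hX.measurable_inner_gradLoss hη hcx)
    (fun z t ht => (hX.hasDerivAt_gradLoss hη hcx ht z).hasDerivWithinAt) 0 (by simp)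
  have h2 := h.const_mul (c ^ 2)⁻¹
  convert! h2 using 1
  funext z
  simp only [zero_smul, add_zero, map_smul, inner_smul_left, inner_smul_right, quadForm]
  simp
  field_simp

/-! Moments. -/

theorem abs_hessRisk_le {j : Fin X.m} (hρ : 0 < ρ) {θ : Vec d}
    (hθ : θ ∈ Metric.closedBall (X.θstar j) M) (v : Vec d) :
    ρ * ‖v‖ ^ 2 ≤ ⟪X.hessRisk j θ v, v⟫_ℝ ∧ ⟪X.hessRisk j θ v, v⟫_ℝ ≤ κ * ‖v‖ ^ 2 ∧
      |⟪X.hessRisk j θ v, v⟫_ℝ| ≤ κ * ‖v‖ ^ 2 := by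
  have h1 := (hX.curvature j θ hθ).1.inner_nonneg_left v
  have h2 := (hX.curvature j θ hθ).2.inner_nonneg_left v
  simp only [_root_.sub_apply, _root_.smul_apply,
    ContinuousLinearMap.id_apply, inner_sub_left, inner_smul_left, real_inner_self_eq_norm_sq] at h1 h2
  simp at h1 h2
  have h3 : 0 ≤ ρ * ‖v‖ ^ 2 := by positivity
  exact ⟨h1, h2, abs_le.2 ⟨by linarith, h2⟩⟩

/-- For unit vectors, centre at the population Hessian, which is at most `κ`, and bound the square
of the deviation by one plus its power `r₂`. Homogeneity of degree four gives general vectors. -/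
theorem lintegral_hessLoss_sq_le (hρ : 0 < ρ) (hσ₂ : 0 < σ₂) (hr₂ : 2 < r₂) {j : Fin X.m}
    {θ : Vec d} (hθ : θ ∈ Metric.closedBall (X.θstar j) M) (v : Vec d) :
    ∫⁻ z, ‖⟪X.hessLoss j θ (X.ηstar j) z v, v⟫_ℝ‖ₑ ^ (2 : ℝ) ∂X.P j ≤
      ENNReal.ofReal ((2 + 2 * κ ^ 2 + 2 * σ₂) * ‖v‖ ^ 4) := by
  have hunit : ∀ w : Vec d, ‖w‖ = 1 →
      ∫⁻ z, ‖⟪X.hessLoss j θ (X.ηstar j) z w, w⟫_ℝ‖ₑ ^ (2 : ℝ) ∂X.P j ≤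
        ENNReal.ofReal (2 + 2 * κ ^ 2 + 2 * σ₂) := by
    intro w hw
    have hpt : ∀ z, ‖⟪X.hessLoss j θ (X.ηstar j) z w, w⟫_ℝ‖ₑ ^ (2 : ℝ) ≤
        ENNReal.ofReal (2 + 2 * κ ^ 2) + ENNReal.ofReal 2 *
          ‖⟪w, (X.hessLoss j θ (X.ηstar j) z - X.hessRisk j θ) w⟫_ℝ‖ₑ ^ r₂ := by
      intro z
      set x := ⟪X.hessLoss j θ (X.ηstar j) z w, w⟫_ℝ with hx
      set h := ⟪X.hessRisk j θ w, w⟫_ℝ with hh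
      have hy : ⟪w, (X.hessLoss j θ (X.ηstar j) z - X.hessRisk j θ) w⟫_ℝ = x - h := by
        rw [real_inner_comm, _root_.sub_apply, inner_sub_left]
      have hk := (hX.abs_hessRisk_le hρ hθ w).2.2
      rw [hw, one_pow, mul_one, ← hh] at hk
      rw [hy, Real.enorm_eq_ofReal_abs, Real.enorm_eq_ofReal_abs,
        ENNReal.ofReal_rpow_of_nonneg (abs_nonneg _) (by norm_num),
        ENNReal.ofReal_rpow_of_nonneg (abs_nonneg _) (by linarith),
        ← ENNReal.ofReal_mul (by norm_num), ← ENNReal.ofReal_add (by positivity) (by positivity)]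
      refine ENNReal.ofReal_le_ofReal ?_
      have h1 := sq_le_one_add_rpow hr₂ (x - h)
      have h2 : h ^ 2 ≤ κ ^ 2 := by
        rw [← sq_abs h]
        exact pow_le_pow_left₀ (abs_nonneg _) hk 2
      rw [Real.rpow_two, sq_abs]
      nlinarith [sq_nonneg (x - 2 * h)]
    refine (lintegral_mono hpt).trans ?_
    rw [lintegral_add_left measurable_const, lintegral_const_mul' _ _ (by simp)]
    simp only [lintegral_const, measure_univ, mul_one]
    calc _ ≤ ENNReal.ofReal (2 + 2 * κ ^ 2) + ENNReal.ofReal 2 * ENNReal.ofReal σ₂ := by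
          gcongr
          exact hX.hessian_moment j w hw θ hθ
      _ = _ := by
          rw [← ENNReal.ofReal_mul (by norm_num), ← ENNReal.ofReal_add (by positivity) (by positivity)]
  rcases eq_or_ne v 0 with rfl | hv
  · simp
  have hv0 : 0 < ‖v‖ := norm_pos_iff.2 hv
  set w := ‖v‖⁻¹ • v with hw
  have hw1 : ‖w‖ = 1 := by
    rw [hw, norm_smul, norm_inv, norm_norm, inv_mul_cancel₀ hv0.ne']
  have hvw : v = ‖v‖ • w := by rw [hw, smul_smul, mul_inv_cancel₀ hv0.ne', one_smul]
  have hpt : ∀ z, ‖⟪X.hessLoss j θ (X.ηstar j) z v, v⟫_ℝ‖ₑ ^ (2 : ℝ) =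
      ENNReal.ofReal (‖v‖ ^ 4) * ‖⟪X.hessLoss j θ (X.ηstar j) z w, w⟫_ℝ‖ₑ ^ (2 : ℝ) := by
    intro z
    conv_lhs => rw [hvw]
    rw [map_smul, inner_smul_left, inner_smul_right, ← mul_assoc, enorm_mul,
      ENNReal.mul_rpow_of_nonneg _ _ (by norm_num)]
    congr 1
    simp only [conj_trivial]
    rw [Real.enorm_eq_ofReal (by positivity), ENNReal.ofReal_rpow_of_nonneg (by positivity)
      (by norm_num), Real.rpow_two]
    congr 1; ring
  simp_rw [hpt]
  rw [lintegral_const_mul' _ _ (by simp), mul_comm (2 + 2 * κ ^ 2 + 2 * σ₂),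
    ENNReal.ofReal_mul (by positivity)]
  gcongr
  exact hunit w hw1

theorem memLp_quadForm (hM : 0 < M) (hρ : 0 < ρ) (hσ₂ : 0 < σ₂) (hr₂ : 2 < r₂) (j : Fin X.m)
    (v : Vec d) : MemLp (X.quadForm j v) 2 (X.P j) ∧
      ∫ z, X.quadForm j v z ^ 2 ∂X.P j ≤ (2 + 2 * κ ^ 2 + 2 * σ₂) * ‖v‖ ^ 4 :=
  memLp_two_of_lintegral_le (hX.measurable_quadForm hM j v) (by positivity)
    (hX.lintegral_hessLoss_sq_le hρ hσ₂ hr₂ (Metric.mem_closedBall_self hM.le) v)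

theorem memLp_lossRem (hM : 0 < M) (hρ : 0 < ρ) (hσ₂ : 0 < σ₂) (hr₂ : 2 < r₂) (j : Fin X.m)
    {x : Vec d} (hx : ‖x‖ ≤ M) : MemLp (X.lossRem j x (X.ηstar j)) 2 (X.P j) ∧
      ∫ z, X.lossRem j x (X.ηstar j) z ^ 2 ∂X.P j ≤ (2 + 2 * κ ^ 2 + 2 * σ₂) * ‖x‖ ^ 4 := by
  have hη : X.ηstar j ∈ Metric.closedBall (X.ηstar j) M := Metric.mem_closedBall_self hM.le
  refine memLp_two_of_lintegral_le (hX.measurable_lossRem hη hx) (by positivity) ?_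
  have := lintegral_enorm_taylor_two_rpow_le (μ := X.P j)
    (φ := fun t => X.loss j (X.θstar j + t • x) (X.ηstar j))
    (fun _ _ => measurable_loss_line _ _)
    (fun z t ht => (hX.hasDerivAt_loss hη hx ht z).hasDerivWithinAt)
    (fun z t ht => (hX.hasDerivAt_gradLoss hη hx ht z).hasDerivWithinAt) one_le_two
    (fun t ht => hX.lintegral_hessLoss_sq_le hρ hσ₂ hr₂ (add_smul_mem_closedBall hx ht) x)
  simpa [lossRem] using this

theorem memLp_score (hM : 0 < M) (hσ₁ : 0 < σ₁) (hr₁ : 2 < r₁) (j : Fin X.m) (a : Fin d) :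
    MemLp (X.score j a (X.ηstar j)) (ENNReal.ofReal r₁) (X.P j) ∧
      ∫ z, |X.score j a (X.ηstar j) z| ^ r₁ ∂X.P j ≤ σ₁ := by
  refine memLp_of_lintegral_rpow_le (hX.measurable_score hM a (Metric.mem_closedBall_self hM.le))
    (by linarith) hσ₁.le ((lintegral_mono fun z => ?_).trans (hX.score_moment j))
  refine ENNReal.rpow_le_rpow ?_ (by linarith)
  exact enorm_le_iff_norm_le.2 (PiLp.norm_apply_le _ a)

theorem memLp_score_two (hM : 0 < M) (hσ₁ : 0 < σ₁) (hr₁ : 2 < r₁) (j : Fin X.m) (a : Fin d) :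
    MemLp (X.score j a (X.ηstar j)) 2 (X.P j) ∧
      ∫ z, X.score j a (X.ηstar j) z ^ 2 ∂X.P j ≤ 1 + σ₁ := by
  obtain ⟨h1, h2⟩ := hX.memLp_score hM hσ₁ hr₁ j a
  have htwo : (2 : ℝ≥0∞) ≤ ENNReal.ofReal r₁ := by
    rw [← ENNReal.ofReal_ofNat]; exact ENNReal.ofReal_le_ofReal hr₁.le
  have h3 := h1.mono_exponent htwo
  refine ⟨h3, ?_⟩
  have hi : Integrable (fun z => |X.score j a (X.ηstar j) z| ^ r₁) (X.P j) := by
    have := h1.integrable_norm_rpow (by simp; linarith) (by simp)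
    simpa [ENNReal.toReal_ofReal (show 0 ≤ r₁ by linarith)] using this
  calc _ ≤ ∫ z, (1 + |X.score j a (X.ηstar j) z| ^ r₁) ∂X.P j :=
        integral_mono h3.integrable_sq ((integrable_const 1).add hi) fun z =>
          sq_le_one_add_rpow hr₁ _
    _ ≤ _ := by
        rw [integral_add (integrable_const 1) hi]
        simpa using h2

end LossRegular

end MTLExperiment

/-! ### Means of the score and the Hessian form, truncation, and the effect of the nuisance. -/

namespace MTLExperiment

variable {d : ℕ} {X : MTLExperiment.{u, v, w} d}

theorem quadForm_smul (j : Fin X.m) (t : ℝ) (v : Vec d) (z : X.Sp j) :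
    X.quadForm j (t • v) z = t ^ 2 * X.quadForm j v z := by
  simp only [quadForm, map_smul, inner_smul_left, inner_smul_right, conj_trivial]
  ring

theorem quadForm_eq_sum (j : Fin X.m) (v : Vec d) (z : X.Sp j) :
    X.quadForm j v z = ∑ a, ∑ b, v a * v b / 2 * (X.quadForm j (pairVec a b) z
      - X.quadForm j (pairVec a a) z / 4 - X.quadForm j (pairVec b b) z / 4) :=
  inner_apply_eq_sum_pairVec _ v

theorem abs_quadForm_le (j : Fin X.m) (v : Vec d) (z : X.Sp j) :
    |X.quadForm j v z| ≤ d ^ 2 * (∑ a, ∑ b, |X.quadForm j (pairVec a b) z|) * ‖v‖ ^ 2 := by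
  rw [quadForm_eq_sum]
  refine abs_sum_pairVec_le v (fun a b => X.quadForm j (pairVec a b) z) fun a b => ?_
  exact (Finset.single_le_sum (f := fun b => |X.quadForm j (pairVec a b) z|)
    (fun _ _ => abs_nonneg _) (Finset.mem_univ b)).trans
    (Finset.single_le_sum (f := fun a => ∑ b, |X.quadForm j (pairVec a b) z|)
      (fun _ _ => Finset.sum_nonneg fun _ _ => abs_nonneg _) (Finset.mem_univ a))

theorem integrable_inner_gradLoss {j : Fin X.m} {η : X.H j}
    (hint : ∀ a, Integrable (X.score j a η) (X.P j)) (x : Vec d) :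
    Integrable (fun z => ⟪X.gradLoss j (X.θstar j) η z, x⟫_ℝ) (X.P j) ∧
      ∫ z, ⟪X.gradLoss j (X.θstar j) η z, x⟫_ℝ ∂X.P j = ∑ a, x a * ∫ z, X.score j a η z ∂X.P j := by
  simp only [inner_gradLoss_eq_sum]
  refine ⟨integrable_finsetSum _ fun a _ => (hint a).const_mul _, ?_⟩
  rw [integral_finsetSum _ fun a _ => (hint a).const_mul _]
  simp only [integral_const_mul]

namespace LossRegular

variable {M ρ κ σ₁ σ₂ σ₃ σ₅ r₁ r₂ : ℝ} (hX : X.LossRegular M ρ κ σ₁ σ₂ σ₃ σ₅ r₁ r₂)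
include hX

/-- An integrable real majorant of the Lipschitz ratio of the Hessian. -/
theorem exists_integrable_hessLip (hσ₃ : 0 < σ₃) (j : Fin X.m) :
    ∃ L : X.Sp j → ℝ≥0∞, Measurable L ∧ (∀ z, X.hessLip M j z ≤ L z) ∧
      ∫⁻ z, L z ∂X.P j ≤ ENNReal.ofReal σ₃ ∧ Integrable (fun z => (L z).toReal) (X.P j) ∧
      ∫ z, (L z).toReal ∂X.P j ≤ σ₃ ∧
      ∀ᵐ z ∂X.P j, X.hessLip M j z ≤ ENNReal.ofReal (L z).toReal := by
  obtain ⟨L, hm, hle, hint⟩ := hX.hessian_lipschitz j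
  have hne : ∫⁻ z, L z ∂X.P j ≠ ∞ := ne_top_of_le_ne_top ENNReal.ofReal_ne_top hint
  have hfin := ae_lt_top hm hne
  refine ⟨L, hm, hle, hint, integrable_toReal_of_lintegral_ne_top hm.aemeasurable hne, ?_, ?_⟩
  · rw [integral_toReal hm.aemeasurable hfin]
    exact ENNReal.toReal_le_of_le_ofReal hσ₃.le hint
  · filter_upwards [hfin] with z hz
    rw [ENNReal.ofReal_toReal hz.ne]
    exact hle z

theorem integral_lossRem (hM : 0 < M) {j : Fin X.m} {η : X.H j}
    (hη : η ∈ Metric.closedBall (X.ηstar j) M)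
    (hint : ∀ a, Integrable (X.score j a η) (X.P j)) {x : Vec d} (hx : ‖x‖ ≤ M) :
    Integrable (X.lossRem j x η) (X.P j) ∧
      ∫ z, X.lossRem j x η z ∂X.P j = X.risk j (X.θstar j + x) η - X.risk j (X.θstar j) η -
        ∑ a, x a * ∫ z, X.score j a η z ∂X.P j := by
  have h0 := hX.loss_integrable j _ (Metric.mem_closedBall_self hM.le) η hη
  have h1 : Integrable (X.loss j (X.θstar j + x) η) (X.P j) := by
    refine hX.loss_integrable j _ ?_ η hη
    rwa [mem_closedBall_iff_norm, add_sub_cancel_left]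
  obtain ⟨h2, h3⟩ := integrable_inner_gradLoss hint x
  refine ⟨(h1.sub h0).sub h2, ?_⟩
  have h10 : Integrable (fun z => X.loss j (X.θstar j + x) η z - X.loss j (X.θstar j) η z) (X.P j) :=
    h1.sub h0
  unfold lossRem
  rw [integral_sub h10 h2, integral_sub h1 h0, h3]
  rfl

/-- The remainder of the loss is at most `‖x‖²` times a fixed integrable function, so the integrated
first order expansion is itself the differentiability of the risk, with gradient the mean score. -/
theorem gradRisk_apply (hM : 0 < M) (hρ : 0 < ρ) (hσ₂ : 0 < σ₂) (hσ₃ : 0 < σ₃) (hr₂ : 2 < r₂)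
    {j : Fin X.m} {η : X.H j} (hη : η ∈ Metric.closedBall (X.ηstar j) M)
    (hint : ∀ a, Integrable (X.score j a η) (X.P j)) (a : Fin d) :
    X.gradRisk j (X.θstar j) η a = ∫ z, X.score j a η z ∂X.P j := by
  obtain ⟨L, -, -, -, hLi, -, hL⟩ := hX.exists_integrable_hessLip hσ₃ j
  set D : X.Sp j → ℝ := fun z =>
    d ^ 2 * (∑ a, ∑ b, |X.quadForm j (pairVec a b) z|) + 2 * M * (L z).toReal with hD
  have hDi : Integrable D (X.P j) := by
    refine Integrable.add (Integrable.const_mul ?_ _) (hLi.const_mul _)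
    exact integrable_finsetSum _ fun a _ => integrable_finsetSum _ fun b _ =>
      ((hX.memLp_quadForm hM hρ hσ₂ hr₂ j _).1.integrable one_le_two).abs
  have hrem : ∀ x : Vec d, ‖x‖ ≤ M → ∀ᵐ z ∂X.P j, ‖X.lossRem j x η z‖ ≤ ‖x‖ ^ 2 * D z := by
    intro x hx
    filter_upwards [hL] with z hz
    have h1 := hX.abs_lossRem_sub_le hM hη hx ENNReal.toReal_nonneg hz
    have h2 := abs_quadForm_le j x z
    have h3 : ‖η - X.ηstar j‖ ≤ M := mem_closedBall_iff_norm.1 hη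
    have h4 : (L z).toReal * (‖x‖ + ‖η - X.ηstar j‖) * ‖x‖ ^ 2 ≤
        (L z).toReal * (M + M) * ‖x‖ ^ 2 := by
      gcongr
    have h5 := abs_le.1 h1
    have h6 := abs_le.1 h2
    have h7 : 0 ≤ d ^ 2 * (∑ a, ∑ b, |X.quadForm j (pairVec a b) z|) * ‖x‖ ^ 2 := by positivity
    have h8 : 0 ≤ (L z).toReal * (M + M) * ‖x‖ ^ 2 := by positivity
    rw [Real.norm_eq_abs, abs_le, hD]
    constructor <;> nlinarith
  set G : Vec d := WithLp.toLp 2 fun a => ∫ z, X.score j a η z ∂X.P j with hG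
  have hgrad : HasGradientAt (fun θ => X.risk j θ η) G (X.θstar j) := by
    rw [hasGradientAt_iff_hasFDerivAt, hasFDerivAt_iff_isLittleO_nhds_zero]
    refine Asymptotics.IsBigO.trans_isLittleO (g := fun x : Vec d => ‖x‖ ^ 2) ?_
      (Asymptotics.isLittleO_norm_pow_id one_lt_two)
    refine Asymptotics.IsBigO.of_bound (∫ z, D z ∂X.P j) ?_
    filter_upwards [Metric.closedBall_mem_nhds (0 : Vec d) hM] with x hx
    rw [mem_closedBall_zero_iff] at hx
    obtain ⟨h1, h2⟩ := hX.integral_lossRem hM hη hint hx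
    have h3 : X.risk j (X.θstar j + x) η - X.risk j (X.θstar j) η -
        (InnerProductSpace.toDual ℝ (Vec d)) G x = ∫ z, X.lossRem j x η z ∂X.P j := by
      rw [h2, InnerProductSpace.toDual_apply_apply, PiLp.inner_apply]
      simp [hG]
    rw [h3, norm_pow, norm_norm]
    calc _ ≤ ∫ z, ‖x‖ ^ 2 * D z ∂X.P j :=
          norm_integral_le_of_norm_le (hDi.const_mul _) (hrem x hx)
      _ = _ := by rw [integral_const_mul, mul_comm]
  rw [gradRisk, hgrad.gradient]

theorem integrable_score_star (hM : 0 < M) (hσ₁ : 0 < σ₁) (hr₁ : 2 < r₁) (j : Fin X.m) (a : Fin d) :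
    Integrable (X.score j a (X.ηstar j)) (X.P j) :=
  (hX.memLp_score_two hM hσ₁ hr₁ j a).1.integrable one_le_two

theorem integral_score_star (hM : 0 < M) (hρ : 0 < ρ) (hσ₁ : 0 < σ₁) (hσ₂ : 0 < σ₂) (hσ₃ : 0 < σ₃)
    (hr₁ : 2 < r₁) (hr₂ : 2 < r₂) (j : Fin X.m) (a : Fin d) :
    ∫ z, X.score j a (X.ηstar j) z ∂X.P j = 0 := by
  rw [← hX.gradRisk_apply hM hρ hσ₂ hσ₃ hr₂ (Metric.mem_closedBall_self hM.le)
    (hX.integrable_score_star hM hσ₁ hr₁ j) a, hX.score_mean j]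
  rfl

theorem risk_sub_ge (hρ : 0 < ρ) (j : Fin X.m) {x : Vec d} (hx : ‖x‖ ≤ M) :
    ρ * ‖x‖ ^ 2 / 2 ≤ X.risk j (X.θstar j + x) (X.ηstar j) - X.risk j (X.θstar j) (X.ηstar j) := by
  have hd : ∀ t ∈ Set.Icc (0 : ℝ) 1, TwiceDifferentiableAt
      (fun θ => X.risk j θ (X.ηstar j)) (X.θstar j + t • x) := fun t ht =>
    hX.risk_twice_differentiable j _ (add_smul_mem_closedBall hx ht)
  have h := taylor_two_le (B := -(ρ * ‖x‖ ^ 2))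
    (fun t ht => (DifferentiableAt.hasDerivAt_line (hd t ht).1).neg)
    (fun t ht => (TwiceDifferentiableAt.hasDerivAt_line (hd t ht)).neg)
    (fun t ht => neg_le_neg
      (hX.abs_hessRisk_le hρ (add_smul_mem_closedBall hx ht) x).1)
  have h0 : gradient (fun θ => X.risk j θ (X.ηstar j)) (X.θstar j) = 0 := hX.score_mean j
  simp only [Pi.neg_apply, zero_smul, add_zero, one_smul, h0, inner_zero_left] at h
  linarith

/-- The mean of the loss Hessian is not identified with the Hessian of the risk. Instead the growth
`ρ ‖x‖² / 2` of the risk is compared with the integrated expansion of the loss, whose cubic error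
disappears on scaling `x = t v` and letting `t` tend to zero. -/
theorem le_integral_quadForm (hM : 0 < M) (hρ : 0 < ρ) (hσ₁ : 0 < σ₁) (hσ₂ : 0 < σ₂)
    (hσ₃ : 0 < σ₃) (hr₁ : 2 < r₁) (hr₂ : 2 < r₂) (j : Fin X.m) (v : Vec d) :
    ρ * ‖v‖ ^ 2 ≤ ∫ z, X.quadForm j v z ∂X.P j := by
  obtain ⟨L, -, -, -, hLi, hLσ, hL⟩ := hX.exists_integrable_hessLip hσ₃ j
  have hη : X.ηstar j ∈ Metric.closedBall (X.ηstar j) M := Metric.mem_closedBall_self hM.le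
  have hqi : ∀ x, Integrable (X.quadForm j x) (X.P j) := fun x =>
    (hX.memLp_quadForm hM hρ hσ₂ hr₂ j x).1.integrable one_le_two
  have hsmall : ∀ x : Vec d, ‖x‖ ≤ M →
      ρ * ‖x‖ ^ 2 ≤ ∫ z, X.quadForm j x z ∂X.P j + σ₃ * ‖x‖ ^ 3 := by
    intro x hx
    obtain ⟨h1, h2⟩ := hX.integral_lossRem hM hη (hX.integrable_score_star hM hσ₁ hr₁ j) hx
    simp only [hX.integral_score_star hM hρ hσ₁ hσ₂ hσ₃ hr₁ hr₂, mul_zero, Finset.sum_const_zero,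
      sub_zero] at h2
    have h3 := hX.risk_sub_ge hρ j hx
    have hi2 : Integrable (fun z => X.quadForm j x z / 2 + (L z).toReal * (‖x‖ ^ 3 / 2)) (X.P j) :=
      ((hqi x).div_const 2).add (hLi.mul_const _)
    have h4 : ∫ z, X.lossRem j x (X.ηstar j) z ∂X.P j ≤
        ∫ z, (X.quadForm j x z / 2 + (L z).toReal * (‖x‖ ^ 3 / 2)) ∂X.P j := by
      refine integral_mono_ae h1 hi2 ?_
      filter_upwards [hL] with z hz
      have := (abs_le.1 (hX.abs_lossRem_sub_le hM hη hx ENNReal.toReal_nonneg hz)).2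
      rw [sub_self, norm_zero, add_zero] at this
      calc _ ≤ X.quadForm j x z / 2 + (L z).toReal * ‖x‖ * ‖x‖ ^ 2 / 2 := by linarith
        _ = _ := by ring
    rw [integral_add ((hqi x).div_const 2) (hLi.mul_const _), integral_div, integral_mul_const] at h4
    have h5 : (∫ z, (L z).toReal ∂X.P j) * (‖x‖ ^ 3 / 2) ≤ σ₃ * (‖x‖ ^ 3 / 2) := by gcongr
    linarith
  rcases eq_or_ne v 0 with rfl | hv
  · simp [quadForm]
  have hv0 : 0 < ‖v‖ := norm_pos_iff.2 hv
  have hlim : Tendsto (fun t : ℝ => ∫ z, X.quadForm j v z ∂X.P j + σ₃ * t * ‖v‖ ^ 3) (𝓝[>] 0)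
      (𝓝 (∫ z, X.quadForm j v z ∂X.P j + σ₃ * 0 * ‖v‖ ^ 3)) := by
    refine Tendsto.mono_left (Continuous.tendsto ?_ 0) nhdsWithin_le_nhds
    fun_prop
  rw [mul_zero, zero_mul, add_zero] at hlim
  refine ge_of_tendsto hlim ?_
  filter_upwards [Ioo_mem_nhdsGT (show 0 < M / ‖v‖ by positivity)] with t ht
  have ht0 : 0 < t := ht.1
  have htn : ‖t • v‖ = t * ‖v‖ := by rw [norm_smul, Real.norm_of_nonneg ht0.le]
  have h := hsmall (t • v) (by rw [htn]; exact ((lt_div_iff₀ hv0).1 ht.2).le)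
  simp only [quadForm_smul, integral_const_mul, htn] at h
  have h2 : t ^ 2 * (ρ * ‖v‖ ^ 2) ≤
      t ^ 2 * (∫ z, X.quadForm j v z ∂X.P j + σ₃ * t * ‖v‖ ^ 3) := by
    calc _ = ρ * (t * ‖v‖) ^ 2 := by ring
      _ ≤ _ := h
      _ = _ := by ring
  exact le_of_mul_le_mul_left h2 (by positivity)

/-! The Hessian truncated to the observations with a bounded Lipschitz ratio. -/

/-- Markov bounds the probability of a Lipschitz ratio above the threshold, and the second moment of
the form then limits the mean lost by truncation. The threshold is chosen so that this loss is at
most `ρ ‖v‖² / 4`. -/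
theorem le_integral_indicator_quadForm (hM : 0 < M) (hρ : 0 < ρ) (hσ₁ : 0 < σ₁) (hσ₂ : 0 < σ₂)
    (hσ₃ : 0 < σ₃) (hr₁ : 2 < r₁) (hr₂ : 2 < r₂) {j : Fin X.m} {L : X.Sp j → ℝ≥0∞}
    (hLm : Measurable L) (hLi : ∫⁻ z, L z ∂X.P j ≤ ENNReal.ofReal σ₃) (v : Vec d) :
    3 / 4 * ρ * ‖v‖ ^ 2 ≤ ∫ z, {z | L z ≤ ENNReal.ofReal
      (16 * (2 + 2 * κ ^ 2 + 2 * σ₂) * σ₃ / ρ ^ 2)}.indicator (X.quadForm j v) z ∂X.P j := by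
  set Q := 2 + 2 * κ ^ 2 + 2 * σ₂ with hQ
  have hQ0 : 0 < Q := by positivity
  set A := 16 * Q * σ₃ / ρ ^ 2 with hA
  have hA0 : 0 < A := by positivity
  rcases eq_or_ne v 0 with rfl | hv
  · have : X.quadForm j (0 : Vec d) = 0 := by funext z; simp [quadForm]
    simp [this]
  have hv0 : 0 < ‖v‖ := norm_pos_iff.2 hv
  set S := {z | L z ≤ ENNReal.ofReal A} with hS
  have hSm : MeasurableSet S := measurableSet_le hLm measurable_const
  obtain ⟨hq2, hq2B⟩ := hX.memLp_quadForm hM hρ hσ₂ hr₂ j v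
  rw [← hQ] at hq2B
  have hqi := hq2.integrable one_le_two
  have hq := hX.le_integral_quadForm hM hρ hσ₁ hσ₂ hσ₃ hr₁ hr₂ j v
  have htail : (X.P j).real Sᶜ ≤ σ₃ / A := by
    have h1 := mul_meas_ge_le_lintegral₀ (μ := X.P j) hLm.aemeasurable (ENNReal.ofReal A)
    have h2 : X.P j Sᶜ ≤ X.P j {z | ENNReal.ofReal A ≤ L z} := measure_mono fun z hz => by
      simp only [hS, Set.mem_compl_iff, Set.mem_ofPred_eq, not_le] at hz
      exact hz.le
    rw [le_div_iff₀ hA0, mul_comm]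
    refine (ENNReal.ofReal_le_ofReal_iff hσ₃.le).1 ?_
    rw [ENNReal.ofReal_mul hA0.le, ofReal_measureReal]
    exact (mul_le_mul_right h2 _).trans (h1.trans hLi)
  -- The parameter of Young's inequality `q ≤ l q² / (2 s) + s / (2 l)` on the discarded set,
  -- balanced so that each term contributes `ρ s / 8`.
  set l := ρ / (4 * Q) with hl
  have hl0 : 0 < l := by positivity
  set s := ‖v‖ ^ 2 with hs
  have hs0 : 0 < s := by positivity
  have hsplit : ∫ z, S.indicator (X.quadForm j v) z ∂X.P j =
      ∫ z, X.quadForm j v z ∂X.P j - ∫ z, Sᶜ.indicator (X.quadForm j v) z ∂X.P j := by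
    rw [integral_indicator hSm, integral_indicator hSm.compl, eq_sub_iff_add_eq,
      integral_add_compl hSm hqi]
  have hbound : ∫ z, Sᶜ.indicator (X.quadForm j v) z ∂X.P j ≤
      ∫ z, (l / (2 * s) * X.quadForm j v z ^ 2 + s / (2 * l) * Sᶜ.indicator (fun _ => 1) z) ∂X.P j := by
    refine integral_mono (hqi.indicator hSm.compl) ((hq2.integrable_sq.const_mul _).add
      (((integrable_const (1 : ℝ)).indicator hSm.compl).const_mul _)) fun z => ?_
    by_cases hz : z ∈ Sᶜ
    · simp only [Set.indicator_of_mem hz, mul_one]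
      have h0 : 0 ≤ l / (2 * s) * (X.quadForm j v z - s / l) ^ 2 := by positivity
      have h1 : l / (2 * s) * (X.quadForm j v z - s / l) ^ 2 =
          l / (2 * s) * X.quadForm j v z ^ 2 - X.quadForm j v z + s / (2 * l) := by
        field_simp; ring
      linarith
    · simp only [Set.indicator_of_notMem hz, mul_zero, add_zero]
      positivity
  rw [integral_add (hq2.integrable_sq.const_mul _)
      (((integrable_const (1 : ℝ)).indicator hSm.compl).const_mul _), integral_const_mul,
    integral_const_mul, integral_indicator_const _ hSm.compl, smul_eq_mul, mul_one] at hbound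
  have hb1 : l / (2 * s) * ∫ z, X.quadForm j v z ^ 2 ∂X.P j ≤ ρ * s / 8 := by
    calc _ ≤ l / (2 * s) * (Q * ‖v‖ ^ 4) := by gcongr
      _ = l / (2 * s) * (Q * s ^ 2) := by rw [hs]; ring
      _ = ρ * s / 8 := by rw [hl]; field_simp; ring
  have hb2 : s / (2 * l) * (X.P j).real Sᶜ ≤ ρ * s / 8 := by
    calc _ ≤ s / (2 * l) * (σ₃ / A) := by gcongr
      _ = ρ * s / 8 := by rw [hl, hA]; field_simp; ring
  rw [hsplit]
  linarith

/-! The effect of the nuisance on the score. -/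

theorem hasDerivAt_score_line {j : Fin X.m} {η : X.H j} (hη : η ∈ X.T j) (a : Fin d) (z : X.Sp j)
    {s : ℝ} (hs : s ∈ Set.Icc (0 : ℝ) 1) :
    HasDerivAt (fun t : ℝ => X.score j a (X.ηstar j + t • (η - X.ηstar j)) z)
        (gateauxDeriv (fun η' => X.gradLoss j (X.θstar j) η' z)
          (X.ηstar j + s • (η - X.ηstar j)) (η - X.ηstar j) a) s ∧
      HasDerivAt (fun t : ℝ => gateauxDeriv (fun η' => X.gradLoss j (X.θstar j) η' z)
          (X.ηstar j + t • (η - X.ηstar j)) (η - X.ηstar j) a)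
        (gateauxDeriv₂ (fun η' => X.gradLoss j (X.θstar j) η' z)
          (X.ηstar j + s • (η - X.ηstar j)) (η - X.ηstar j) (η - X.ηstar j) a) s := by
  set h := η - X.ηstar j with hh
  have hseg : X.ηstar j + s • h ∈ segment ℝ (X.ηstar j) η := by
    rw [segment_eq_image']; exact ⟨s, hs, rfl⟩
  have key : ∀ (f : X.H j → Vec d) (y : Vec d), HasGateauxDerivAt f y (X.ηstar j + s • h) h →
      HasDerivAt (fun t : ℝ => f (X.ηstar j + t • h) a) (y a) s := by
    intro f y hf
    unfold HasGateauxDerivAt at hf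
    have h1 : HasDerivAt (fun t : ℝ => t - s) 1 s := (hasDerivAt_id s).sub_const s
    have h2 : HasDerivAt (fun t : ℝ => f (X.ηstar j + s • h + t • h)) y (s - s) := by
      rw [sub_self]; exact hf
    have h3 := HasDerivAt.scomp (h := fun t : ℝ => t - s) s h2 h1
    rw [one_smul] at h3
    have h4 : HasDerivAt (fun t : ℝ => f (X.ηstar j + t • h)) y s := by
      refine h3.congr_of_eventuallyEq (Eventually.of_forall fun t => ?_)
      simp only [Function.comp_apply]
      congr 1; module
    exact (EuclideanSpace.proj (𝕜 := ℝ) a).hasFDerivAt.comp_hasDerivAt s h4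
  have htg := hX.twice_gateaux j η hη _ hseg z
  exact ⟨key _ _ htg.1, key _ _ htg.2⟩

theorem lintegral_score_sub_le {j : Fin X.m} {η : X.H j} (hM : 0 < M) (hη : η ∈ X.T j)
    (hηM : η ∈ Metric.closedBall (X.ηstar j) M) (a : Fin d) {t : ℝ} (ht : t ∈ Set.Icc (0 : ℝ) 1) :
    ∫⁻ z, ‖X.score j a (X.ηstar j + t • (η - X.ηstar j)) z - X.score j a (X.ηstar j) z‖ₑ ^ (2 : ℝ)
      ∂X.P j ≤ ENNReal.ofReal (σ₅ * ‖η - X.ηstar j‖ ^ 2) := by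
  have := lintegral_enorm_sub_zero_rpow_le (μ := X.P j)
    (φ := fun t z => X.score j a (X.ηstar j + t • (η - X.ηstar j)) z)
    (fun t ht => hX.measurable_score hM a
      (add_smul_mem_closedBall (mem_closedBall_iff_norm.1 hηM) ht))
    (fun z t ht => (hX.hasDerivAt_score_line hη a z ht).1.hasDerivWithinAt) one_le_two
    (B := ENNReal.ofReal (σ₅ * ‖η - X.ηstar j‖ ^ 2)) (fun s hs => by
      refine (lintegral_mono fun z => ?_).trans (hX.first_moment_bound j η hη
        (X.ηstar j + s • (η - X.ηstar j)) (by rw [segment_eq_image']; exact ⟨s, hs, rfl⟩))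
      rw [ENNReal.rpow_two]
      gcongr
      exact enorm_le_iff_norm_le.2 (PiLp.norm_apply_le _ a)) ht
  simpa using this

theorem memLp_score_sub (hσ₅ : 0 < σ₅) {j : Fin X.m} {η : X.H j} (hM : 0 < M) (hη : η ∈ X.T j)
    (hηM : η ∈ Metric.closedBall (X.ηstar j) M) (a : Fin d) {t : ℝ} (ht : t ∈ Set.Icc (0 : ℝ) 1) :
    MemLp (fun z => X.score j a (X.ηstar j + t • (η - X.ηstar j)) z - X.score j a (X.ηstar j) z) 2
        (X.P j) ∧
      ∫ z, (X.score j a (X.ηstar j + t • (η - X.ηstar j)) z - X.score j a (X.ηstar j) z) ^ 2 ∂X.P j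
        ≤ σ₅ * ‖η - X.ηstar j‖ ^ 2 :=
  memLp_two_of_lintegral_le ((hX.measurable_score hM a
    (add_smul_mem_closedBall (mem_closedBall_iff_norm.1 hηM) ht)).sub
      (hX.measurable_score hM a (Metric.mem_closedBall_self hM.le))) (by positivity)
    (hX.lintegral_score_sub_le hM hη hηM a ht)

/-- Neyman orthogonality removes the first order term in the nuisance error, leaving a bias bounded
by the second Gâteaux derivative. Pooled over a cluster, this bias is what produces `b_k`. -/
theorem abs_integral_score_sub_le (hM : 0 < M) (hρ : 0 < ρ) (hσ₁ : 0 < σ₁) (hσ₂ : 0 < σ₂)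
    (hσ₃ : 0 < σ₃) (hσ₅ : 0 < σ₅) (hr₁ : 2 < r₁) (hr₂ : 2 < r₂) {j : Fin X.m} {η : X.H j}
    (hη : η ∈ X.T j) (hηM : η ∈ Metric.closedBall (X.ηstar j) M) (a : Fin d) :
    |∫ z, (X.score j a η z - X.score j a (X.ηstar j) z) ∂X.P j| ≤ σ₅ * ‖η - X.ηstar j‖ ^ 2 := by
  set h := η - X.ηstar j with hh
  have hball : ∀ t ∈ Set.Icc (0 : ℝ) 1, X.ηstar j + t • h ∈ Metric.closedBall (X.ηstar j) M :=
    fun t ht => add_smul_mem_closedBall (mem_closedBall_iff_norm.1 hηM) ht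
  have h01 : (0 : ℝ) ∈ Set.Icc (0 : ℝ) 1 := by simp
  set φ : ℝ → X.Sp j → ℝ := fun t z => X.score j a (X.ηstar j + t • h) z with hφ
  set φ' : ℝ → X.Sp j → ℝ := fun t z =>
    gateauxDeriv (fun η' => X.gradLoss j (X.θstar j) η' z) (X.ηstar j + t • h) h a with hφ'
  have hφm : ∀ t ∈ Set.Icc (0 : ℝ) 1, Measurable (φ t) := fun t ht =>
    hX.measurable_score hM a (hball t ht)
  have hφd : ∀ z, ∀ t ∈ Set.Icc (0 : ℝ) 1,
      HasDerivWithinAt (fun t => φ t z) (φ' t z) (Set.Icc 0 1) t := fun z t ht =>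
    (hX.hasDerivAt_score_line hη a z ht).1.hasDerivWithinAt
  have hφ'm := measurable_of_hasDerivWithinAt_Icc hφm hφd
  have hsub : ∀ t ∈ Set.Icc (0 : ℝ) 1, ∀ b, Integrable
      (fun z => X.score j b (X.ηstar j + t • h) z - X.score j b (X.ηstar j) z) (X.P j) :=
    fun t ht b => (hX.memLp_score_sub hσ₅ hM hη hηM b ht).1.integrable one_le_two
  have hint : ∀ t ∈ Set.Icc (0 : ℝ) 1, ∀ b,
      Integrable (X.score j b (X.ηstar j + t • h)) (X.P j) := by
    intro t ht b
    have := (hsub t ht b).add (hX.integrable_score_star hM hσ₁ hr₁ j b)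
    refine this.congr (Eventually.of_forall fun z => ?_)
    simp
  have hgr : ∀ t ∈ Set.Icc (0 : ℝ) 1,
      X.gradRisk j (X.θstar j) (X.ηstar j + t • h) a = ∫ z, φ t z ∂X.P j := fun t ht =>
    hX.gradRisk_apply hM hρ hσ₂ hσ₃ hr₂ (hball t ht) (hint t ht) a
  have hφ'i : Integrable (φ' 0) (X.P j) := by
    refine (memLp_two_of_lintegral_le (hφ'm 0 h01)
      (show 0 ≤ σ₅ * ‖h‖ ^ 2 by positivity) ?_).1.integrable one_le_two
    refine (lintegral_mono fun z => ?_).trans (hX.first_moment_bound j η hη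
      (X.ηstar j + (0 : ℝ) • h) (by rw [segment_eq_image']; exact ⟨0, h01, rfl⟩))
    rw [ENNReal.rpow_two]
    gcongr
    exact enorm_le_iff_norm_le.2 (PiLp.norm_apply_le _ a)
  have hB0 : 0 ≤ σ₅ * ‖h‖ ^ 2 := by positivity
  have htaylor : ∀ t ∈ Set.Icc (0 : ℝ) 1,
      |∫ z, φ t z ∂X.P j - ∫ z, φ 0 z ∂X.P j - t * ∫ z, φ' 0 z ∂X.P j| ≤ t ^ 2 * (σ₅ * ‖h‖ ^ 2) := by
    intro t ht
    have h1 := lintegral_enorm_taylor_two_scaled_le (μ := X.P j) hφm hφd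
      (fun z t ht => (hX.hasDerivAt_score_line hη a z ht).2.hasDerivWithinAt)
      (B := ENNReal.ofReal (σ₅ * ‖h‖ ^ 2)) (fun s hs => by
        refine (lintegral_mono fun z => ?_).trans (hX.second_moment_bound j η hη
          (X.ηstar j + s • h) (by rw [segment_eq_image']; exact ⟨s, hs, rfl⟩))
        exact enorm_le_iff_norm_le.2 (PiLp.norm_apply_le _ a)) ht
    rw [← ENNReal.ofReal_mul (by positivity)] at h1
    have hm1 : Measurable fun z => φ t z - φ 0 z - t * φ' 0 z :=
      ((hφm t ht).sub (hφm 0 h01)).sub ((hφ'm 0 h01).const_mul t)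
    have h2 := (integrable_of_lintegral_le hm1 (by positivity) h1).2
    have h3 : Integrable (fun z => φ t z - φ 0 z) (X.P j) := (hint t ht a).sub (hint 0 h01 a)
    rwa [integral_sub h3 (hφ'i.const_mul t), integral_sub (hint t ht a) (hint 0 h01 a),
      integral_const_mul] at h2
  -- Dividing the Taylor bound by `t` and letting `t` decrease to zero shows that this integral is
  -- the derivative of the risk gradient in the nuisance direction, which vanishes by orthogonality.
  have hzero : ∫ z, φ' 0 z ∂X.P j = 0 := by
    have horth := hX.orthogonality j η hη
    unfold HasGateauxDerivAt at horth
    rw [← hh] at horth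
    have h1 : HasDerivAt (fun t : ℝ => X.gradRisk j (X.θstar j) (X.ηstar j + t • h) a) 0 0 :=
      (EuclideanSpace.proj (𝕜 := ℝ) a).hasFDerivAt.comp_hasDerivAt 0 horth
    have h2 := (hasDerivAt_iff_tendsto_slope_left_right.1 h1).2
    have h3 : Tendsto (fun t : ℝ => |slope (fun t : ℝ =>
        X.gradRisk j (X.θstar j) (X.ηstar j + t • h) a) 0 t| + t * (σ₅ * ‖h‖ ^ 2)) (𝓝[>] 0)
        (𝓝 (|0| + 0 * (σ₅ * ‖h‖ ^ 2))) := by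
      refine h2.abs.add (Tendsto.mul_const _ ?_)
      exact tendsto_id.mono_left nhdsWithin_le_nhds
    rw [abs_zero, zero_mul, add_zero] at h3
    have h4 : |∫ z, φ' 0 z ∂X.P j| ≤ 0 := by
      refine ge_of_tendsto h3 ?_
      filter_upwards [Ioo_mem_nhdsGT (zero_lt_one (α := ℝ))] with t ht
      have ht' : t ∈ Set.Icc (0 : ℝ) 1 := Set.Ioo_subset_Icc_self ht
      have h5 := htaylor t ht'
      rw [slope_def_field, hgr t ht', hgr 0 h01, sub_zero]
      set I := ∫ z, φ t z ∂X.P j - ∫ z, φ 0 z ∂X.P j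
      have h6 : |t * ∫ z, φ' 0 z ∂X.P j| ≤ |I| + t ^ 2 * (σ₅ * ‖h‖ ^ 2) := by
        have := abs_sub_abs_le_abs_sub (t * ∫ z, φ' 0 z ∂X.P j) I
        rw [abs_sub_comm (t * _) I] at this
        linarith
      rw [abs_mul, abs_of_pos ht.1] at h6
      rw [abs_div, abs_of_pos ht.1]
      have h7 : t * |∫ z, φ' 0 z ∂X.P j| ≤ t * (|I| / t + t * (σ₅ * ‖h‖ ^ 2)) := by
        rw [mul_add, mul_div_cancel₀ _ ht.1.ne']
        linarith
      exact le_of_mul_le_mul_left h7 ht.1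
    exact abs_eq_zero.1 (le_antisymm h4 (abs_nonneg _))
  have h1 := htaylor 1 (by simp)
  rw [hzero, mul_zero, sub_zero, one_pow, one_mul, ← integral_sub (hint 1 (by simp) a)
    (hint 0 h01 a)] at h1
  have he : X.ηstar j + (1 : ℝ) • h = η := by rw [one_smul, hh, add_sub_cancel]
  simpa [hφ, he, -one_smul] using h1

end LossRegular

end MTLExperiment

/-! ### Convex functions bounded at the vertices of a cross-polytope -/

/-- A point with `(d + 1) ‖x‖ ≤ R` is a convex combination of the centre and the vertices, with
weight `|x a| / R` on the vertex whose sign matches the coordinate. -/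
theorem ConvexOn.le_add_of_vertices {d : ℕ} {Θ : Set (Vec d)} {f : Vec d → ℝ} (hf : ConvexOn ℝ Θ f)
    {x₀ : Vec d} {R B : ℝ} (hR : 0 < R) (hB : 0 ≤ B) (hball : Metric.closedBall x₀ R ⊆ Θ)
    (hv : ∀ (a : Fin d) (c : ℝ), |c| = R →
      f (x₀ + c • EuclideanSpace.single a (1 : ℝ)) ≤ f x₀ + B)
    {x : Vec d} (hx : (d + 1) * ‖x‖ ≤ R) : f (x₀ + x) ≤ f x₀ + B := by
  set c : Fin d → ℝ := fun a => if 0 ≤ x a then R else -R with hc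
  have hcabs : ∀ a, |c a| = R := fun a => by
    simp only [hc]; split_ifs <;> simp [abs_of_pos hR]
  have hcx : ∀ a, |x a| / R * c a = x a := fun a => by
    simp only [hc]
    split_ifs with h
    · rw [abs_of_nonneg h]; field_simp
    · rw [abs_of_neg (not_le.1 h)]; field_simp
  have hsum : ∑ a, |x a| / R ≤ 1 := by
    rw [← Finset.sum_div, div_le_one hR]
    calc ∑ a, |x a| ≤ ∑ _a : Fin d, ‖x‖ := Finset.sum_le_sum fun a _ => abs_coord_le_norm x a
      _ = d * ‖x‖ := by simp
      _ ≤ R := by linarith [norm_nonneg x]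
  have hxe : x = ∑ a, x a • EuclideanSpace.single a (1 : ℝ) := by
    simpa using ((EuclideanSpace.basisFun (Fin d) ℝ).sum_repr x).symm
  set v := 1 - ∑ a, |x a| / R with hv'
  have hcomb : x₀ + x = v • x₀ + ∑ a, (|x a| / R) • (x₀ + c a • EuclideanSpace.single a (1 : ℝ)) := by
    simp only [smul_add, Finset.sum_add_distrib, smul_smul, hcx, ← hxe, ← Finset.sum_smul]
    rw [← add_assoc, ← add_smul, hv', sub_add_cancel, one_smul]
  have h := hf.map_add_sum_le (t := Finset.univ) (w := fun a => |x a| / R)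
    (p := fun a => x₀ + c a • EuclideanSpace.single a (1 : ℝ)) (v := v) (q := x₀)
    (fun a _ => by positivity) (by rw [hv']; ring) (fun a _ => by
      refine hball ?_
      rw [mem_closedBall_iff_norm, add_sub_cancel_left, norm_smul]
      simp [hcabs]) (by linarith) (hball (Metric.mem_closedBall_self hR.le))
  rw [← hcomb] at h
  refine h.trans ?_
  simp only [smul_eq_mul]
  have h2 : ∑ a, |x a| / R * f (x₀ + c a • EuclideanSpace.single a (1 : ℝ)) ≤
      ∑ a, |x a| / R * (f x₀ + B) := by
    refine Finset.sum_le_sum fun a _ => ?_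
    have := hv a (c a) (hcabs a)
    gcongr
  rw [← Finset.sum_mul] at h2
  have h3 : (∑ a, |x a| / R) * B ≤ 1 * B := by gcongr
  have h4 : v * f x₀ = f x₀ - (∑ a, |x a| / R) * f x₀ := by rw [hv']; ring
  linarith

/-- An upper bound on a ball becomes a lower bound by reflection through the centre, and a convex
function bounded on the ball of radius `3 r` is Lipschitz on that of radius `2 r`, which contains
the closed ball of radius `r`. -/
theorem ConvexOn.abs_sub_le_of_vertices {d : ℕ} {Θ : Set (Vec d)} {f : Vec d → ℝ}
    (hf : ConvexOn ℝ Θ f) {x₀ : Vec d} {R B r : ℝ} (hr : 0 < r) (hrR : (d + 1) * (3 * r) ≤ R)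
    (hB : 0 ≤ B) (hball : Metric.closedBall x₀ R ⊆ Θ)
    (hv : ∀ (a : Fin d) (c : ℝ), |c| = R →
      f (x₀ + c • EuclideanSpace.single a (1 : ℝ)) ≤ f x₀ + B)
    {x y : Vec d} (hx : x ∈ Metric.closedBall x₀ r) (hy : y ∈ Metric.closedBall x₀ r) :
    |f x - f y| ≤ 2 * B / r * ‖x - y‖ := by
  have h3R : 3 * r ≤ R := by
    have : 0 ≤ (d : ℝ) * (3 * r) := by positivity
    linarith
  have hR : 0 < R := by linarith
  have hup : ∀ z : Vec d, ‖z‖ ≤ 3 * r → f (x₀ + z) ≤ f x₀ + B := fun z hz =>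
    hf.le_add_of_vertices hR hB hball hv (le_trans (by gcongr) hrR)
  have hsub : Metric.ball x₀ (3 * r) ⊆ Θ := (Metric.ball_subset_closedBall.trans
    (Metric.closedBall_subset_closedBall h3R)).trans hball
  have hg : ConvexOn ℝ (Metric.ball x₀ (3 * r)) fun z => f z - f x₀ := by
    have := (hf.subset hsub (convex_ball _ _)).add_const (-f x₀)
    simpa [sub_eq_add_neg] using! this
  have habs : ∀ z, dist z x₀ < 3 * r → |f z - f x₀| ≤ B := by
    intro z hz
    rw [dist_eq_norm] at hz
    have h1 := hup (z - x₀) hz.le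
    rw [add_sub_cancel] at h1
    have h2 := hup (-(z - x₀)) (by rw [norm_neg]; exact hz.le)
    have hm1 : z ∈ Θ := hsub (by rw [mem_ball_iff_norm]; exact hz)
    have hm2 : x₀ + -(z - x₀) ∈ Θ := hsub (by
      rw [mem_ball_iff_norm, add_sub_cancel_left, norm_neg]; exact hz)
    have h3 := hf.2 hm1 hm2 (show (0 : ℝ) ≤ 1 / 2 by norm_num) (show (0 : ℝ) ≤ 1 / 2 by norm_num)
      (by norm_num)
    rw [show (1 / 2 : ℝ) • z + (1 / 2 : ℝ) • (x₀ + -(z - x₀)) = x₀ by module] at h3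
    simp only [smul_eq_mul] at h3
    rw [abs_le]; constructor <;> linarith
  have hl := hg.lipschitzOnWith_of_abs_le hr habs
  have hmem : ∀ z ∈ Metric.closedBall x₀ r, z ∈ Metric.ball x₀ (3 * r - r) := fun z hz =>
    Metric.closedBall_subset_ball (by linarith) hz
  have := hl.dist_le_mul x (hmem x hx) y (hmem y hy)
  rw [Real.coe_toNNReal _ (by positivity), Real.dist_eq, dist_eq_norm] at this
  simpa using this

/-! ### Curvature and Lipschitz bounds for the empirical loss of a task -/

namespace MTLExperiment

variable {d : ℕ} {X : MTLExperiment.{u, v, w} d}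

theorem indicator_quadForm_eq_sum (j : Fin X.m) (S : Set (X.Sp j)) (v : Vec d) (z : X.Sp j) :
    S.indicator (X.quadForm j v) z = ∑ a, ∑ b, v a * v b / 2 *
      (S.indicator (X.quadForm j (pairVec a b)) z - S.indicator (X.quadForm j (pairVec a a)) z / 4
        - S.indicator (X.quadForm j (pairVec b b)) z / 4) := by
  by_cases hz : z ∈ S
  · simp only [Set.indicator_of_mem hz]
    exact quadForm_eq_sum j v z
  · simp [Set.indicator_of_notMem hz]

theorem sum_loss_sub_eq (j : Fin X.m) (x : Vec d) (η : X.H j) {n : ℕ} (z : Fin n → X.Sp j) :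
    ∑ i, X.loss j (X.θstar j + x) η (z i) = ∑ i, X.loss j (X.θstar j) η (z i)
      + ⟪∑ i, X.gradLoss j (X.θstar j) η (z i), x⟫_ℝ + ∑ i, X.lossRem j x η (z i) := by
  rw [sum_inner, ← Finset.sum_add_distrib, ← Finset.sum_add_distrib]
  exact Finset.sum_congr rfl fun i _ => by unfold lossRem; ring

namespace LossRegular

variable {M ρ κ σ₁ σ₂ σ₃ σ₅ r₁ r₂ : ℝ} (hX : X.LossRegular M ρ κ σ₁ σ₂ σ₃ σ₅ r₁ r₂)
include hX

/-- Retained observations give half the truncated form minus an error `A (r + re) ≤ ρ / 4`;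
discarded ones are nonnegative by convexity. The mean coefficient `3ρ/4` loses `ρ/4` to
fluctuations, and half of what remains, less `ρ/8`, is `ρ/8`. The bound holds for each `x` in the
ball under the same finitely many deviation conditions. -/
theorem le_sum_lossRem (hM : 0 < M) (hρ : 0 < ρ) (hσ₂ : 0 < σ₂) (hr₂ : 2 < r₂) {j : Fin X.m}
    {η : X.H j} {r re : ℝ} (hre : ‖η - X.ηstar j‖ ≤ re) (hreM : re ≤ M) {x : Vec d} (hx : ‖x‖ ≤ r)
    (hrM : r ≤ M) {L : X.Sp j → ℝ≥0∞} (hLm : Measurable L) (hLle : ∀ z, X.hessLip M j z ≤ L z)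
    {A : ℝ} (hA : 0 ≤ A) (hAr : A * (r + re) ≤ ρ / 4)
    (hmean : ∀ v, 3 / 4 * ρ * ‖v‖ ^ 2 ≤
      ∫ z, {z | L z ≤ ENNReal.ofReal A}.indicator (X.quadForm j v) z ∂X.P j)
    {n : ℕ} {z : Fin n → X.Sp j}
    (hdev : ∀ a b, |∑ i, {z | L z ≤ ENNReal.ofReal A}.indicator (X.quadForm j (pairVec a b)) (z i)
      - n * ∫ z, {z | L z ≤ ENNReal.ofReal A}.indicator (X.quadForm j (pairVec a b)) z ∂X.P j| ≤
        ρ / (4 * (d ^ 2 + 1)) * n) :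
    ρ / 8 * n * ‖x‖ ^ 2 ≤ ∑ i, X.lossRem j x η (z i) := by
  set S := {z | L z ≤ ENNReal.ofReal A} with hS
  have hSm : MeasurableSet S := measurableSet_le hLm measurable_const
  have hη : η ∈ Metric.closedBall (X.ηstar j) M := mem_closedBall_iff_norm.2 (hre.trans hreM)
  have hxM : ‖x‖ ≤ M := hx.trans hrM
  have hpt : ∀ i, S.indicator (X.quadForm j x) (z i) / 2 - A * (r + re) * ‖x‖ ^ 2 / 2 ≤
      X.lossRem j x η (z i) := by
    intro i
    by_cases hi : z i ∈ S
    · rw [Set.indicator_of_mem hi]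
      have h1 := (abs_le.1 (hX.abs_lossRem_sub_le hM hη hxM hA ((hLle _).trans hi))).1
      have h2 : A * (‖x‖ + ‖η - X.ηstar j‖) * ‖x‖ ^ 2 ≤ A * (r + re) * ‖x‖ ^ 2 := by gcongr
      linarith
    · rw [Set.indicator_of_notMem hi]
      have h1 := hX.lossRem_nonneg hM hη hxM (z i)
      have : 0 ≤ r + re := by
        have := norm_nonneg x
        have := norm_nonneg (η - X.ηstar j)
        linarith
      have h2 : 0 ≤ A * (r + re) * ‖x‖ ^ 2 := by positivity
      linarith
  have hsum := Finset.sum_le_sum fun i (_ : i ∈ (Finset.univ : Finset (Fin n))) => hpt i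
  rw [Finset.sum_sub_distrib, ← Finset.sum_div, Finset.sum_const, Finset.card_univ,
    Fintype.card_fin, nsmul_eq_mul] at hsum
  have hqi : ∀ v, Integrable (S.indicator (X.quadForm j v)) (X.P j) := fun v =>
    ((hX.memLp_quadForm hM hρ hσ₂ hr₂ j v).1.integrable one_le_two).indicator hSm
  have hint : ∫ z, S.indicator (X.quadForm j x) z ∂X.P j = ∑ a, ∑ b, x a * x b / 2 *
      (∫ z, S.indicator (X.quadForm j (pairVec a b)) z ∂X.P j
        - (∫ z, S.indicator (X.quadForm j (pairVec a a)) z ∂X.P j) / 4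
        - (∫ z, S.indicator (X.quadForm j (pairVec b b)) z ∂X.P j) / 4) := by
    have hi : ∀ a b, Integrable (fun z => x a * x b / 2 *
      (S.indicator (X.quadForm j (pairVec a b)) z - S.indicator (X.quadForm j (pairVec a a)) z / 4
        - S.indicator (X.quadForm j (pairVec b b)) z / 4)) (X.P j) := fun a b =>
      (((hqi _).sub ((hqi _).div_const 4)).sub ((hqi _).div_const 4)).const_mul _
    simp only [indicator_quadForm_eq_sum j S x]
    rw [integral_finsetSum _ fun a _ => integrable_finsetSum _ fun b _ => hi a b]
    refine Finset.sum_congr rfl fun a _ => ?_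
    rw [integral_finsetSum _ fun b _ => hi a b]
    refine Finset.sum_congr rfl fun b _ => ?_
    have h1 : Integrable (fun z => S.indicator (X.quadForm j (pairVec a b)) z
      - S.indicator (X.quadForm j (pairVec a a)) z / 4) (X.P j) := (hqi _).sub ((hqi _).div_const 4)
    rw [integral_const_mul, integral_sub h1 ((hqi _).div_const 4),
      integral_sub (hqi _) ((hqi _).div_const 4), integral_div, integral_div]
  set D : Fin d → Fin d → ℝ := fun a b => ∑ i, S.indicator (X.quadForm j (pairVec a b)) (z i)
      - n * ∫ z, S.indicator (X.quadForm j (pairVec a b)) z ∂X.P j with hD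
  have hdiff : ∑ i, S.indicator (X.quadForm j x) (z i)
      - n * ∫ z, S.indicator (X.quadForm j x) z ∂X.P j =
      ∑ a, ∑ b, x a * x b / 2 * (D a b - D a a / 4 - D b b / 4) := by
    simp only [indicator_quadForm_eq_sum j S x] at hint ⊢
    rw [hint, Finset.sum_comm, Finset.mul_sum, ← Finset.sum_sub_distrib]
    refine Finset.sum_congr rfl fun a _ => ?_
    rw [Finset.sum_comm, Finset.mul_sum, ← Finset.sum_sub_distrib]
    refine Finset.sum_congr rfl fun b _ => ?_
    rw [← Finset.mul_sum, Finset.sum_sub_distrib, Finset.sum_sub_distrib, ← Finset.sum_div,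
      ← Finset.sum_div]
    simp only [hD]
    ring
  have hdev' := abs_sum_pairVec_le x D hdev
  rw [← hdiff] at hdev'
  have hc : (d : ℝ) ^ 2 * (ρ / (4 * (d ^ 2 + 1)) * n) * ‖x‖ ^ 2 ≤ ρ / 4 * n * ‖x‖ ^ 2 := by
    have : (d : ℝ) ^ 2 * (ρ / (4 * (d ^ 2 + 1))) ≤ ρ / 4 := by
      rw [mul_div_assoc', div_le_div_iff₀ (by positivity) (by norm_num)]
      nlinarith [sq_nonneg (d : ℝ)]
    rw [← mul_assoc]
    gcongr
  have h1 := (abs_le.1 hdev').1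
  have h2 : (n : ℝ) * (3 / 4 * ρ * ‖x‖ ^ 2) ≤ n * ∫ z, S.indicator (X.quadForm j x) z ∂X.P j := by
    have := hmean x
    gcongr
  have h3 : (n : ℝ) * (A * (r + re) * ‖x‖ ^ 2 / 2) ≤ n * (ρ / 4 * ‖x‖ ^ 2 / 2) := by gcongr
  linarith

/-- The remainder is moved to the true nuisance at a cost controlled by the Lipschitz ratios, and
there replaced by its mean. Of the constant `2`, one unit is the deviation and the other comes from
bounding the mean by one plus the second moment. -/
theorem sum_lossRem_le (hM : 0 < M) (hρ : 0 < ρ) (hσ₂ : 0 < σ₂) (hr₂ : 2 < r₂) {j : Fin X.m}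
    {η : X.H j} (hη : η ∈ Metric.closedBall (X.ηstar j) M) {x : Vec d} (hx : ‖x‖ ≤ M)
    {L : X.Sp j → ℝ≥0∞} (hLle : ∀ z, X.hessLip M j z ≤ L z) {n : ℕ} {z : Fin n → X.Sp j}
    (hL : ∑ i, L (z i) * ‖η - X.ηstar j‖ₑ ≤ n)
    (hdev : |∑ i, X.lossRem j x (X.ηstar j) (z i)
      - n * ∫ z, X.lossRem j x (X.ηstar j) z ∂X.P j| ≤ n) :
    ∑ i, X.lossRem j x η (z i) ≤
      n * (2 + (2 + 2 * κ ^ 2 + 2 * σ₂) * ‖x‖ ^ 4 + ‖x‖ ^ 2 / 2) := by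
  have hfin : ∀ i, L (z i) * ‖η - X.ηstar j‖ₑ ≠ ∞ := fun i =>
    ne_top_of_le_ne_top (ENNReal.natCast_ne_top n) ((Finset.single_le_sum
      (f := fun i => L (z i) * ‖η - X.ηstar j‖ₑ) (fun _ _ => zero_le) (Finset.mem_univ i)).trans hL)
  have hpt : ∀ i, X.lossRem j x η (z i) ≤ X.lossRem j x (X.ηstar j) (z i)
      + (L (z i) * ‖η - X.ηstar j‖ₑ).toReal * (‖x‖ ^ 2 / 2) := by
    intro i
    have h := (abs_le.1 (hX.abs_lossRem_sub_lossRem_le hM hη hx (z := z i)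
      (c := (L (z i) * ‖η - X.ηstar j‖ₑ).toReal) ENNReal.toReal_nonneg (by
        rw [ENNReal.ofReal_toReal (hfin i)]
        gcongr
        exact hLle _))).2
    linarith
  have hsum := Finset.sum_le_sum fun i (_ : i ∈ (Finset.univ : Finset (Fin n))) => hpt i
  rw [Finset.sum_add_distrib, ← Finset.sum_mul, ← ENNReal.toReal_sum fun i _ => hfin i] at hsum
  have h1 : (∑ i, L (z i) * ‖η - X.ηstar j‖ₑ).toReal ≤ n := by
    have := ENNReal.toReal_mono (ENNReal.natCast_ne_top n) hL
    simpa using this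
  have h2 : (∑ i, L (z i) * ‖η - X.ηstar j‖ₑ).toReal * (‖x‖ ^ 2 / 2) ≤ n * (‖x‖ ^ 2 / 2) := by gcongr
  obtain ⟨hm, hmB⟩ := hX.memLp_lossRem hM hρ hσ₂ hr₂ j hx
  have h3 : ∫ z, X.lossRem j x (X.ηstar j) z ∂X.P j ≤
      1 + (2 + 2 * κ ^ 2 + 2 * σ₂) * ‖x‖ ^ 4 := by
    calc _ ≤ ∫ z, (1 + X.lossRem j x (X.ηstar j) z ^ 2) ∂X.P j :=
          integral_mono (hm.integrable one_le_two) ((integrable_const 1).add hm.integrable_sq)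
            fun z => by nlinarith [sq_nonneg (X.lossRem j x (X.ηstar j) z - 1 / 2)]
      _ ≤ _ := by
          rw [integral_add (integrable_const 1) hm.integrable_sq]
          simpa using hmB
  have h4 := (abs_le.1 hdev).2
  have h5 : (n : ℝ) * ∫ z, X.lossRem j x (X.ηstar j) z ∂X.P j ≤
      n * (1 + (2 + 2 * κ ^ 2 + 2 * σ₂) * ‖x‖ ^ 4) := by gcongr
  linarith

theorem convexOn_sum_loss {j : Fin X.m} {η : X.H j}
    (hη : η ∈ Metric.closedBall (X.ηstar j) M) {n : ℕ} (z : Fin n → X.Sp j) (hΘ : Convex ℝ X.Θ) :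
    ConvexOn ℝ X.Θ fun θ => ∑ i, X.loss j θ η (z i) := by
  refine ⟨hΘ, fun x hx y hy a b ha hb hab => ?_⟩
  simp only [smul_eq_mul, Finset.mul_sum, ← Finset.sum_add_distrib]
  exact Finset.sum_le_sum fun i _ => (hX.convex j η hη (z i)).2 hx hy ha hb hab

/-- Only the `2 d` vertices at distance `M` from the target are inspected; convexity of the sample
loss extends the control to the whole small ball. -/
theorem abs_sum_loss_sub_le (hM : 0 < M) (hρ : 0 < ρ) (hσ₂ : 0 < σ₂) (hr₂ : 2 < r₂) {j : Fin X.m}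
    {η : X.H j} (hη : η ∈ Metric.closedBall (X.ηstar j) M) {r : ℝ} (hr : 0 < r)
    (hrM : (d + 1) * (3 * r) ≤ M) (hΘ : Convex ℝ X.Θ)
    {L : X.Sp j → ℝ≥0∞} (hLle : ∀ z, X.hessLip M j z ≤ L z) {n : ℕ} {z : Fin n → X.Sp j}
    (hL : ∑ i, L (z i) * ‖η - X.ηstar j‖ₑ ≤ n)
    (hdev : ∀ (a : Fin d) (c : ℝ), |c| = M →
      |∑ i, X.lossRem j (c • EuclideanSpace.single a (1 : ℝ)) (X.ηstar j) (z i)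
      - n * ∫ z, X.lossRem j (c • EuclideanSpace.single a (1 : ℝ)) (X.ηstar j) z ∂X.P j| ≤ n)
    (hscore : ∀ a, |∑ i, X.score j a η (z i)| ≤ 3 * n)
    {x y : Vec d} (hx : x ∈ Metric.closedBall (X.θstar j) r)
    (hy : y ∈ Metric.closedBall (X.θstar j) r) :
    |∑ i, X.loss j x η (z i) - ∑ i, X.loss j y η (z i)| ≤
      2 * (n * (3 * M + (2 + (2 + 2 * κ ^ 2 + 2 * σ₂) * M ^ 4 + M ^ 2 / 2))) / r * ‖x - y‖ := by
  refine (hX.convexOn_sum_loss hη z hΘ).abs_sub_le_of_vertices hr hrM (by positivity)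
    (hX.ball_subset j) (fun a c hc => ?_) hx hy
  set e := c • EuclideanSpace.single a (1 : ℝ) with he
  have hen : ‖e‖ = M := by rw [he, norm_smul]; simp [hc]
  have h1 := hX.sum_lossRem_le hM hρ hσ₂ hr₂ hη hen.le hLle hL (hdev a c hc)
  rw [hen] at h1
  have h2 : ⟪∑ i, X.gradLoss j (X.θstar j) η (z i), e⟫_ℝ = c * ∑ i, X.score j a η (z i) := by
    rw [sum_inner, Finset.mul_sum]
    refine Finset.sum_congr rfl fun i _ => ?_
    rw [he, inner_smul_right, EuclideanSpace.inner_single_right]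
    simp [score]
  have h3 : c * ∑ i, X.score j a η (z i) ≤ M * (3 * n) := by
    refine (le_abs_self _).trans ?_
    rw [abs_mul, hc]
    exact mul_le_mul_of_nonneg_left (hscore a) hM.le
  rw [sum_loss_sub_eq, h2]
  linarith

end LossRegular

end MTLExperiment

/-! ### Deviations of sums over the evaluation samples -/

namespace MTLExperiment

variable {d : ℕ} {X : MTLExperiment.{u, v, w} d}

theorem iIndepFun_comp_Z {φ : ∀ j, X.Sp j → ℝ} (hφ : ∀ j, Measurable (φ j)) :
    iIndepFun (fun (x : Σ j, Fin (X.n j)) ω => φ x.1 (X.Z x.1 x.2 ω)) X.Pr :=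
  X.indep_Z.comp (fun x => φ x.1) fun x => hφ x.1

theorem memLp_comp_Z {j : Fin X.m} {f : X.Sp j → ℝ} {p : ℝ≥0∞} (hf : MemLp f p (X.P j))
    (i : Fin (X.n j)) : MemLp (fun ω => f (X.Z j i ω)) p X.Pr := by
  rw [← X.law_Z j i] at hf
  exact hf.comp_of_map (X.measurable_Z j i).aemeasurable

theorem integral_comp_Z {j : Fin X.m} {f : X.Sp j → ℝ} (hf : Measurable f) (i : Fin (X.n j)) :
    ∫ ω, f (X.Z j i ω) ∂X.Pr = ∫ z, f z ∂X.P j := by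
  rw [← X.law_Z j i, integral_map (X.measurable_Z j i).aemeasurable hf.aestronglyMeasurable]

theorem lintegral_comp_Z {j : Fin X.m} {f : X.Sp j → ℝ≥0∞} (hf : Measurable f) (i : Fin (X.n j)) :
    ∫⁻ ω, f (X.Z j i ω) ∂X.Pr = ∫⁻ z, f z ∂X.P j := by
  rw [← X.law_Z j i, lintegral_map hf (X.measurable_Z j i)]

theorem measure_sampleSum_sub_ge_le {φ : ∀ j, X.Sp j → ℝ} (hφ : ∀ j, Measurable (φ j))
    (h2 : ∀ j, MemLp (φ j) 2 (X.P j)) {B : Fin X.m → ℝ} (hB : ∀ j, ∫ z, φ j z ^ 2 ∂X.P j ≤ B j)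
    (S : Finset (Fin X.m)) {c : ℝ} (hc : 0 < c) :
    X.Pr {ω | c ≤ |∑ j ∈ S, ∑ i, φ j (X.Z j i ω) - ∑ j ∈ S, X.n j * ∫ z, φ j z ∂X.P j|} ≤
      ENNReal.ofReal ((∑ j ∈ S, X.n j * B j) / c ^ 2) := by
  have h := measure_abs_sum_sub_ge_le (μ := X.Pr) (S.sigma fun _ => Finset.univ)
    (fun x : (Σ j, Fin (X.n j)) => memLp_comp_Z (h2 x.1) x.2) (iIndepFun_comp_Z hφ) hc
  simp only [Finset.sum_sigma] at h
  have h1 : ∀ j, ∑ i, ∫ ω, φ j (X.Z j i ω) ∂X.Pr = X.n j * ∫ z, φ j z ∂X.P j := fun j => by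
    simp [integral_comp_Z (hφ j)]
  have h3 : ∀ j, ∑ i, ∫ ω, φ j (X.Z j i ω) ^ 2 ∂X.Pr = X.n j * ∫ z, φ j z ^ 2 ∂X.P j := fun j => by
    simp [integral_comp_Z ((hφ j).pow_const 2)]
  simp only [h1, h3] at h
  refine h.trans (ENNReal.ofReal_le_ofReal ?_)
  gcongr with j
  exact hB j

theorem measure_sampleSum_ge_le_rpow {φ : ∀ j, X.Sp j → ℝ} (hφ : ∀ j, Measurable (φ j))
    {r V : ℝ} (hr : 2 < r) (hV : 0 ≤ V) (hL : ∀ j, MemLp (φ j) (ENNReal.ofReal r) (X.P j))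
    (h0 : ∀ j, ∫ z, φ j z ∂X.P j = 0) (hB : ∀ j, ∫ z, |φ j z| ^ r ∂X.P j ≤ V)
    (S : Finset (Fin X.m)) {c : ℝ} (hc : 0 < c) :
    X.Pr {ω | c ≤ |∑ j ∈ S, ∑ i, φ j (X.Z j i ω)|} ≤
      ENNReal.ofReal (mzConst r V * ((∑ j ∈ S, X.n j : ℕ) : ℝ) ^ (r / 2) / c ^ r) := by
  have h := measure_abs_sum_ge_le_rpow (μ := X.Pr) hr hV (iIndepFun_comp_Z hφ)
    (fun x => (hφ x.1).comp (X.measurable_Z x.1 x.2))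
    (fun x : (Σ j, Fin (X.n j)) => memLp_comp_Z (hL x.1) x.2)
    (fun x => by rw [integral_comp_Z (hφ x.1), h0])
    (fun x => by
      rw [integral_comp_Z (f := fun z => |φ x.1 z| ^ r) ((hφ x.1).abs.pow_const r)]
      exact hB x.1)
    (S.sigma fun _ => Finset.univ) hc
  simpa [Finset.sum_sigma, Finset.card_sigma] using h

theorem measurable_enorm_sub_const {E : Type*} [NormedAddCommGroup E] [MeasurableSpace E]
    [BorelSpace E] (c : E) : Measurable fun x : E => ‖x - c‖ₑ :=
  (continuous_id.sub continuous_const).enorm.measurable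

namespace LossRegular

variable {M ρ κ σ₁ σ₂ σ₃ σ₅ r₁ r₂ : ℝ} (hX : X.LossRegular M ρ κ σ₁ σ₂ σ₃ σ₅ r₁ r₂)
include hX

/-- `D` bounds both the mean and the variance of the sum. If `D ≤ c` the mean uses up one `c` and
Chebyshev handles the other; if `D > c` the claimed bound exceeds one. -/
theorem measure_score_sub_fixed_le (hM : 0 < M) (hρ : 0 < ρ) (hσ₁ : 0 < σ₁) (hσ₂ : 0 < σ₂)
    (hσ₃ : 0 < σ₃) (hσ₅ : 0 < σ₅) (hr₁ : 2 < r₁) (hr₂ : 2 < r₂) {η : ∀ j, X.H j}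
    (hη : ∀ j, η j ∈ X.T j ∧ η j ∈ Metric.closedBall (X.ηstar j) M) (a : Fin d)
    (S : Finset (Fin X.m)) {c : ℝ} (hc : 0 < c) :
    X.Pr {ω | 2 * c < |∑ j ∈ S, ∑ i, (X.score j a (η j) (X.Z j i ω)
        - X.score j a (X.ηstar j) (X.Z j i ω))|} ≤
      ENNReal.ofReal ((1 / c + 1 / c ^ 2) * ∑ j ∈ S, X.n j * (σ₅ * ‖η j - X.ηstar j‖ ^ 2)) := by
  set D := ∑ j ∈ S, X.n j * (σ₅ * ‖η j - X.ηstar j‖ ^ 2) with hD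
  have hD0 : 0 ≤ D := Finset.sum_nonneg fun j _ => by positivity
  have hone : (1 : ℝ) ∈ Set.Icc (0 : ℝ) 1 := by simp
  have hmem : ∀ j, MemLp (fun z => X.score j a (η j) z - X.score j a (X.ηstar j) z) 2 (X.P j) ∧
      ∫ z, (X.score j a (η j) z - X.score j a (X.ηstar j) z) ^ 2 ∂X.P j ≤
        σ₅ * ‖η j - X.ηstar j‖ ^ 2 := fun j => by
    have := hX.memLp_score_sub hσ₅ hM (hη j).1 (hη j).2 a hone
    rwa [one_smul, add_sub_cancel] at this
  rcases le_or_gt D c with hDc | hDc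
  · have h := measure_sampleSum_sub_ge_le
      (φ := fun j z => X.score j a (η j) z - X.score j a (X.ηstar j) z)
      (fun j => (hX.measurable_score hM a (hη j).2).sub
        (hX.measurable_score hM a (Metric.mem_closedBall_self hM.le)))
      (fun j => (hmem j).1) (fun j => (hmem j).2) S hc
    have hmean : |∑ j ∈ S, (X.n j : ℝ) * ∫ z, (X.score j a (η j) z - X.score j a (X.ηstar j) z)
        ∂X.P j| ≤ D := by
      refine (Finset.abs_sum_le_sum_abs _ _).trans (Finset.sum_le_sum fun j _ => ?_)
      rw [abs_mul, Nat.abs_cast]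
      gcongr
      exact hX.abs_integral_score_sub_le hM hρ hσ₁ hσ₂ hσ₃ hσ₅ hr₁ hr₂ (hη j).1 (hη j).2 a
    refine (measure_mono fun ω hω => ?_).trans (h.trans (ENNReal.ofReal_le_ofReal ?_))
    · simp only [Set.mem_ofPred_eq] at hω ⊢
      have := abs_sub_abs_le_abs_sub (∑ j ∈ S, ∑ i, (X.score j a (η j) (X.Z j i ω)
        - X.score j a (X.ηstar j) (X.Z j i ω))) (∑ j ∈ S, (X.n j : ℝ) *
          ∫ z, (X.score j a (η j) z - X.score j a (X.ηstar j) z) ∂X.P j)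
      linarith
    · rw [← hD, add_mul, one_div_mul_eq_div, one_div_mul_eq_div]
      have : 0 ≤ D / c := by positivity
      linarith
  · refine prob_le_one.trans ?_
    rw [← ENNReal.ofReal_one]
    refine ENNReal.ofReal_le_ofReal ?_
    rw [add_mul, one_div_mul_eq_div]
    have h1 : 1 ≤ D / c := (one_le_div hc).2 hDc.le
    have h2 : 0 ≤ 1 / c ^ 2 * D := by positivity
    linarith

/-- Sample splitting makes the joint law of nuisance estimators and samples a product, so the
fixed-nuisance bound applies on each slice and is then integrated. It is linear in the squared
errors, so the mean square rate is all that is needed. -/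
theorem measure_score_sub_le (hM : 0 < M) (hρ : 0 < ρ) (hσ₁ : 0 < σ₁) (hσ₂ : 0 < σ₂)
    (hσ₃ : 0 < σ₃) (hσ₅ : 0 < σ₅) (hr₁ : 2 < r₁) (hr₂ : 2 < r₂) {σ₄ : ℝ} (hσ₄ : 0 < σ₄)
    {s : ℕ → ℝ} (hN : X.NuisanceRate σ₄ s) (a : Fin d) (S : Finset (Fin X.m)) {c : ℝ} (hc : 0 < c) :
    X.Pr {ω | (∀ j, X.ηhat j ω ∈ X.T j ∧ X.ηhat j ω ∈ Metric.closedBall (X.ηstar j) M) ∧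
        2 * c < |∑ j ∈ S, ∑ i, (X.score j a (X.ηhat j ω) (X.Z j i ω)
          - X.score j a (X.ηstar j) (X.Z j i ω))|} ≤
      ENNReal.ofReal ((1 / c + 1 / c ^ 2) * (σ₅ * σ₄) * ∑ j ∈ S, X.n j / s (X.n j) ^ 2) := by
  set ηv : X.Ω → ∀ j, X.H j := fun ω j => X.ηhat j ω with hηv
  set Zv : X.Ω → ∀ x : (Σ j, Fin (X.n j)), X.Sp x.1 := fun ω x => X.Z x.1 x.2 ω with hZv
  have hηm : Measurable ηv := measurable_pi_lambda _ fun j => X.measurable_ηhat j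
  have hZm : Measurable Zv := measurable_pi_lambda _ fun x => X.measurable_Z x.1 x.2
  set good : Set (∀ j, X.H j) :=
    {η | ∀ j, η j ∈ X.T j ∧ η j ∈ Metric.closedBall (X.ηstar j) M} with hgood
  have hgm : MeasurableSet good := by
    have : good = ⋂ j, (fun η : ∀ j, X.H j => η j) ⁻¹' (X.T j ∩ Metric.closedBall (X.ηstar j) M) := by
      ext η; simp [hgood]
    rw [this]
    exact MeasurableSet.iInter fun j => measurable_pi_apply j
      ((X.measurableSet_T j).inter Metric.isClosed_closedBall.measurableSet)
  set g : ∀ j, X.H j × X.Sp j → ℝ := fun j =>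
    (Metric.closedBall (X.ηstar j) M ×ˢ (Set.univ : Set (X.Sp j))).indicator
      fun x => X.score j a x.1 x.2 with hg
  have hgmeas : ∀ j, Measurable (g j) := fun j => hX.measurable_score_indicator hM j a
  have hgeq : ∀ j (η : X.H j) (z : X.Sp j), η ∈ Metric.closedBall (X.ηstar j) M →
      g j (η, z) = X.score j a η z := fun j η z hη =>
    Set.indicator_of_mem (s := Metric.closedBall (X.ηstar j) M ×ˢ (Set.univ : Set (X.Sp j)))
      (f := fun x : X.H j × X.Sp j => X.score j a x.1 x.2) (a := (η, z)) ⟨hη, trivial⟩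
  set F : (∀ j, X.H j) × (∀ x : (Σ j, Fin (X.n j)), X.Sp x.1) → ℝ := fun x =>
    ∑ j ∈ S, ∑ i, (g j (x.1 j, x.2 ⟨j, i⟩) - X.score j a (X.ηstar j) (x.2 ⟨j, i⟩)) with hF
  have hFm : Measurable F := by
    refine Finset.measurable_sum _ fun j _ => Finset.measurable_sum _ fun i _ => Measurable.sub ?_ ?_
    · exact (hgmeas j).comp (((measurable_pi_apply j).comp measurable_fst).prodMk
        ((measurable_pi_apply (⟨j, i⟩ : Σ j, Fin (X.n j))).comp measurable_snd))
    · exact (hX.measurable_score hM a (Metric.mem_closedBall_self hM.le)).comp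
        ((measurable_pi_apply (⟨j, i⟩ : Σ j, Fin (X.n j))).comp measurable_snd)
  set W := {x | x.1 ∈ good ∧ 2 * c < |F x|} with hW
  have hWm : MeasurableSet W :=
    (measurable_fst hgm).inter (measurableSet_lt measurable_const hFm.abs)
  have hset : {ω | (∀ j, X.ηhat j ω ∈ X.T j ∧ X.ηhat j ω ∈ Metric.closedBall (X.ηstar j) M) ∧
        2 * c < |∑ j ∈ S, ∑ i, (X.score j a (X.ηhat j ω) (X.Z j i ω)
          - X.score j a (X.ηstar j) (X.Z j i ω))|} = (fun ω => (ηv ω, Zv ω)) ⁻¹' W := by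
    ext ω
    simp only [Set.mem_ofPred_eq, Set.mem_preimage, hW, hgood, hηv, hZv, hF]
    refine and_congr_right fun h => ?_
    simp only [hgeq _ _ _ (h _).2]
  have hprod := (indepFun_iff_map_prod_eq_prod_map_map hηm.aemeasurable hZm.aemeasurable).1
    X.indep_ηhat
  have hpZ : IsProbabilityMeasure (X.Pr.map Zv) := Measure.isProbabilityMeasure_map hZm.aemeasurable
  rw [hset, ← Measure.map_apply (hηm.prodMk hZm) hWm, hprod, Measure.prod_apply hWm]
  have hslice : ∀ η : ∀ j, X.H j, X.Pr.map Zv (Prod.mk η ⁻¹' W) ≤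
      ENNReal.ofReal (1 / c + 1 / c ^ 2) *
        ∑ j ∈ S, ENNReal.ofReal (X.n j * σ₅) * ‖η j - X.ηstar j‖ₑ ^ 2 := by
    intro η
    rw [Measure.map_apply hZm (measurable_prodMk_left hWm)]
    by_cases hη : η ∈ good
    · have h := hX.measure_score_sub_fixed_le hM hρ hσ₁ hσ₂ hσ₃ hσ₅ hr₁ hr₂ hη a S hc
      refine (measure_mono fun ω hω => ?_).trans (h.trans (le_of_eq ?_))
      · simp only [Set.mem_preimage, hW, Set.mem_ofPred_eq, hF, hZv, hgeq _ _ _ (hη _).2] at hω ⊢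
        exact hω.2
      · rw [ENNReal.ofReal_mul (by positivity),
          ENNReal.ofReal_sum_of_nonneg fun j _ => by positivity]
        congr 1
        refine Finset.sum_congr rfl fun j _ => ?_
        rw [← mul_assoc, ENNReal.ofReal_mul (by positivity), ENNReal.ofReal_pow (norm_nonneg _),
          ofReal_norm]
    · have : Zv ⁻¹' (Prod.mk η ⁻¹' W) = ∅ := by
        ext ω
        simp [hW, hη]
      rw [this, measure_empty]
      exact zero_le
  have hmη : ∀ j, Measurable fun η : ∀ j, X.H j =>
      ENNReal.ofReal (X.n j * σ₅) * ‖η j - X.ηstar j‖ₑ ^ 2 := fun j =>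
    (((measurable_enorm_sub_const (X.ηstar j)).comp (measurable_pi_apply j)).pow_const 2).const_mul _
  have hmη' : ∀ j, Measurable fun ω =>
      ENNReal.ofReal (X.n j * σ₅) * ‖ηv ω j - X.ηstar j‖ₑ ^ 2 := fun j => (hmη j).comp hηm
  refine (lintegral_mono hslice).trans ?_
  rw [lintegral_map ((Finset.measurable_sum _ fun j _ => hmη j).const_mul _) hηm,
    lintegral_const_mul' _ _ ENNReal.ofReal_ne_top,
    lintegral_finsetSum _ fun j _ => hmη' j]
  have hle : ∀ j ∈ S, ∫⁻ ω, ENNReal.ofReal (X.n j * σ₅) * ‖ηv ω j - X.ηstar j‖ₑ ^ 2 ∂X.Pr ≤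
      ENNReal.ofReal (σ₅ * σ₄ * (X.n j / s (X.n j) ^ 2)) := by
    intro j _
    rw [lintegral_const_mul' _ _ ENNReal.ofReal_ne_top]
    calc _ ≤ ENNReal.ofReal (X.n j * σ₅) * ENNReal.ofReal (σ₄ / s (X.n j) ^ 2) := by
          gcongr
          exact hN j
      _ = _ := by
          rw [← ENNReal.ofReal_mul (by positivity)]
          congr 1; ring
  calc _ ≤ ENNReal.ofReal (1 / c + 1 / c ^ 2) *
        ∑ j ∈ S, ENNReal.ofReal (σ₅ * σ₄ * (X.n j / s (X.n j) ^ 2)) := by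
        gcongr with j hj
        exact hle j hj
    _ = _ := by
        rw [← ENNReal.ofReal_sum_of_nonneg fun j _ => by positivity, ← ENNReal.ofReal_mul
          (by positivity), ← Finset.mul_sum]
        congr 1; ring

end LossRegular

theorem NuisanceRate.measure_norm_sub_gt_le {σ₄ : ℝ} {s : ℕ → ℝ} (hN : X.NuisanceRate σ₄ s)
    (j : Fin X.m) {r : ℝ} (hr : 0 < r) :
    X.Pr {ω | r < ‖X.ηhat j ω - X.ηstar j‖} ≤ ENNReal.ofReal (σ₄ / s (X.n j) ^ 2 / r ^ 2) := by
  have hm : Measurable fun ω => ‖X.ηhat j ω - X.ηstar j‖ₑ ^ 2 :=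
    ((measurable_enorm_sub_const (X.ηstar j)).comp (X.measurable_ηhat j)).pow_const 2
  have h := mul_meas_ge_le_lintegral₀ (μ := X.Pr) hm.aemeasurable (ENNReal.ofReal (r ^ 2))
  have hsub : {ω | r < ‖X.ηhat j ω - X.ηstar j‖} ⊆
      {ω | ENNReal.ofReal (r ^ 2) ≤ ‖X.ηhat j ω - X.ηstar j‖ₑ ^ 2} := by
    intro ω hω
    simp only [Set.mem_ofPred_eq] at hω ⊢
    rw [← ofReal_norm, ← ENNReal.ofReal_pow (norm_nonneg _)]
    exact ENNReal.ofReal_le_ofReal (pow_le_pow_left₀ hr.le hω.le 2)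
  rw [ENNReal.ofReal_div_of_pos (by positivity), ENNReal.le_div_iff_mul_le
    (Or.inl (by simpa using hr.ne')) (Or.inl ENNReal.ofReal_ne_top), mul_comm]
  exact (mul_le_mul_right (measure_mono hsub) _).trans (h.trans (hN j))

/-- The elementary bound `x ≤ 1/σ + σ x²` with `σ = s(n_j)` balances the two terms. -/
theorem NuisanceRate.lintegral_enorm_sub_le {σ₄ : ℝ} (hσ₄ : 0 < σ₄) {s : ℕ → ℝ}
    (hs : ∀ n, 0 < s n) (hN : X.NuisanceRate σ₄ s) (j : Fin X.m) :
    ∫⁻ ω, ‖X.ηhat j ω - X.ηstar j‖ₑ ∂X.Pr ≤ ENNReal.ofReal ((1 + σ₄) / s (X.n j)) := by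
  have hs0 := hs (X.n j)
  set σ := s (X.n j) with hσ
  have hpt : ∀ ω, ‖X.ηhat j ω - X.ηstar j‖ₑ ≤
      ENNReal.ofReal (1 / σ) + ENNReal.ofReal σ * ‖X.ηhat j ω - X.ηstar j‖ₑ ^ 2 := by
    intro ω
    rw [← ofReal_norm, ← ENNReal.ofReal_pow (norm_nonneg _), ← ENNReal.ofReal_mul hs0.le,
      ← ENNReal.ofReal_add (by positivity) (by positivity)]
    refine ENNReal.ofReal_le_ofReal ?_
    set x := ‖X.ηhat j ω - X.ηstar j‖
    have h0 : 0 ≤ σ * (x - 1 / (2 * σ)) ^ 2 := by positivity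
    have h1 : σ * (x - 1 / (2 * σ)) ^ 2 = σ * x ^ 2 - x + 1 / σ / 4 := by field_simp; ring
    have h2 : 0 ≤ 1 / σ := by positivity
    linarith
  refine (lintegral_mono hpt).trans ?_
  rw [lintegral_add_left measurable_const, lintegral_const_mul' _ _ ENNReal.ofReal_ne_top]
  simp only [lintegral_const, measure_univ, mul_one]
  calc _ ≤ ENNReal.ofReal (1 / σ) + ENNReal.ofReal σ * ENNReal.ofReal (σ₄ / σ ^ 2) := by
        gcongr
        exact hN j
    _ = _ := by
        rw [← ENNReal.ofReal_mul hs0.le, ← ENNReal.ofReal_add (by positivity) (by positivity)]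
        congr 1; field_simp

/-- Lipschitz ratio and nuisance error are independent, so the mean of each product factorizes and
Markov applies. A first moment of the ratio is enough. -/
theorem measure_sum_mul_enorm_sub_gt_le {σ₄ : ℝ} (hσ₄ : 0 < σ₄) {s : ℕ → ℝ}
    (hs : ∀ n, 0 < s n) (hN : X.NuisanceRate σ₄ s) (j : Fin X.m) {L : X.Sp j → ℝ≥0∞}
    (hLm : Measurable L) {σ₃ : ℝ} (hσ₃ : 0 < σ₃) (hL : ∫⁻ z, L z ∂X.P j ≤ ENNReal.ofReal σ₃) :
    X.Pr {ω | (X.n j : ℝ≥0∞) < ∑ i, L (X.Z j i ω) * ‖X.ηhat j ω - X.ηstar j‖ₑ} ≤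
      ENNReal.ofReal (σ₃ * ((1 + σ₄) / s (X.n j))) := by
  have hs0 := hs (X.n j)
  have hmη : Measurable fun ω => ‖X.ηhat j ω - X.ηstar j‖ₑ :=
    (measurable_enorm_sub_const (X.ηstar j)).comp (X.measurable_ηhat j)
  have hmL : ∀ i, Measurable fun ω => L (X.Z j i ω) := fun i => hLm.comp (X.measurable_Z j i)
  have hterm : ∀ i, ∫⁻ ω, L (X.Z j i ω) * ‖X.ηhat j ω - X.ηstar j‖ₑ ∂X.Pr ≤
      ENNReal.ofReal (σ₃ * ((1 + σ₄) / s (X.n j))) := by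
    intro i
    have hind : IndepFun (fun ω => L (X.Z j i ω)) (fun ω => ‖X.ηhat j ω - X.ηstar j‖ₑ) X.Pr :=
      (X.indep_ηhat.comp (φ := fun η : ∀ j, X.H j => ‖η j - X.ηstar j‖ₑ)
        (ψ := fun z : (∀ x : (Σ j, Fin (X.n j)), X.Sp x.1) => L (z ⟨j, i⟩))
        ((measurable_enorm_sub_const (X.ηstar j)).comp (measurable_pi_apply j))
        (hLm.comp (measurable_pi_apply (⟨j, i⟩ : Σ j, Fin (X.n j))))).symm
    have h := lintegral_mul_eq_lintegral_mul_lintegral_of_indepFun (hmL i) hmη hind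
    simp only [Pi.mul_apply] at h
    rw [h, lintegral_comp_Z hLm i, ENNReal.ofReal_mul hσ₃.le]
    exact mul_le_mul' hL (hN.lintegral_enorm_sub_le hσ₄ hs j)
  have hmp : ∀ i, Measurable fun ω => L (X.Z j i ω) * ‖X.ηhat j ω - X.ηstar j‖ₑ := fun i =>
    (hmL i).mul hmη
  have hmsum : Measurable fun ω => ∑ i, L (X.Z j i ω) * ‖X.ηhat j ω - X.ηstar j‖ₑ :=
    Finset.measurable_sum _ fun i _ => hmp i
  have h := mul_meas_ge_le_lintegral₀ (μ := X.Pr) hmsum.aemeasurable (X.n j : ℝ≥0∞)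
  rw [lintegral_finsetSum _ fun i _ => hmp i] at h
  have h2 : ∑ i, ∫⁻ ω, L (X.Z j i ω) * ‖X.ηhat j ω - X.ηstar j‖ₑ ∂X.Pr ≤
      X.n j * ENNReal.ofReal (σ₃ * ((1 + σ₄) / s (X.n j))) := by
    refine (Finset.sum_le_sum fun i _ => hterm i).trans (le_of_eq ?_)
    simp
  have h3 := h.trans h2
  have hn0 : (X.n j : ℝ≥0∞) ≠ 0 := by
    simpa using (X.n_pos j).ne'
  have h4 := (ENNReal.mul_le_mul_iff_right hn0 (ENNReal.natCast_ne_top _)).1 h3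
  exact (measure_mono fun ω hω => le_of_lt (Set.mem_ofPred_eq ▸ hω)).trans h4

end MTLExperiment

/-! ### The event on which the samples and the nuisance estimators are regular -/

namespace MTLExperiment

variable {d : ℕ} (X : MTLExperiment.{u, v, w} d)

theorem one_le_n (j : Fin X.m) : (1 : ℝ) ≤ X.n j := by exact_mod_cast X.n_pos j

theorem one_le_K : (1 : ℝ) ≤ X.K := by
  have := (X.cluster ⟨0, X.m_pos⟩).pos
  exact_mod_cast this

theorem n_le_N (j : Fin X.m) : X.n j ≤ X.N (X.cluster j) :=
  Finset.single_le_sum (f := X.n) (fun _ _ => Nat.zero_le _)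
    (Finset.mem_filter.2 ⟨Finset.mem_univ j, rfl⟩)

theorem one_le_N (k : Fin X.K) : (1 : ℝ) ≤ X.N k := by
  obtain ⟨j, rfl⟩ := X.cluster_surjective k
  exact_mod_cast (X.n_pos j).trans_le (X.n_le_N j)

theorem b_nonneg {s : ℕ → ℝ} (k : Fin X.K) : 0 ≤ X.b s k :=
  mul_nonneg (by positivity) (Real.iSup_nonneg fun j => by positivity)

/-- Cauchy–Schwarz gives `∑ √n_j ≤ √(m_k N_k)`, which is where the factor `m_k^{1/2}` of `b_k` comes
from. -/
theorem K_mul_sum_le {s : ℕ → ℝ} (k : Fin X.K) :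
    X.K * ∑ j with X.cluster j = k, X.n j / s (X.n j) ^ 2 ≤ X.b s k * √(X.N k : ℝ) := by
  set μ := ⨆ j : {j // X.cluster j = k}, √(X.n j : ℝ) * (s (X.n j) ^ 2)⁻¹ with hμ
  have hμ0 : 0 ≤ μ := Real.iSup_nonneg fun j => by positivity
  have h1 : ∀ j ∈ Finset.univ.filter (fun j => X.cluster j = k),
      (X.n j : ℝ) / s (X.n j) ^ 2 ≤ √(X.n j : ℝ) * μ := by
    intro j hj
    have h2 : √(X.n j : ℝ) * (s (X.n j) ^ 2)⁻¹ ≤ μ :=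
      le_ciSup (f := fun j : {j // X.cluster j = k} => √(X.n j : ℝ) * (s (X.n j) ^ 2)⁻¹)
        (Set.finite_range _).bddAbove ⟨j, (Finset.mem_filter.1 hj).2⟩
    calc _ = √(X.n j : ℝ) * (√(X.n j : ℝ) * (s (X.n j) ^ 2)⁻¹) := by
          rw [← mul_assoc, Real.mul_self_sqrt (by positivity)]; rfl
      _ ≤ _ := by gcongr
  have h3 : ∑ j with X.cluster j = k, √(X.n j : ℝ) ≤ √(X.size k : ℝ) * √(X.N k : ℝ) := by
    have := Real.sum_mul_le_sqrt_mul_sqrt (Finset.univ.filter fun j => X.cluster j = k)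
      (fun _ => 1) (fun j => √(X.n j : ℝ))
    simpa [size, N] using this
  have hK : (0 : ℝ) ≤ X.K := by positivity
  calc _ ≤ X.K * ∑ j with X.cluster j = k, √(X.n j : ℝ) * μ := by
        gcongr with j hj
        exact h1 j hj
    _ = X.K * ((∑ j with X.cluster j = k, √(X.n j : ℝ)) * μ) := by rw [Finset.sum_mul]
    _ ≤ X.K * ((√(X.size k : ℝ) * √(X.N k : ℝ)) * μ) := by gcongr
    _ = _ := by rw [b]; ring

/-- The deviation bounds for the samples and the nuisance estimators on which the analysis of the
fused estimator is based. -/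
structure SampleRegular (M ρ A re : ℝ) (L : ∀ j, X.Sp j → ℝ≥0∞) (U : Fin X.K → ℝ) (ω : X.Ω) :
    Prop where
  norm_le : ∀ j, ‖X.ηhat j ω - X.ηstar j‖ ≤ re
  lipschitz : ∀ j, ∑ i, L j (X.Z j i ω) * ‖X.ηhat j ω - X.ηstar j‖ₑ ≤ X.n j
  quadForm : ∀ j a b, |∑ i, {z | L j z ≤ ENNReal.ofReal A}.indicator (X.quadForm j (pairVec a b))
      (X.Z j i ω) - X.n j * ∫ z, {z | L j z ≤ ENNReal.ofReal A}.indicator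
        (X.quadForm j (pairVec a b)) z ∂X.P j| ≤ ρ / (4 * (d ^ 2 + 1)) * X.n j
  lossRem : ∀ j (a : Fin d) (c : ℝ), |c| = M →
    |∑ i, X.lossRem j (c • EuclideanSpace.single a (1 : ℝ)) (X.ηstar j) (X.Z j i ω)
      - X.n j * ∫ z, X.lossRem j (c • EuclideanSpace.single a (1 : ℝ)) (X.ηstar j) z ∂X.P j| ≤ X.n j
  score : ∀ j a, |∑ i, X.score j a (X.ηhat j ω) (X.Z j i ω)| ≤ 3 * X.n j
  cluster_score : ∀ k a,
    |∑ j with X.cluster j = k, ∑ i, X.score j a (X.ηhat j ω) (X.Z j i ω)| ≤ U k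

variable {X}

theorem measure_exists_le {Ω : Type*} [MeasurableSpace Ω] (μ : Measure Ω) {ι : Type*} [Fintype ι]
    (q : ι → Ω → Prop) {B : ℝ} (h : ∀ i, μ {ω | q i ω} ≤ ENNReal.ofReal B) :
    μ {ω | ∃ i, q i ω} ≤ ENNReal.ofReal (Fintype.card ι * B) := by
  have h1 : {ω | ∃ i, q i ω} = ⋃ i, {ω | q i ω} := by ext; simp
  rw [h1]
  refine (measure_iUnion_fintype_le μ _).trans ((Finset.sum_le_sum fun i _ => h i).trans ?_)
  rw [ENNReal.ofReal_mul (by positivity)]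
  simp

namespace LossRegular

variable {M ρ κ σ₁ σ₂ σ₃ σ₅ r₁ r₂ : ℝ} (hX : X.LossRegular M ρ κ σ₁ σ₂ σ₃ σ₅ r₁ r₂)
include hX

theorem measure_quadForm_dev_le (hM : 0 < M) (hρ : 0 < ρ) (hσ₂ : 0 < σ₂) (hr₂ : 2 < r₂)
    {L : ∀ j, X.Sp j → ℝ≥0∞} (hLm : ∀ j, Measurable (L j)) (A : ℝ) (j : Fin X.m) (a b : Fin d)
    {c : ℝ} (hc : 0 < c) :
    X.Pr {ω | c * X.n j ≤ |∑ i, {z | L j z ≤ ENNReal.ofReal A}.indicator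
        (X.quadForm j (pairVec a b)) (X.Z j i ω)
        - X.n j * ∫ z, {z | L j z ≤ ENNReal.ofReal A}.indicator
          (X.quadForm j (pairVec a b)) z ∂X.P j|} ≤
      ENNReal.ofReal (16 * (2 + 2 * κ ^ 2 + 2 * σ₂) / c ^ 2 / X.n j) := by
  set Q := 2 + 2 * κ ^ 2 + 2 * σ₂ with hQ
  have hn := X.one_le_n j
  have hSm : ∀ j, MeasurableSet {z | L j z ≤ ENNReal.ofReal A} := fun j =>
    measurableSet_le (hLm j) measurable_const
  have hq := fun j => hX.memLp_quadForm hM hρ hσ₂ hr₂ j (pairVec a b)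
  have h := measure_sampleSum_sub_ge_le (X := X)
    (φ := fun j => {z | L j z ≤ ENNReal.ofReal A}.indicator (X.quadForm j (pairVec a b)))
    (fun j => (hX.measurable_quadForm hM j _).indicator (hSm j))
    (fun j => (hq j).1.indicator (hSm j)) (B := fun _ => 16 * Q) (fun j => ?_) {j}
    (c := c * X.n j) (by positivity)
  · simp only [Finset.sum_singleton] at h
    refine h.trans (le_of_eq ?_)
    congr 1; field_simp
  · have h4 : ‖pairVec a b‖ ^ 4 ≤ 16 :=
      (pow_le_pow_left₀ (norm_nonneg _) (norm_pairVec_le a b) 4).trans (by norm_num)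
    calc _ ≤ ∫ z, X.quadForm j (pairVec a b) z ^ 2 ∂X.P j := by
          refine integral_mono_of_nonneg (ae_of_all _ fun z => sq_nonneg _) (hq j).1.integrable_sq
            (ae_of_all _ fun z => ?_)
          by_cases hz : z ∈ {z | L j z ≤ ENNReal.ofReal A}
          · simp [Set.indicator_of_mem hz]
          · simpa [Set.indicator_of_notMem hz] using sq_nonneg _
      _ ≤ Q * ‖pairVec a b‖ ^ 4 := (hq j).2
      _ ≤ Q * 16 := by gcongr
      _ = _ := by ring

theorem measure_lossRem_dev_le (hM : 0 < M) (hρ : 0 < ρ) (hσ₂ : 0 < σ₂) (hr₂ : 2 < r₂)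
    (j : Fin X.m) (a : Fin d) {c : ℝ} (hc : |c| = M) :
    X.Pr {ω | X.n j ≤
        |∑ i, X.lossRem j (c • EuclideanSpace.single a (1 : ℝ)) (X.ηstar j) (X.Z j i ω)
          - X.n j * ∫ z, X.lossRem j (c • EuclideanSpace.single a (1 : ℝ)) (X.ηstar j) z ∂X.P j|} ≤
      ENNReal.ofReal ((2 + 2 * κ ^ 2 + 2 * σ₂) * M ^ 4 / X.n j) := by
  have hn := X.one_le_n j
  have hx : ‖c • EuclideanSpace.single a (1 : ℝ)‖ = M := by rw [norm_smul]; simp [hc]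
  have hq := fun j => hX.memLp_lossRem hM hρ hσ₂ hr₂ j hx.le
  have h := measure_sampleSum_sub_ge_le (X := X)
    (φ := fun j => X.lossRem j (c • EuclideanSpace.single a (1 : ℝ)) (X.ηstar j))
    (fun j => hX.measurable_lossRem (Metric.mem_closedBall_self hM.le) hx.le)
    (fun j => (hq j).1) (fun j => (hq j).2) {j} (c := X.n j) (by positivity)
  simp only [Finset.sum_singleton, hx] at h
  refine h.trans (le_of_eq ?_)
  congr 1; field_simp

theorem measure_score_dev_le (hM : 0 < M) (hρ : 0 < ρ) (hσ₁ : 0 < σ₁) (hσ₂ : 0 < σ₂) (hσ₃ : 0 < σ₃)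
    (hr₁ : 2 < r₁) (hr₂ : 2 < r₂) (j : Fin X.m) (a : Fin d) :
    X.Pr {ω | X.n j ≤ |∑ i, X.score j a (X.ηstar j) (X.Z j i ω)|} ≤
      ENNReal.ofReal ((1 + σ₁) / X.n j) := by
  have hn := X.one_le_n j
  have hq := fun j => hX.memLp_score_two hM hσ₁ hr₁ j a
  have h := measure_sampleSum_sub_ge_le (X := X) (φ := fun j => X.score j a (X.ηstar j))
    (fun j => hX.measurable_score hM a (Metric.mem_closedBall_self hM.le))
    (fun j => (hq j).1) (fun j => (hq j).2) {j} (c := X.n j) (by positivity)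
  simp only [Finset.sum_singleton, hX.integral_score_star hM hρ hσ₁ hσ₂ hσ₃ hr₁ hr₂, mul_zero,
    sub_zero] at h
  refine h.trans (le_of_eq ?_)
  congr 1; field_simp

/-- At power `r₁` the threshold contributes `K N_k^{r₁/2}`: the power of `N_k` cancels the moment
bound, and the remaining `1 / K` pays for the union over clusters. -/
theorem measure_cluster_score_le (hM : 0 < M) (hρ : 0 < ρ) (hσ₁ : 0 < σ₁) (hσ₂ : 0 < σ₂)
    (hσ₃ : 0 < σ₃) (hr₁ : 2 < r₁) (hr₂ : 2 < r₂) {B t : ℝ} (hB : 1 ≤ B) (ht : 1 < t)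
    (k : Fin X.K) (a : Fin d) :
    X.Pr {ω | B * (X.K : ℝ) ^ (1 / r₁) * √(X.N k : ℝ) * t ≤
        |∑ j with X.cluster j = k, ∑ i, X.score j a (X.ηstar j) (X.Z j i ω)|} ≤
      ENNReal.ofReal (mzConst r₁ σ₁ / B / t / X.K) := by
  have hK := X.one_le_K
  have hN := X.one_le_N k
  have hr0 : 0 < r₁ := by linarith
  have h := measure_sampleSum_ge_le_rpow (X := X) (φ := fun j => X.score j a (X.ηstar j))
    (fun j => hX.measurable_score hM a (Metric.mem_closedBall_self hM.le)) hr₁ hσ₁.le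
    (fun j => (hX.memLp_score hM hσ₁ hr₁ j a).1)
    (fun j => hX.integral_score_star hM hρ hσ₁ hσ₂ hσ₃ hr₁ hr₂ j a)
    (fun j => (hX.memLp_score hM hσ₁ hr₁ j a).2) (Finset.univ.filter fun j => X.cluster j = k)
    (c := B * (X.K : ℝ) ^ (1 / r₁) * √(X.N k : ℝ) * t) (by positivity)
  refine h.trans (ENNReal.ofReal_le_ofReal ?_)
  have h1 : (B * (X.K : ℝ) ^ (1 / r₁) * √(X.N k : ℝ) * t) ^ r₁ =
      B ^ r₁ * X.K * (X.N k : ℝ) ^ (r₁ / 2) * t ^ r₁ := by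
    rw [Real.mul_rpow (by positivity) (by positivity), Real.mul_rpow (by positivity) (by positivity),
      Real.mul_rpow (by positivity) (by positivity), ← Real.rpow_mul (by positivity),
      one_div_mul_cancel hr0.ne', Real.rpow_one, Real.sqrt_eq_rpow, ← Real.rpow_mul (by positivity)]
    congr 3; ring
  have hmz := mzConst_nonneg hr₁ hσ₁.le
  change mzConst r₁ σ₁ * (X.N k : ℝ) ^ (r₁ / 2) / _ ≤ _
  rw [h1]
  calc _ = mzConst r₁ σ₁ / B ^ r₁ / t ^ r₁ / X.K := by field_simp
    _ ≤ _ := by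
      have hB' : B ≤ B ^ r₁ := Real.self_le_rpow_of_one_le hB (by linarith)
      have ht' : t ≤ t ^ r₁ := Real.self_le_rpow_of_one_le ht.le (by linarith)
      gcongr

end LossRegular

end MTLExperiment

/-! ### Probability of leaving the regular event. -/

namespace MTLExperiment

variable {d : ℕ} {X : MTLExperiment.{u, v, w} d}

theorem SampleRegular.of_not_exists {M ρ A re B₀ : ℝ} {L : ∀ j, X.Sp j → ℝ≥0∞} {U V : Fin X.K → ℝ}
    {ω : X.Ω} (hreM : re ≤ M)
    (hB : B₀ = ρ / (4 * (d ^ 2 + 1)))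
    (h1 : ¬ ∃ j, X.ηhat j ω ∉ X.T j)
    (h2 : ¬ ∃ j, re < ‖X.ηhat j ω - X.ηstar j‖)
    (h3 : ¬ ∃ j, (X.n j : ℝ≥0∞) < ∑ i, L j (X.Z j i ω) * ‖X.ηhat j ω - X.ηstar j‖ₑ)
    (h4 : ¬ ∃ x : Fin X.m × Fin d × Fin d, B₀ * X.n x.1 ≤
      |∑ i, {z | L x.1 z ≤ ENNReal.ofReal A}.indicator
        (X.quadForm x.1 (pairVec x.2.1 x.2.2)) (X.Z x.1 i ω)
        - X.n x.1 * ∫ z, {z | L x.1 z ≤ ENNReal.ofReal A}.indicator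
          (X.quadForm x.1 (pairVec x.2.1 x.2.2)) z ∂X.P x.1|)
    (h5 : ¬ ∃ x : Fin X.m × Fin d × Bool, X.n x.1 ≤
      |∑ i, X.lossRem x.1 ((if x.2.2 then M else -M) • EuclideanSpace.single x.2.1 (1 : ℝ))
          (X.ηstar x.1) (X.Z x.1 i ω)
        - X.n x.1 * ∫ z, X.lossRem x.1
          ((if x.2.2 then M else -M) • EuclideanSpace.single x.2.1 (1 : ℝ)) (X.ηstar x.1) z ∂X.P x.1|)
    (h6 : ¬ ∃ x : Fin X.m × Fin d, X.n x.1 ≤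
      |∑ i, X.score x.1 x.2 (X.ηstar x.1) (X.Z x.1 i ω)|)
    (h7 : ¬ ∃ x : Fin X.m × Fin d,
      (∀ j, X.ηhat j ω ∈ X.T j ∧ X.ηhat j ω ∈ Metric.closedBall (X.ηstar j) M) ∧
        2 * (X.n x.1 : ℝ) < |∑ i, (X.score x.1 x.2 (X.ηhat x.1 ω) (X.Z x.1 i ω)
          - X.score x.1 x.2 (X.ηstar x.1) (X.Z x.1 i ω))|)
    (h8 : ¬ ∃ x : Fin X.K × Fin d, U x.1 ≤
      |∑ j with X.cluster j = x.1, ∑ i, X.score j x.2 (X.ηstar j) (X.Z j i ω)|)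
    (h9 : ¬ ∃ x : Fin X.K × Fin d,
      (∀ j, X.ηhat j ω ∈ X.T j ∧ X.ηhat j ω ∈ Metric.closedBall (X.ηstar j) M) ∧
        2 * V x.1 < |∑ j with X.cluster j = x.1, ∑ i, (X.score j x.2 (X.ηhat j ω) (X.Z j i ω)
          - X.score j x.2 (X.ηstar j) (X.Z j i ω))|) :
    X.SampleRegular M ρ A re L (fun k => U k + 2 * V k) ω := by
  push Not at h1 h2 h3
  have hgood : ∀ j, X.ηhat j ω ∈ X.T j ∧ X.ηhat j ω ∈ Metric.closedBall (X.ηstar j) M :=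
    fun j => ⟨h1 j, mem_closedBall_iff_norm.2 ((h2 j).trans hreM)⟩
  refine ⟨h2, h3, fun j a b => ?_, fun j a c hc => ?_, fun j a => ?_, fun k a => ?_⟩
  · rw [← hB]
    exact (not_le.1 fun h => h4 ⟨(j, a, b), h⟩).le
  · rcases (abs_eq (hc ▸ abs_nonneg c)).1 hc with h | h
    · refine (not_le.1 fun h' => h5 ⟨(j, a, true), ?_⟩).le
      simpa [h] using h'
    · refine (not_le.1 fun h' => h5 ⟨(j, a, false), ?_⟩).le
      simpa [h] using h'
  · have e6 := not_le.1 fun h => h6 ⟨(j, a), h⟩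
    have e7 := not_lt.1 fun h => h7 ⟨(j, a), hgood, h⟩
    dsimp only at e6 e7
    rw [Finset.sum_sub_distrib] at e7
    have := abs_add_le (∑ i, X.score j a (X.ηstar j) (X.Z j i ω))
      (∑ i, X.score j a (X.ηhat j ω) (X.Z j i ω) - ∑ i, X.score j a (X.ηstar j) (X.Z j i ω))
    rw [add_sub_cancel] at this
    linarith
  · have e8 := not_le.1 fun h => h8 ⟨(k, a), h⟩
    have e9 := not_lt.1 fun h => h9 ⟨(k, a), hgood, h⟩
    simp only [Finset.sum_sub_distrib] at e8 e9
    have := abs_add_le (∑ j with X.cluster j = k, ∑ i, X.score j a (X.ηstar j) (X.Z j i ω))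
      (∑ j with X.cluster j = k, ∑ i, X.score j a (X.ηhat j ω) (X.Z j i ω)
        - ∑ j with X.cluster j = k, ∑ i, X.score j a (X.ηstar j) (X.Z j i ω))
    rw [add_sub_cancel] at this
    linarith

namespace LossRegular

variable {M ρ κ σ₁ σ₂ σ₃ σ₅ r₁ r₂ : ℝ} (hX : X.LossRegular M ρ κ σ₁ σ₂ σ₃ σ₅ r₁ r₂)
include hX

theorem measure_task_score_sub_le (hM : 0 < M) (hρ : 0 < ρ) (hσ₁ : 0 < σ₁) (hσ₂ : 0 < σ₂)
    (hσ₃ : 0 < σ₃) (hσ₅ : 0 < σ₅) (hr₁ : 2 < r₁) (hr₂ : 2 < r₂) {σ₄ : ℝ} (hσ₄ : 0 < σ₄)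
    {s : ℕ → ℝ} (hs : ∀ n, 0 < s n) (hN : X.NuisanceRate σ₄ s) (j : Fin X.m) (a : Fin d) :
    X.Pr {ω | (∀ j, X.ηhat j ω ∈ X.T j ∧ X.ηhat j ω ∈ Metric.closedBall (X.ηstar j) M) ∧
        2 * (X.n j : ℝ) < |∑ i, (X.score j a (X.ηhat j ω) (X.Z j i ω)
          - X.score j a (X.ηstar j) (X.Z j i ω))|} ≤
      ENNReal.ofReal (2 * (σ₅ * σ₄) / s (X.n j) ^ 2) := by
  have hn := X.one_le_n j
  have hs0 := hs (X.n j)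
  have h := hX.measure_score_sub_le hM hρ hσ₁ hσ₂ hσ₃ hσ₅ hr₁ hr₂ hσ₄ hN a {j}
    (c := X.n j) (by positivity)
  simp only [Finset.sum_singleton] at h
  refine h.trans (ENNReal.ofReal_le_ofReal ?_)
  have h1 : (1 / (X.n j : ℝ) + 1 / (X.n j : ℝ) ^ 2) * (σ₅ * σ₄) * (X.n j / s (X.n j) ^ 2) =
      (1 + 1 / (X.n j : ℝ)) * (σ₅ * σ₄) / s (X.n j) ^ 2 := by field_simp
  rw [h1]
  have h2 : 1 / (X.n j : ℝ) ≤ 1 := by rw [div_le_one (by positivity)]; exact hn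
  gcongr
  linarith

/-- Since the threshold `c` is at least one, `1/c` dominates `1/c²`, and `b_k` is calibrated so that
`B t K ∑ n_j / s(n_j)² ≤ c`. The resulting `1 / K` again pays for the union over clusters. -/
theorem measure_cluster_score_sub_le (hM : 0 < M) (hρ : 0 < ρ) (hσ₁ : 0 < σ₁) (hσ₂ : 0 < σ₂)
    (hσ₃ : 0 < σ₃) (hσ₅ : 0 < σ₅) (hr₁ : 2 < r₁) (hr₂ : 2 < r₂) {σ₄ : ℝ} (hσ₄ : 0 < σ₄)
    {s : ℕ → ℝ} (hN : X.NuisanceRate σ₄ s) {B t : ℝ} (hB : 1 ≤ B)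
    (ht : 1 < t) (k : Fin X.K) (a : Fin d) :
    X.Pr {ω | (∀ j, X.ηhat j ω ∈ X.T j ∧ X.ηhat j ω ∈ Metric.closedBall (X.ηstar j) M) ∧
        2 * (B * ((X.K : ℝ) ^ (1 / r₁) + X.b s k) * √(X.N k : ℝ) * t) <
          |∑ j with X.cluster j = k, ∑ i, (X.score j a (X.ηhat j ω) (X.Z j i ω)
          - X.score j a (X.ηstar j) (X.Z j i ω))|} ≤
      ENNReal.ofReal (2 * (σ₅ * σ₄) / B / t / X.K) := by
  have hK := X.one_le_K
  have hNk := X.one_le_N k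
  have hb := X.b_nonneg (s := s) k
  have hK1 : 1 ≤ (X.K : ℝ) ^ (1 / r₁) := Real.one_le_rpow hK (by positivity)
  have hsN : 1 ≤ √(X.N k : ℝ) := Real.one_le_sqrt.2 hNk
  set c := B * ((X.K : ℝ) ^ (1 / r₁) + X.b s k) * √(X.N k : ℝ) * t with hc
  set D := ∑ j with X.cluster j = k, (X.n j : ℝ) / s (X.n j) ^ 2 with hD
  have hD0 : 0 ≤ D := Finset.sum_nonneg fun j _ => by positivity
  have hc1 : 1 ≤ c := one_le_mul_of_one_le_of_one_le (one_le_mul_of_one_le_of_one_le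
    (one_le_mul_of_one_le_of_one_le hB (by linarith)) hsN) ht.le
  have hDc : B * t * (X.K * D) ≤ c := by
    calc _ ≤ B * t * (X.b s k * √(X.N k : ℝ)) := 
          mul_le_mul_of_nonneg_left (X.K_mul_sum_le k) (by positivity)
      _ ≤ B * t * (((X.K : ℝ) ^ (1 / r₁) + X.b s k) * √(X.N k : ℝ)) := by gcongr; linarith
      _ = _ := by rw [hc]; ring
  refine (hX.measure_score_sub_le hM hρ hσ₁ hσ₂ hσ₃ hσ₅ hr₁ hr₂ hσ₄ hN a
    (Finset.univ.filter fun j => X.cluster j = k) (by positivity)).trans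
    (ENNReal.ofReal_le_ofReal ?_)
  have h2 : 1 / c ^ 2 ≤ 1 / c := by
    rw [one_div_le_one_div (by positivity) (by positivity)]; nlinarith
  have h3 : 1 / c * D ≤ 1 / B / t / X.K := by
    rw [one_div_mul_eq_div, div_le_iff₀ (by positivity)]
    calc D = 1 / B / t / X.K * (B * t * (X.K * D)) := by field_simp
      _ ≤ _ := by gcongr
  calc _ ≤ (1 / c + 1 / c) * (σ₅ * σ₄) * D := by gcongr
    _ = 2 * (σ₅ * σ₄) * (1 / c * D) := by ring
    _ ≤ 2 * (σ₅ * σ₄) * (1 / B / t / X.K) := by gcongr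
    _ = _ := by ring

/-- Conditions on single tasks each fail with probability of order `1 / W`, hence `m / W` in total;
conditions on clusters fail with total probability of order `1 / (B t)`. Thus `W` absorbs the number
of tasks, and `B` makes the cluster part as small as desired. -/
theorem measure_not_sampleRegular_le (hM : 0 < M) (hρ : 0 < ρ) (hσ₁ : 0 < σ₁) (hσ₂ : 0 < σ₂)
    (hσ₃ : 0 < σ₃) (hσ₅ : 0 < σ₅) (hr₁ : 2 < r₁) (hr₂ : 2 < r₂) {σ₄ : ℝ} (hσ₄ : 0 < σ₄)
    {s : ℕ → ℝ} (hs : ∀ n, 0 < s n) (hN : X.NuisanceRate σ₄ s) {L : ∀ j, X.Sp j → ℝ≥0∞}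
    (hLm : ∀ j, Measurable (L j)) (hL : ∀ j, ∫⁻ z, L j z ∂X.P j ≤ ENNReal.ofReal σ₃) (A : ℝ)
    {re : ℝ} (hre : 0 < re) (hreM : re ≤ M) {B t W : ℝ} (hB : 1 ≤ B) (ht : 1 < t) (hW : 1 ≤ W)
    (hWn : ∀ j, W ≤ √(X.n j : ℝ)) (hWs : ∀ j, W ≤ s (X.n j)) :
    X.Pr {ω | ¬ X.SampleRegular M ρ A re L (fun k => B * (X.K : ℝ) ^ (1 / r₁) * √(X.N k : ℝ) * t
        + 2 * (B * ((X.K : ℝ) ^ (1 / r₁) + X.b s k) * √(X.N k : ℝ) * t)) ω} ≤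
      X.missProb + ENNReal.ofReal
        ((σ₄ / re ^ 2 + σ₃ * (1 + σ₄)
          + d ^ 2 * (16 * (2 + 2 * κ ^ 2 + 2 * σ₂) / (ρ / (4 * (d ^ 2 + 1))) ^ 2)
          + 2 * d * ((2 + 2 * κ ^ 2 + 2 * σ₂) * M ^ 4) + d * (1 + σ₁) + d * (2 * (σ₅ * σ₄)))
            * (X.m / W)
        + d * (mzConst r₁ σ₁ + 2 * (σ₅ * σ₄)) / B / t) := by
  have hK := X.one_le_K
  have hm0 : (0 : ℝ) ≤ X.m := by positivity
  have hmz := mzConst_nonneg hr₁ hσ₁.le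
  have hWn' : ∀ j, W ≤ X.n j := fun j => (hWn j).trans
    (Real.sqrt_le_iff.2 ⟨by positivity, by nlinarith [X.one_le_n j]⟩)
  have hWs' : ∀ j, W ≤ s (X.n j) ^ 2 := fun j => by nlinarith [hWs j]
  set Q := 2 + 2 * κ ^ 2 + 2 * σ₂ with hQ
  have hQ0 : 0 < Q := by positivity
  set c₀ := ρ / (4 * ((d : ℝ) ^ 2 + 1)) with hc₀
  have hc₀0 : 0 < c₀ := by positivity
  have p2 := measure_exists_le X.Pr (fun (j : Fin X.m) ω => re < ‖X.ηhat j ω - X.ηstar j‖)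
    (B := σ₄ / W / re ^ 2) fun j => (hN.measure_norm_sub_gt_le j hre).trans
      (ENNReal.ofReal_le_ofReal (by gcongr; exact hWs' j))
  have p3 := measure_exists_le X.Pr (fun (j : Fin X.m) ω =>
      (X.n j : ℝ≥0∞) < ∑ i, L j (X.Z j i ω) * ‖X.ηhat j ω - X.ηstar j‖ₑ)
    (B := σ₃ * ((1 + σ₄) / W)) fun j =>
      (measure_sum_mul_enorm_sub_gt_le hσ₄ hs hN j (hLm j) hσ₃ (hL j)).trans
      (ENNReal.ofReal_le_ofReal (by gcongr; exact hWs j))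
  have p4 := measure_exists_le X.Pr (fun (x : Fin X.m × Fin d × Fin d) ω => c₀ * X.n x.1 ≤
      |∑ i, {z | L x.1 z ≤ ENNReal.ofReal A}.indicator
        (X.quadForm x.1 (pairVec x.2.1 x.2.2)) (X.Z x.1 i ω)
        - X.n x.1 * ∫ z, {z | L x.1 z ≤ ENNReal.ofReal A}.indicator
          (X.quadForm x.1 (pairVec x.2.1 x.2.2)) z ∂X.P x.1|)
    (B := 16 * Q / c₀ ^ 2 / W) fun x =>
      (hX.measure_quadForm_dev_le hM hρ hσ₂ hr₂ hLm A x.1 x.2.1 x.2.2 hc₀0).trans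
      (ENNReal.ofReal_le_ofReal (by gcongr; exact hWn' x.1))
  have p5 := measure_exists_le X.Pr (fun (x : Fin X.m × Fin d × Bool) ω => X.n x.1 ≤
      |∑ i, X.lossRem x.1 ((if x.2.2 then M else -M) • EuclideanSpace.single x.2.1 (1 : ℝ))
          (X.ηstar x.1) (X.Z x.1 i ω)
        - X.n x.1 * ∫ z, X.lossRem x.1
          ((if x.2.2 then M else -M) • EuclideanSpace.single x.2.1 (1 : ℝ)) (X.ηstar x.1) z ∂X.P x.1|)
    (B := Q * M ^ 4 / W) fun x =>
      (hX.measure_lossRem_dev_le hM hρ hσ₂ hr₂ x.1 x.2.1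
        (by split_ifs <;> simp [abs_of_pos hM])).trans
      (ENNReal.ofReal_le_ofReal (by gcongr; exact hWn' x.1))
  have p6 := measure_exists_le X.Pr (fun (x : Fin X.m × Fin d) ω => X.n x.1 ≤
      |∑ i, X.score x.1 x.2 (X.ηstar x.1) (X.Z x.1 i ω)|)
    (B := (1 + σ₁) / W) fun x =>
      (hX.measure_score_dev_le hM hρ hσ₁ hσ₂ hσ₃ hr₁ hr₂ x.1 x.2).trans
      (ENNReal.ofReal_le_ofReal (by gcongr; exact hWn' x.1))
  have p7 := measure_exists_le X.Pr (fun (x : Fin X.m × Fin d) ω =>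
      (∀ j, X.ηhat j ω ∈ X.T j ∧ X.ηhat j ω ∈ Metric.closedBall (X.ηstar j) M) ∧
        2 * (X.n x.1 : ℝ) < |∑ i, (X.score x.1 x.2 (X.ηhat x.1 ω) (X.Z x.1 i ω)
          - X.score x.1 x.2 (X.ηstar x.1) (X.Z x.1 i ω))|)
    (B := 2 * (σ₅ * σ₄) / W) fun x =>
      (hX.measure_task_score_sub_le hM hρ hσ₁ hσ₂ hσ₃ hσ₅ hr₁ hr₂ hσ₄ hs hN x.1 x.2).trans
      (ENNReal.ofReal_le_ofReal (by gcongr; exact hWs' x.1))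
  have p8 := measure_exists_le X.Pr (fun (x : Fin X.K × Fin d) ω =>
      B * (X.K : ℝ) ^ (1 / r₁) * √(X.N x.1 : ℝ) * t ≤
      |∑ j with X.cluster j = x.1, ∑ i, X.score j x.2 (X.ηstar j) (X.Z j i ω)|) fun x =>
      hX.measure_cluster_score_le hM hρ hσ₁ hσ₂ hσ₃ hr₁ hr₂ hB ht x.1 x.2
  have p9 := measure_exists_le X.Pr (fun (x : Fin X.K × Fin d) ω =>
      (∀ j, X.ηhat j ω ∈ X.T j ∧ X.ηhat j ω ∈ Metric.closedBall (X.ηstar j) M) ∧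
        2 * (B * ((X.K : ℝ) ^ (1 / r₁) + X.b s x.1) * √(X.N x.1 : ℝ) * t) <
          |∑ j with X.cluster j = x.1, ∑ i, (X.score j x.2 (X.ηhat j ω) (X.Z j i ω)
          - X.score j x.2 (X.ηstar j) (X.Z j i ω))|) fun x =>
      hX.measure_cluster_score_sub_le hM hρ hσ₁ hσ₂ hσ₃ hσ₅ hr₁ hr₂ hσ₄ hN hB ht x.1 x.2
  simp only [Fintype.card_prod, Fintype.card_fin, Fintype.card_bool] at p2 p3 p4 p5 p6 p7 p8 p9
  refine (measure_mono fun ω hω => ?_).trans <|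
    (measure_union_le {ω | ∃ j, X.ηhat j ω ∉ X.T j} _).trans <| add_le_add le_rfl <|
    (measure_union_le _ _).trans <| (add_le_add p2 <|
    (measure_union_le _ _).trans <| add_le_add p3 <|
    (measure_union_le _ _).trans <| add_le_add p4 <|
    (measure_union_le _ _).trans <| add_le_add p5 <|
    (measure_union_le _ _).trans <| add_le_add p6 <|
    (measure_union_le _ _).trans <| add_le_add p7 <|
    (measure_union_le _ _).trans <| add_le_add p8 p9).trans ?_
  · by_contra hnot
    simp only [Set.mem_union, not_or, Set.mem_ofPred_eq] at hnot
    exact hω (SampleRegular.of_not_exists hreM rfl hnot.1 hnot.2.1 hnot.2.2.1 hnot.2.2.2.1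
      hnot.2.2.2.2.1 hnot.2.2.2.2.2.1 hnot.2.2.2.2.2.2.1 hnot.2.2.2.2.2.2.2.1 hnot.2.2.2.2.2.2.2.2)
  · push_cast
    rw [← ENNReal.ofReal_add (by positivity) (by positivity),
      ← ENNReal.ofReal_add (by positivity) (by positivity),
      ← ENNReal.ofReal_add (by positivity) (by positivity),
      ← ENNReal.ofReal_add (by positivity) (by positivity),
      ← ENNReal.ofReal_add (by positivity) (by positivity),
      ← ENNReal.ofReal_add (by positivity) (by positivity),
      ← ENNReal.ofReal_add (by positivity) (by positivity)]
    refine ENNReal.ofReal_le_ofReal (le_of_eq ?_)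
    have hK0 : (X.K : ℝ) ≠ 0 := by positivity
    have e8 : X.K * d * (mzConst r₁ σ₁ / B / t / X.K) = d * mzConst r₁ σ₁ / B / t := by
      field_simp
    have e9 : X.K * d * (2 * (σ₅ * σ₄) / B / t / X.K) = d * (2 * (σ₅ * σ₄)) / B / t := by
      field_simp
    rw [e8, e9]
    ring

end LossRegular

end MTLExperiment

/-! ### The fused criterion on the regular event -/

namespace MTLExperiment

variable {d : ℕ} (X : MTLExperiment.{u, v, w} d)

theorem nMin_le (j : Fin X.m) : X.nMin ≤ X.n j := ciInf_le (OrderBot.bddBelow _) j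

theorem le_nMax (j : Fin X.m) : X.n j ≤ X.nMax := le_ciSup (Set.finite_range X.n).bddAbove j

theorem nMin_pos : 0 < X.nMin := by
  have : Nonempty (Fin X.m) := ⟨⟨0, X.m_pos⟩⟩
  obtain ⟨j, hj⟩ := exists_eq_ciInf_of_finite (f := X.n)
  rw [nMin, ← hj]
  exact X.n_pos j

theorem NMin_le (k : Fin X.K) : X.NMin ≤ X.N k := ciInf_le (OrderBot.bddBelow _) k

theorem NMin_pos : 0 < X.NMin := by
  have : Nonempty (Fin X.K) := ⟨X.cluster ⟨0, X.m_pos⟩⟩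
  obtain ⟨k, hk⟩ := exists_eq_ciInf_of_finite (f := X.N)
  rw [NMin, ← hk]
  exact_mod_cast X.one_le_N k

theorem NMin_le_mul : (X.NMin : ℝ) ≤ X.m * X.nMax := by
  have h1 : X.N (X.cluster ⟨0, X.m_pos⟩) ≤ X.m * X.nMax := by
    calc _ ≤ ∑ _j : Fin X.m, X.nMax :=
          (Finset.sum_le_sum fun j _ => X.le_nMax j).trans
            (Finset.sum_le_sum_of_subset (Finset.filter_subset _ _))
      _ = _ := by simp
  exact_mod_cast (X.NMin_le _).trans h1

theorem K_le_m : X.K ≤ X.m := by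
  simpa using Fintype.card_le_of_surjective _ X.cluster_surjective

theorem size_le_m (k : Fin X.K) : X.size k ≤ X.m := by
  exact (Finset.card_filter_le _ _).trans (by simp)

variable {X}

/-- The sum of the losses of task `j` over its evaluation sample. -/
noncomputable def sampleLoss (X : MTLExperiment.{u, v, w} d) (ω : X.Ω) (j : Fin X.m) (θ : Vec d) :
    ℝ := ∑ i, X.loss j θ (X.ηhat j ω) (X.Z j i ω)

theorem fusionPenalty_nonneg {Λ ε : ℝ} (hΛ : 0 ≤ Λ) (hε : 0 ≤ ε) {m K : ℕ} {E : Type*}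
    [NormedAddCommGroup E] (cl : Fin m → Fin K) (θ : Fin m → E) : 0 ≤ fusionPenalty cl Λ ε θ :=
  Finset.sum_nonneg fun j _ => Finset.sum_nonneg fun j' _ =>
    mul_nonneg (by split_ifs <;> assumption) (norm_nonneg _)

theorem ofReal_fusionPenalty {Λ ε : ℝ} (hΛ : 0 ≤ Λ) (hε : 0 ≤ ε) {m K : ℕ} {E : Type*}
    [NormedAddCommGroup E] (cl : Fin m → Fin K) (θ : Fin m → E) :
    ENNReal.ofReal (fusionPenalty cl Λ ε θ) = ∑ j, ∑ j' with j' < j,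
      ENNReal.ofReal (if cl j = cl j' then Λ else ε) * ‖θ j - θ j'‖ₑ := by
  have h0 : ∀ j j', 0 ≤ (if cl j = cl j' then Λ else ε) := fun j j' => by
    split_ifs <;> assumption
  unfold fusionPenalty
  rw [ENNReal.ofReal_sum_of_nonneg fun j _ => Finset.sum_nonneg fun j' _ =>
    mul_nonneg (h0 j j') (norm_nonneg _)]
  refine Finset.sum_congr rfl fun j _ => ?_
  rw [ENNReal.ofReal_sum_of_nonneg fun j' _ => mul_nonneg (h0 j j') (norm_nonneg _)]
  refine Finset.sum_congr rfl fun j' _ => ?_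
  rw [ENNReal.ofReal_mul (h0 j j'), ofReal_norm]

theorem coe_fusedObjective {Λ ε : ℝ} (hΛ : 0 ≤ Λ) (hε : 0 ≤ ε) (ω : X.Ω) (θ : Fin X.m → Vec d) :
    ((fusedObjective (X.sampleLoss ω) X.cluster Λ ε θ : ℝ) : EReal) =
      ((∑ j, ∑ i, X.loss j (θ j) (X.ηhat j ω) (X.Z j i ω) : ℝ) : EReal) +
        ((∑ j, ∑ j' with j' < j, ENNReal.ofReal (if X.cluster j = X.cluster j' then Λ else ε) *
          ‖θ j - θ j'‖ₑ : ℝ≥0∞) : EReal) := by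
  rw [← ofReal_fusionPenalty hΛ hε, EReal.coe_ennreal_ofReal,
    max_eq_left (fusionPenalty_nonneg hΛ hε _ _), ← EReal.coe_add]
  rfl

/-- Together with `coe_fusedObjective_eq_criterion` this replaces random, possibly infinite
penalties by two real weights: domination everywhere and equality on cluster-wise constant vectors
make the minimizers comparable. -/
theorem coe_fusedObjective_le_criterion {cw γ τ Λ ε : ℝ} (hΛ : 0 ≤ Λ) (hε : 0 ≤ ε) {ω : X.Ω}
    (hin : ∀ j j', X.cluster j = X.cluster j' →
      ENNReal.ofReal Λ ≤ X.penalty cw γ τ ε ω j j')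
    (hout : ∀ j j', X.cluster j ≠ X.cluster j' →
      X.penalty cw γ τ ε ω j j' = ENNReal.ofReal ε) (θ : Fin X.m → Vec d) :
    ((fusedObjective (X.sampleLoss ω) X.cluster Λ ε θ : ℝ) : EReal) ≤
      X.criterion cw γ τ ε ω θ := by
  rw [coe_fusedObjective hΛ hε, criterion]
  refine add_le_add le_rfl (EReal.coe_ennreal_le_coe_ennreal_iff.2 ?_)
  refine Finset.sum_le_sum fun j _ => Finset.sum_le_sum fun j' _ => mul_le_mul_left ?_ _
  split_ifs with h
  · exact hin j j' h
  · exact (hout j j' h).ge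

theorem coe_fusedObjective_eq_criterion {cw γ τ Λ ε : ℝ} (hΛ : 0 ≤ Λ) (hε : 0 ≤ ε) {ω : X.Ω}
    (hout : ∀ j j', X.cluster j ≠ X.cluster j' →
      X.penalty cw γ τ ε ω j j' = ENNReal.ofReal ε) {θ : Fin X.m → Vec d}
    (hθ : ∀ j j', X.cluster j = X.cluster j' → θ j = θ j') :
    ((fusedObjective (X.sampleLoss ω) X.cluster Λ ε θ : ℝ) : EReal) =
      X.criterion cw γ τ ε ω θ := by
  rw [coe_fusedObjective hΛ hε, criterion]
  congr 2
  refine Finset.sum_congr rfl fun j _ => Finset.sum_congr rfl fun j' _ => ?_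
  split_ifs with h
  · simp [hθ j j' h]
  · rw [hout j j' h]

theorem norm_θinit_sub_lt {α δ : ℝ} {ω : X.Ω} (hα : 0 < α)
    (h : ∀ j, (X.n j : ℝ) ^ α * ‖X.θinit j ω - X.θstar j‖ < δ / 4) (j : Fin X.m) :
    ‖X.θinit j ω - X.θstar j‖ < δ / 4 * ((X.nMin : ℝ) ^ α)⁻¹ := by
  have h0 : (0 : ℝ) < X.nMin := by exact_mod_cast X.nMin_pos
  have h1 : (0 : ℝ) < (X.nMin : ℝ) ^ α := by positivity
  have h2 : (X.nMin : ℝ) ^ α ≤ (X.n j : ℝ) ^ α :=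
    Real.rpow_le_rpow h0.le (by exact_mod_cast X.nMin_le j) hα.le
  rw [← div_eq_mul_inv, lt_div_iff₀ h1]
  calc _ ≤ ‖X.θinit j ω - X.θstar j‖ * (X.n j : ℝ) ^ α := by gcongr
    _ = _ := mul_comm _ _
    _ < _ := h j

theorem weight_le {cw γ x : ℝ} (hγ : 0 ≤ γ) (hx : 0 < x) {ω : X.Ω} {j j' : Fin X.m}
    (h : x ≤ ‖X.θinit j ω - X.θinit j' ω‖) :
    X.weight cw γ ω j j' ≤ ENNReal.ofReal cw * ENNReal.ofReal (x ^ (-γ)) := by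
  unfold weight
  gcongr
  rw [← ENNReal.ofReal_rpow_of_pos hx, ENNReal.rpow_neg, ENNReal.rpow_neg, ENNReal.inv_le_inv,
    ← ofReal_norm]
  exact ENNReal.rpow_le_rpow (ENNReal.ofReal_le_ofReal h) hγ

theorem le_weight {cw γ x : ℝ} (hγ : 0 ≤ γ) (hx : 0 < x) {ω : X.Ω} {j j' : Fin X.m}
    (h : ‖X.θinit j ω - X.θinit j' ω‖ ≤ x) :
    ENNReal.ofReal cw * ENNReal.ofReal (x ^ (-γ)) ≤ X.weight cw γ ω j j' := by
  unfold weight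
  gcongr
  rw [← ENNReal.ofReal_rpow_of_pos hx, ENNReal.rpow_neg, ENNReal.rpow_neg, ENNReal.inv_le_inv,
    ← ofReal_norm]
  exact ENNReal.rpow_le_rpow (ENNReal.ofReal_le_ofReal h) hγ

/-- Pilots of one cluster are within `δ/2 · n_min^{-α}` of each other, so their weight exceeds the
threshold and is kept as the penalty. -/
theorem le_penalty_of_cluster_eq {α γ cw δ τ ε : ℝ} {ω : X.Ω} (hα : 0 < α) (hγ : 0 ≤ γ)
    (hcw : 0 < cw) (hδ : 0 < δ)
    (hτ : τ < cw * (δ / 2) ^ (-γ) * (X.nMin : ℝ) ^ (α * γ))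
    (h : ∀ j, (X.n j : ℝ) ^ α * ‖X.θinit j ω - X.θstar j‖ < δ / 4) {j j' : Fin X.m}
    (hjj : X.cluster j = X.cluster j') :
    ENNReal.ofReal (cw * (δ / 2) ^ (-γ) * (X.nMin : ℝ) ^ (α * γ)) ≤
      X.penalty cw γ τ ε ω j j' := by
  have h0 : (0 : ℝ) < X.nMin := by exact_mod_cast X.nMin_pos
  have h1 : (0 : ℝ) < (X.nMin : ℝ) ^ α := by positivity
  have hj := norm_θinit_sub_lt hα h j
  have hj' := norm_θinit_sub_lt hα h j'
  have hst : X.θstar j = X.θstar j' := by simp [θstar, hjj]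
  have hle : ‖X.θinit j ω - X.θinit j' ω‖ ≤ δ / 2 * ((X.nMin : ℝ) ^ α)⁻¹ := by
    have h3 := norm_sub_le_norm_sub_add_norm_sub (X.θinit j ω) (X.θstar j) (X.θinit j' ω)
    rw [norm_sub_rev (X.θstar j), hst] at h3
    rw [hst] at hj
    linarith
  have hw := le_weight (cw := cw) hγ (by positivity) hle
  have heq : (δ / 2 * ((X.nMin : ℝ) ^ α)⁻¹) ^ (-γ) = (δ / 2) ^ (-γ) * (X.nMin : ℝ) ^ (α * γ) := by
    rw [Real.mul_rpow (by positivity) (by positivity), ← Real.rpow_neg h0.le,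
      ← Real.rpow_mul h0.le]
    congr 2; ring
  rw [← ENNReal.ofReal_mul hcw.le, heq, ← mul_assoc] at hw
  unfold penalty
  rw [if_neg]
  · exact hw
  · refine not_le.2 (lt_of_lt_of_le ?_ hw)
    exact (ENNReal.ofReal_lt_ofReal_iff (by positivity)).2 hτ

/-- Pilots of different clusters stay at distance at least `δ - 2 · δ/4 = δ/2`, so their weight is
below the threshold. -/
theorem penalty_eq_of_cluster_ne {α γ cw δ τ ε : ℝ} {ω : X.Ω} (hα : 0 < α) (hγ : 0 ≤ γ)
    (hcw : 0 < cw) (hδ : 0 < δ) (hT : X.ClusteredTargets δ)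
    (hτ : cw * (δ / 2) ^ (-γ) < τ)
    (h : ∀ j, (X.n j : ℝ) ^ α * ‖X.θinit j ω - X.θstar j‖ < δ / 4) {j j' : Fin X.m}
    (hjj : X.cluster j ≠ X.cluster j') :
    X.penalty cw γ τ ε ω j j' = ENNReal.ofReal ε := by
  have h0 : (1 : ℝ) ≤ X.nMin := by exact_mod_cast X.nMin_pos
  have h1 : ((X.nMin : ℝ) ^ α)⁻¹ ≤ 1 := inv_le_one_of_one_le₀ (Real.one_le_rpow h0 hα.le)
  have hsm : ∀ j, ‖X.θinit j ω - X.θstar j‖ ≤ δ / 4 := fun j =>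
    (norm_θinit_sub_lt hα h j).le.trans (mul_le_of_le_one_right (by positivity) h1)
  have hj := hsm j
  have hj' := hsm j'
  have hsep := hT.separated _ _ hjj
  have hle : δ / 2 ≤ ‖X.θinit j ω - X.θinit j' ω‖ := by
    have h3 := norm_sub_le_norm_sub_add_norm_sub (X.θstar j) (X.θinit j ω) (X.θstar j')
    have h4 := norm_sub_le_norm_sub_add_norm_sub (X.θinit j ω) (X.θinit j' ω) (X.θstar j')
    rw [norm_sub_rev (X.θstar j) (X.θinit j ω)] at h3
    change δ ≤ ‖X.θstar j - X.θstar j'‖ at hsep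
    linarith
  have hw := weight_le (cw := cw) hγ (by positivity) hle
  rw [← ENNReal.ofReal_mul hcw.le] at hw
  unfold penalty
  rw [if_pos (hw.trans (ENNReal.ofReal_le_ofReal hτ.le))]

/-- An estimator that minimizes the fused criterion is exact about the clusters and accurate, if the
task losses are regular and the penalties separate the clusters. -/
theorem IsFusedEstimator.exact_clustering {cw γ τ Λ ε r G δ : ℝ} {ω : X.Ω}
    {θhat : X.Ω → Fin X.m → Vec d} (hθ : X.IsFusedEstimator cw γ τ ε θhat)
    (hT : X.ClusteredTargets δ)
    (hin : ∀ j j', X.cluster j = X.cluster j' → ENNReal.ofReal Λ ≤ X.penalty cw γ τ ε ω j j')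
    (hout : ∀ j j', X.cluster j ≠ X.cluster j' → X.penalty cw γ τ ε ω j j' = ENNReal.ofReal ε)
    (hconv : ∀ j, ConvexOn ℝ X.Θ (X.sampleLoss ω j)) (hε : 0 ≤ ε) (hr : 0 < r) (hG : 0 ≤ G)
    (hball : ∀ j, Metric.closedBall (X.θstar j) r ⊆ X.Θ)
    {g : Fin X.m → Vec d} {q : Fin X.m → ℝ} {R : Fin X.K → ℝ} (hq : ∀ j, 0 < q j)
    (hlip : ∀ j, ∀ x ∈ Metric.closedBall (X.θstar j) r, ∀ y ∈ Metric.closedBall (X.θstar j) r,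
      |X.sampleLoss ω j x - X.sampleLoss ω j y| ≤ G * ‖x - y‖)
    (hquad : ∀ j, ∀ x ∈ Metric.closedBall (X.θstar j) r,
      X.sampleLoss ω j (X.θstar j) + ⟪g j, x - X.θstar j⟫_ℝ + q j * ‖x - X.θstar j‖ ^ 2 ≤
        X.sampleLoss ω j x)
    (hR : ∀ k, ‖∑ j with X.cluster j = k, g j‖ + ε * X.m ^ 2 ≤
      (∑ j with X.cluster j = k, q j) * R k)
    (hRr : ∀ k, R k < r) (hrδ : 2 * r ≤ δ) (hΛ : G + 2 * ε * X.m < Λ) :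
    (∀ j j', θhat ω j = θhat ω j' ↔ X.cluster j = X.cluster j') ∧
      ∀ j, ‖θhat ω j - X.θstar j‖ ≤ R (X.cluster j) := by
  have hΛ0 : 0 ≤ Λ := by
    have : 0 ≤ 2 * ε * X.m := by positivity
    linarith
  obtain ⟨⟨θ₀, hθ₀, hfus, hmin⟩, hall⟩ := fusedObjective_exact_clustering (β₀ := X.βstar)
    X.cluster_surjective hconv hε hr hG
    (fun k => by obtain ⟨j, rfl⟩ := X.cluster_surjective k; exact hball j) hq hlip hquad hR hRr hΛ
  have hle := coe_fusedObjective_le_criterion hΛ0 hε hin hout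
  have heq := coe_fusedObjective_eq_criterion hΛ0 hε hout hfus
  -- The fused minimizer of the model also minimizes the criterion, so a minimizer exists at this
  -- outcome and the estimator is one. Chaining domination and equality, the estimator also
  -- minimizes the model.
  obtain ⟨hmem, hopt⟩ := hθ ω ⟨θ₀, hθ₀, fun θ' hθ' => by
    simp only [Set.mem_ofPred_eq] at hθ' ⊢
    rw [← heq]
    exact (EReal.coe_le_coe_iff.2 (hmin θ' hθ')).trans (hle θ')⟩
  obtain ⟨h1, h2⟩ := hall (θhat ω) hmem fun θ' hθ' =>
    (EReal.coe_le_coe_iff.1 ((hle _).trans ((hopt hθ₀).trans heq.ge))).trans (hmin θ' hθ')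
  refine ⟨fun j j' => ⟨fun h => ?_, h1 j j'⟩, h2⟩
  -- Equal estimates in different clusters would put both targets within less than `r` of one point,
  -- against `2 r ≤ δ`.
  by_contra hne
  have h3 := hT.separated _ _ hne
  have h4 := h2 j
  have h5 := h2 j'
  rw [norm_sub_rev] at h4
  rw [h] at h4
  have := norm_sub_le_norm_sub_add_norm_sub (X.βstar (X.cluster j)) (θhat ω j')
    (X.βstar (X.cluster j'))
  linarith [hRr (X.cluster j), hRr (X.cluster j')]

end MTLExperiment

/-! ### Matching the constants on the regular event. -/

namespace MTLExperiment

variable {d : ℕ} {X : MTLExperiment.{u, v, w} d}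

/-- Convexity of `Θ` is part of the convexity of the loss at any one observation, and a probability
space is nonempty. -/
theorem convex_Θ {M ρ κ σ₁ σ₂ σ₃ σ₅ r₁ r₂ : ℝ} (hX : X.LossRegular M ρ κ σ₁ σ₂ σ₃ σ₅ r₁ r₂)
    (hM : 0 < M) : Convex ℝ X.Θ := by
  set j : Fin X.m := ⟨0, X.m_pos⟩
  obtain ⟨z⟩ := (X.P j).nonempty_of_neZero
  exact (hX.convex j _ (Metric.mem_closedBall_self hM.le) z).1

/-- Crude bounds `K ≤ m` and `√m_k ≤ m` suffice here: with `K_rpow_mul_le` this only serves to keep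
the estimation error below the fixed radius `r`. -/
theorem b_mul_le {s : ℕ → ℝ} {W t : ℝ} (ht : 1 ≤ t) (hW : 0 < W) (hWs : ∀ j, W ≤ s (X.n j))
    (k : Fin X.K) : X.b s k * (X.N k : ℝ) ^ (-1 / 2 : ℝ) * t ≤ (X.m * t / W) ^ 2 := by
  have hN := X.one_le_N k
  have hsN : 0 < √(X.N k : ℝ) := Real.sqrt_pos.2 (by linarith)
  have hN' : (X.N k : ℝ) ^ (-1 / 2 : ℝ) = (√(X.N k : ℝ))⁻¹ := by
    rw [neg_div, Real.rpow_neg (by positivity), Real.sqrt_eq_rpow]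
  have hm1 : (1 : ℝ) ≤ X.m := by exact_mod_cast X.m_pos
  have hK : (X.K : ℝ) ≤ X.m := by exact_mod_cast X.K_le_m
  have hsz : √(X.size k : ℝ) ≤ X.m := Real.sqrt_le_iff.2 ⟨by positivity, by
    have : (X.size k : ℝ) ≤ X.m := by exact_mod_cast X.size_le_m k
    nlinarith⟩
  have hμ : (⨆ j : {j // X.cluster j = k}, √(X.n j : ℝ) * (s (X.n j) ^ 2)⁻¹) ≤
      √(X.N k : ℝ) * (W ^ 2)⁻¹ := by
    refine Real.iSup_le (fun ⟨j, hj⟩ => ?_) (by positivity)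
    have h1 : (X.n j : ℝ) ≤ X.N k := by
      rw [← hj]; exact_mod_cast X.n_le_N j
    have := hWs j
    gcongr
  rw [hN', b]
  calc _ ≤ X.m * X.m * (√(X.N k : ℝ) * (W ^ 2)⁻¹) * (√(X.N k : ℝ))⁻¹ * t := by
        gcongr
        exact Real.iSup_nonneg fun j => by positivity
    _ = (X.m / W) ^ 2 * t := by field_simp
    _ ≤ (X.m / W) ^ 2 * t ^ 2 := by gcongr; nlinarith
    _ = _ := by ring

theorem K_rpow_mul_le {r₁ W t : ℝ} (hr₁ : 2 < r₁) (ht : 1 ≤ t) (hW : 0 < W)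
    (hWn : ∀ j, W ≤ √(X.n j : ℝ)) (k : Fin X.K) :
    (X.K : ℝ) ^ (1 / r₁) * (X.N k : ℝ) ^ (-1 / 2 : ℝ) * t ≤ X.m * t / W := by
  have hN := X.one_le_N k
  have hN' : (X.N k : ℝ) ^ (-1 / 2 : ℝ) = (√(X.N k : ℝ))⁻¹ := by
    rw [neg_div, Real.rpow_neg (by positivity), Real.sqrt_eq_rpow]
  have hK : (X.K : ℝ) ^ (1 / r₁) ≤ X.m :=
    (Real.rpow_le_self_of_one_le X.one_le_K (by
      rw [div_le_one (by linarith)]; linarith)).trans (by exact_mod_cast X.K_le_m)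
  have hWN : W ≤ √(X.N k : ℝ) := by
    obtain ⟨j, rfl⟩ := X.cluster_surjective k
    exact (hWn j).trans (Real.sqrt_le_sqrt (by exact_mod_cast X.n_le_N j))
  rw [hN']
  calc _ ≤ X.m * W⁻¹ * t := by gcongr
    _ = _ := by ring

theorem SampleRegular.exact_clustering {M δ ρ κ σ₁ σ₂ σ₃ σ₅ r₁ r₂ : ℝ} (hM : 0 < M)
    (hδ : 0 < δ) (hρ : 0 < ρ) (hσ₁ : 0 < σ₁) (hσ₂ : 0 < σ₂) (hσ₃ : 0 < σ₃)
    (hr₁ : 2 < r₁) (hr₂ : 2 < r₂) {s : ℕ → ℝ}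
    (hT : X.ClusteredTargets δ) (hX : X.LossRegular M ρ κ σ₁ σ₂ σ₃ σ₅ r₁ r₂)
    {L : ∀ j, X.Sp j → ℝ≥0∞} (hLm : ∀ j, Measurable (L j))
    (hLle : ∀ j z, X.hessLip M j z ≤ L j z) (hLi : ∀ j, ∫⁻ z, L j z ∂X.P j ≤ ENNReal.ofReal σ₃)
    {A re r B C t G₀ : ℝ} (hA : A = 16 * (2 + 2 * κ ^ 2 + 2 * σ₂) * σ₃ / ρ ^ 2)
    (hreM : re ≤ M) (hr : 0 < r) (hrM : (d + 1) * (3 * r) ≤ M) (hrδ : 2 * r ≤ δ)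
    (hAr : A * (r + re) ≤ ρ / 4) (hB : 1 ≤ B) (hC : C = 8 / ρ * (3 * d * B + 1)) (ht : 1 < t)
    (hG₀ : G₀ = 2 * (3 * M + (2 + (2 + 2 * κ ^ 2 + 2 * σ₂) * M ^ 4 + M ^ 2 / 2)) / r)
    (hRr : ∀ k, C * ((X.K : ℝ) ^ (1 / r₁) + X.b s k) * (X.N k : ℝ) ^ (-1 / 2 : ℝ) * t < r)
    {α ζ γ cw τ ε c₂ : ℝ} (hα : 0 < α) (hγ : 0 ≤ γ) (hcw : 0 < cw) (hζ : ζ < 1 / 2)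
    (hc₂ : c₂ = cw * (δ / 2) ^ (-γ)) (htun : X.Tuned ((G₀ + 3) / c₂) 1 c₂ α ζ γ τ ε)
    {θhat : X.Ω → Fin X.m → Vec d} (hθ : X.IsFusedEstimator cw γ τ ε θhat) {ω : X.Ω}
    (hpil : ∀ j, (X.n j : ℝ) ^ α * ‖X.θinit j ω - X.θstar j‖ < δ / 4)
    (hω : X.SampleRegular M ρ A re L (fun k => B * (X.K : ℝ) ^ (1 / r₁) * √(X.N k : ℝ) * t
        + 2 * (B * ((X.K : ℝ) ^ (1 / r₁) + X.b s k) * √(X.N k : ℝ) * t)) ω) :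
    (∀ j j', θhat ω j = θhat ω j' ↔ X.cluster j = X.cluster j') ∧
      ∀ j, ‖θhat ω j - X.θstar j‖ ≤ C * ((X.K : ℝ) ^ (1 / r₁) + X.b s (X.cluster j)) *
        (X.N (X.cluster j) : ℝ) ^ (-1 / 2 : ℝ) * t := by
  obtain ⟨htun1, hε, htun2, hτ1, hτ2⟩ := htun
  have hc₂0 : 0 < c₂ := by rw [hc₂]; positivity
  have hG₀0 : 0 < G₀ := by rw [hG₀]; positivity
  have hm1 : (1 : ℝ) ≤ X.m := by exact_mod_cast X.m_pos
  have hnM : (0 : ℝ) ≤ X.nMax := by positivity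
  have hNmin : (1 : ℝ) ≤ X.NMin := by exact_mod_cast X.NMin_pos
  have hA0 : 0 ≤ A := by rw [hA]; positivity
  have hrM' : r ≤ M := by
    have : (1 : ℝ) * (1 * r) ≤ (d + 1) * (3 * r) := by gcongr <;> simp
    linarith
  have hη : ∀ j, X.ηhat j ω ∈ Metric.closedBall (X.ηstar j) M := fun j =>
    mem_closedBall_iff_norm.2 ((hω.norm_le j).trans hreM)
  have hεm : ε * X.m ^ 2 ≤ (X.NMin : ℝ) ^ ζ := by
    rw [one_mul, inv_mul_eq_div, le_div_iff₀ (by positivity)] at htun2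
    exact htun2
  -- As `N_min ≤ m n_max` and `ζ ≤ 1`, the bound on `ε m²` makes `2 ε m` at most `2 n_max`, so that
  -- it fits into the slack of `c₀`.
  have hεm1 : ε * X.m ≤ X.nMax := by
    have h1 : (X.NMin : ℝ) ^ ζ ≤ X.NMin := Real.rpow_le_self_of_one_le hNmin (by linarith)
    have h2 := (hεm.trans h1).trans X.NMin_le_mul
    have h3 : X.m * (ε * X.m) ≤ X.m * X.nMax := by linarith
    exact le_of_mul_le_mul_left h3 (by linarith)
  refine hθ.exact_clustering (Λ := c₂ * (X.nMin : ℝ) ^ (α * γ)) (G := G₀ * X.nMax)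
    (g := fun j => ∑ i, X.gradLoss j (X.θstar j) (X.ηhat j ω) (X.Z j i ω))
    (q := fun j => ρ / 8 * X.n j)
    (R := fun k => C * ((X.K : ℝ) ^ (1 / r₁) + X.b s k) * (X.N k : ℝ) ^ (-1 / 2 : ℝ) * t) hT ?_ ?_
    (fun j => hX.convexOn_sum_loss (hη j) _ (convex_Θ hX hM)) hε hr (by positivity)
    (fun j => (Metric.closedBall_subset_closedBall hrM').trans (hX.ball_subset j))
    (fun j => by have := X.one_le_n j; positivity) ?_ ?_ ?_ hRr hrδ ?_
  · intro j j' hjj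
    rw [hc₂]
    exact le_penalty_of_cluster_eq hα hγ hcw hδ (hc₂ ▸ hτ2) hpil hjj
  · intro j j' hjj
    exact penalty_eq_of_cluster_ne hα hγ hcw hδ hT (hc₂ ▸ hτ1) hpil hjj
  · intro j x hx y hy
    refine (hX.abs_sum_loss_sub_le hM hρ hσ₂ hr₂ (hη j) hr hrM (convex_Θ hX hM) (hLle j)
      (hω.lipschitz j) (hω.lossRem j) (hω.score j) hx hy).trans ?_
    gcongr
    have h1 : (X.n j : ℝ) ≤ X.nMax := by exact_mod_cast X.le_nMax j
    calc _ = G₀ * X.n j := by rw [hG₀]; ring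
      _ ≤ _ := by gcongr
  · intro j x hx
    have h1 := sum_loss_sub_eq j (x - X.θstar j) (X.ηhat j ω) fun i => X.Z j i ω
    rw [add_sub_cancel] at h1
    have h2 := hX.le_sum_lossRem hM hρ hσ₂ hr₂ (hω.norm_le j) hreM (mem_closedBall_iff_norm.1 hx)
      hrM' (hLm j) (hLle j) hA0 hAr
      (by rw [hA]; exact hX.le_integral_indicator_quadForm hM hρ hσ₁ hσ₂ hσ₃ hr₁ hr₂ (hLm j) (hLi j))
      (hω.quadForm j)
    change ∑ i, _ + _ + _ ≤ ∑ i, _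
    linarith
  · intro k
    have hNk := X.one_le_N k
    have hsN : 0 < √(X.N k : ℝ) := Real.sqrt_pos.2 (by linarith)
    have hN' : (X.N k : ℝ) * (X.N k : ℝ) ^ (-1 / 2 : ℝ) = √(X.N k : ℝ) := by
      rw [Real.sqrt_eq_rpow, ← Real.rpow_one_add' (by positivity) (by norm_num)]
      norm_num
    have hK1 : 1 ≤ (X.K : ℝ) ^ (1 / r₁) := Real.one_le_rpow X.one_le_K (by positivity)
    have hb := X.b_nonneg (s := s) k
    set κ₁ := (X.K : ℝ) ^ (1 / r₁)
    have h1 : ‖∑ j with X.cluster j = k,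
        ∑ i, X.gradLoss j (X.θstar j) (X.ηhat j ω) (X.Z j i ω)‖ ≤
        d * (3 * (B * (κ₁ + X.b s k) * √(X.N k : ℝ) * t)) := by
      refine (norm_le_sum_abs_coord _).trans ?_
      calc _ ≤ ∑ _a : Fin d, (B * κ₁ * √(X.N k : ℝ) * t
            + 2 * (B * (κ₁ + X.b s k) * √(X.N k : ℝ) * t)) := by
            refine Finset.sum_le_sum fun a _ => ?_
            have := hω.cluster_score k a
            simpa [MTLExperiment.score] using this
        _ ≤ ∑ _a : Fin d, (B * (κ₁ + X.b s k) * √(X.N k : ℝ) * t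
            + 2 * (B * (κ₁ + X.b s k) * √(X.N k : ℝ) * t)) := by
            gcongr
            linarith
        _ = _ := by simp; ring
    -- The shrinkage bias across clusters is at most `N_min^ζ ≤ √N_k`, hence absorbed into the
    -- stochastic term; it accounts for the `+ 1` in `C`.
    have h2 : ε * X.m ^ 2 ≤ (κ₁ + X.b s k) * √(X.N k : ℝ) * t := by
      calc _ ≤ (X.NMin : ℝ) ^ ζ := hεm
        _ ≤ (X.NMin : ℝ) ^ (1 / 2 : ℝ) := Real.rpow_le_rpow_of_exponent_le hNmin hζ.le
        _ = √(X.NMin : ℝ) := by rw [Real.sqrt_eq_rpow]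
        _ ≤ √(X.N k : ℝ) := Real.sqrt_le_sqrt (by exact_mod_cast X.NMin_le k)
        _ = 1 * √(X.N k : ℝ) * 1 := by ring
        _ ≤ _ := by gcongr; linarith
    have h3 : ∑ j with X.cluster j = k, ρ / 8 * (X.n j : ℝ) = ρ / 8 * X.N k := by
      rw [← Finset.mul_sum, N]; push_cast; rfl
    rw [h3]
    calc _ ≤ (3 * d * B + 1) * ((κ₁ + X.b s k) * √(X.N k : ℝ) * t) := by linarith
      _ = _ := by rw [← hN', hC]; field_simp
  -- The first tuning condition reads `(G₀ + 3) n_max ≤ Λ`. Of the `3`, two units cover `2 ε m` and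
  -- the third makes the inequality strict.
  · rw [div_mul_eq_mul_div, div_le_iff₀ hc₂0] at htun1
    have hnM1 : (1 : ℝ) ≤ X.nMax :=
      (X.one_le_n ⟨0, X.m_pos⟩).trans (by exact_mod_cast X.le_nMax _)
    linarith

/-- The exponent `r₂ / (2 (r₂ + d))` is at most one half, so the condition on `n_min` is used only
through `√n_j`. -/
theorem bounds_of_lt_tMax {c r₂ t : ℝ} {s : ℕ → ℝ} (hs : ∀ n, 0 < s n) (hr₂ : 2 < r₂) (hc : 0 < c)
    (ht : 1 < t) (h : ENNReal.ofReal t < X.tMax c r₂ s) :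
    X.missProb ≤ ENNReal.ofReal (c / t) ∧ (∀ j, X.m * t / c ≤ √(X.n j : ℝ)) ∧
      ∀ j, X.m * t / c ≤ s (X.n j) := by
  have hm : (0 : ℝ) < X.m := by exact_mod_cast X.m_pos
  have hn : (1 : ℝ) ≤ X.nMin := by exact_mod_cast X.nMin_pos
  have h1 : ENNReal.ofReal t ≤ ENNReal.ofReal c * ENNReal.ofReal
      ((X.m : ℝ)⁻¹ * min ((X.nMin : ℝ) ^ (r₂ / (2 * (r₂ + d)))) (⨅ j, s (X.n j))) :=
    h.le.trans (by unfold tMax; gcongr; exact min_le_left _ _)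
  have h2 : ENNReal.ofReal t ≤ ENNReal.ofReal c * X.missProb⁻¹ :=
    h.le.trans (by unfold tMax; gcongr; exact min_le_right _ _)
  have hinf : 0 ≤ ⨅ j, s (X.n j) := Real.iInf_nonneg fun j => (hs _).le
  have h3 : X.m * t / c ≤ min ((X.nMin : ℝ) ^ (r₂ / (2 * (r₂ + d)))) (⨅ j, s (X.n j)) := by
    rw [← ENNReal.ofReal_mul hc.le, ENNReal.ofReal_le_ofReal_iff (by positivity)] at h1
    rw [div_le_iff₀ hc]
    calc X.m * t ≤ X.m * (c * ((X.m : ℝ)⁻¹ *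
          min ((X.nMin : ℝ) ^ (r₂ / (2 * (r₂ + d)))) (⨅ j, s (X.n j)))) := by gcongr
      _ = _ := by field_simp
  refine ⟨?_, fun j => ?_, fun j => ?_⟩
  · rw [ENNReal.ofReal_div_of_pos (by linarith), ENNReal.le_div_iff_mul_le
      (Or.inl (by simp; linarith)) (Or.inl ENNReal.ofReal_ne_top)]
    calc _ ≤ X.missProb * (ENNReal.ofReal c * X.missProb⁻¹) := by gcongr
      _ = ENNReal.ofReal c * (X.missProb * X.missProb⁻¹) := by ring
      _ ≤ ENNReal.ofReal c * 1 := by gcongr; exact ENNReal.mul_inv_le_one _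
      _ = _ := mul_one _
  · refine (h3.trans (min_le_left _ _)).trans ?_
    calc _ ≤ (X.nMin : ℝ) ^ (1 / 2 : ℝ) := by
          refine Real.rpow_le_rpow_of_exponent_le hn ?_
          rw [div_le_div_iff₀ (by positivity) (by norm_num)]
          have : (0 : ℝ) ≤ d := by positivity
          linarith
      _ ≤ _ := by
          rw [← Real.sqrt_eq_rpow]
          exact Real.sqrt_le_sqrt (by exact_mod_cast X.nMin_le j)
  · exact (h3.trans (min_le_right _ _)).trans (ciInf_le (Set.finite_range _).bddBelow j)

end MTLExperiment

/-! ### The oracle rate and its asymptotic consequences -/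

namespace MTLExperiment

theorem exists_oracle_constants (d : ℕ) {M δ ρ κ σ₁ σ₂ σ₃ σ₄ σ₅ r₁ r₂ : ℝ}
    (hM : 0 < M) (hδ : 0 < δ) (hρ : 0 < ρ) (hσ₁ : 0 < σ₁) (hσ₂ : 0 < σ₂) (hσ₃ : 0 < σ₃)
    (hσ₄ : 0 < σ₄) (hσ₅ : 0 < σ₅) (hr₁ : 2 < r₁) (hr₂ : 2 < r₂) {s : ℕ → ℝ} (hs : ∀ n, 0 < s n) :
    ∃ c > (0 : ℝ), ∃ C > (0 : ℝ), ∃ G₀ > (0 : ℝ), ∀ α γ cw c₂ ζ : ℝ, 0 < α → 0 ≤ γ → 0 < cw →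
      c₂ = cw * (δ / 2) ^ (-γ) → ζ < 1 / 2 → ∀ (p : ℝ → ℕ → ℝ≥0) (X : MTLExperiment.{u, v, w} d),
      X.ClusteredTargets δ → X.LossRegular M ρ κ σ₁ σ₂ σ₃ σ₅ r₁ r₂ →
      X.NuisanceRate σ₄ s → X.PilotConsistent α p →
      ∀ τ ε : ℝ, X.Tuned ((G₀ + 3) / c₂) 1 c₂ α ζ γ τ ε →
      ∀ θhat : X.Ω → Fin X.m → Vec d, X.IsFusedEstimator cw γ τ ε θhat →
      ∀ t : ℝ, 1 < t → ENNReal.ofReal t < X.tMax c r₂ s →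
      X.Pr {ω | ¬ ((∀ j j', θhat ω j = θhat ω j' ↔ X.cluster j = X.cluster j') ∧
          ∀ j, ‖θhat ω j - X.θstar j‖ ≤ C * ((X.K : ℝ) ^ (1 / r₁) + X.b s (X.cluster j)) *
            (X.N (X.cluster j) : ℝ) ^ (-1 / 2 : ℝ) * t)}
        ≤ ENNReal.ofReal t⁻¹ + p (δ / 4) X.nMin := by
  have hmz := mzConst_nonneg hr₁ hσ₁.le
  obtain ⟨A, hA⟩ : ∃ A, A = 16 * (2 + 2 * κ ^ 2 + 2 * σ₂) * σ₃ / ρ ^ 2 := ⟨_, rfl⟩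
  have hA0 : 0 < A := by rw [hA]; positivity
  -- Radii `r` and `re` below this value give `A (r + re) ≤ ρ / 4`, the tolerance of the curvature
  -- bound.
  obtain ⟨x, hx⟩ : ∃ x, x = ρ / (8 * (A + 1)) := ⟨_, rfl⟩
  have hx0 : 0 < x := by rw [hx]; positivity
  obtain ⟨r, hr, hrM, hrδ, hrx⟩ : ∃ r > 0, (d + 1) * (3 * r) ≤ M ∧ 2 * r ≤ δ ∧ r ≤ x := by
    refine ⟨min (min (M / (3 * (d + 1))) (δ / 2)) x, by positivity, ?_, ?_, min_le_right _ _⟩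
    · calc _ ≤ ((d : ℝ) + 1) * (3 * (M / (3 * (d + 1)))) := by
            gcongr; exact (min_le_left _ _).trans (min_le_left _ _)
        _ = M := by field_simp
    · have := (min_le_left (min (M / (3 * ((d : ℝ) + 1))) (δ / 2)) x).trans (min_le_right _ _)
      linarith
  obtain ⟨re, hre, hreM, hrex⟩ : ∃ re > 0, re ≤ M ∧ re ≤ x :=
    ⟨min M x, by positivity, min_le_left _ _, min_le_right _ _⟩
  have hAr : A * (r + re) ≤ ρ / 4 := by
    calc _ ≤ (A + 1) * (x + x) := by gcongr; linarith
      _ = _ := by rw [hx]; field_simp; ring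
  obtain ⟨V, hV⟩ : ∃ V, V = d * (mzConst r₁ σ₁ + 2 * (σ₅ * σ₄)) := ⟨_, rfl⟩
  have hV0 : 0 ≤ V := by rw [hV]; positivity
  -- The cluster-level failures then cost at most a quarter of `1 / t`.
  obtain ⟨B, hB⟩ : ∃ B, B = 4 * V + 1 := ⟨_, rfl⟩
  have hB1 : 1 ≤ B := by linarith
  have hVB : V / B ≤ 1 / 4 := by rw [div_le_div_iff₀ (by linarith) (by norm_num)]; linarith
  obtain ⟨C, hC⟩ : ∃ C, C = 8 / ρ * (3 * d * B + 1) := ⟨_, rfl⟩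
  have hC0 : 0 < C := by rw [hC]; positivity
  obtain ⟨G₀, hG₀⟩ : ∃ G₀, G₀ =
    2 * (3 * M + (2 + (2 + 2 * κ ^ 2 + 2 * σ₂) * M ^ 4 + M ^ 2 / 2)) / r := ⟨_, rfl⟩
  have hG₀0 : 0 < G₀ := by rw [hG₀]; positivity
  obtain ⟨Y, hY⟩ : ∃ Y, Y = σ₄ / re ^ 2 + σ₃ * (1 + σ₄)
      + d ^ 2 * (16 * (2 + 2 * κ ^ 2 + 2 * σ₂) / (ρ / (4 * ((d : ℝ) ^ 2 + 1))) ^ 2)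
      + 2 * d * ((2 + 2 * κ ^ 2 + 2 * σ₂) * M ^ 4) + d * (1 + σ₁) + d * (2 * (σ₅ * σ₄)) := ⟨_, rfl⟩
  have hY0 : 0 ≤ Y := by rw [hY]; positivity
  -- The second bound limits the missed realization sets and the task-level failures to half of `1 /
  -- t`. The third keeps every `R k` below `r`, and `c ≤ 1` gives `W ≥ 1` and `c² ≤ c`.
  obtain ⟨c, hc, hc1, hcY, hcC⟩ : ∃ c > 0, c ≤ 1 ∧ c * (1 + Y) ≤ 1 / 2 ∧ 2 * C * c < r := by
    refine ⟨min (min 1 (1 / (2 * (1 + Y)))) (r / (4 * C)), by positivity,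
      (min_le_left _ _).trans (min_le_left _ _), ?_, ?_⟩
    · calc _ ≤ 1 / (2 * (1 + Y)) * (1 + Y) := by
            gcongr; exact (min_le_left _ _).trans (min_le_right _ _)
        _ = _ := by field_simp
    · calc _ ≤ 2 * C * (r / (4 * C)) := by gcongr; exact min_le_right _ _
        _ = r / 2 := by field_simp; norm_num
        _ < r := by linarith
  refine ⟨c, hc, C, hC0, G₀, hG₀0, ?_⟩
  intro α γ cw c₂ ζ hα hγ hcw hc₂ hζ p X hT hX hN hP τ ε htun θhat hθ t ht htm
  obtain ⟨hmiss, hWn, hWs⟩ := bounds_of_lt_tMax hs hr₂ hc ht htm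
  have hm1 : (1 : ℝ) ≤ X.m := by exact_mod_cast X.m_pos
  have ht0 : 0 < t := one_pos.trans ht
  have hW : 1 ≤ X.m * t / c := by
    rw [le_div_iff₀ hc, one_mul]
    exact hc1.trans (one_le_mul_of_one_le_of_one_le hm1 ht.le)
  have hmtW : X.m * t / (X.m * t / c) = c := by field_simp
  have hRr : ∀ k, C * ((X.K : ℝ) ^ (1 / r₁) + X.b s k) * (X.N k : ℝ) ^ (-1 / 2 : ℝ) * t < r := by
    intro k
    have h1 := b_mul_le ht.le (one_pos.trans_le hW) hWs k
    have h2 := K_rpow_mul_le hr₁ ht.le (one_pos.trans_le hW) hWn k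
    rw [hmtW] at h1 h2
    have h3 : c ^ 2 ≤ c := pow_le_of_le_one hc.le hc1 two_ne_zero
    calc _ = C * ((X.K : ℝ) ^ (1 / r₁) * (X.N k : ℝ) ^ (-1 / 2 : ℝ) * t
          + X.b s k * (X.N k : ℝ) ^ (-1 / 2 : ℝ) * t) := by ring
      _ ≤ C * (c + c) := by gcongr; exact h1.trans h3
      _ = 2 * C * c := by ring
      _ < r := hcC
  choose L hLm hLle hLi using hX.hessian_lipschitz
  have hfail := hX.measure_not_sampleRegular_le hM hρ hσ₁ hσ₂ hσ₃ hσ₅ hr₁ hr₂ hσ₄ hs hN hLm hLi A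
    hre hreM hB1 ht hW hWn hWs
  rw [← hY, ← hV] at hfail
  have hsum : X.missProb + ENNReal.ofReal (Y * (X.m / (X.m * t / c)) + V / B / t) ≤
      ENNReal.ofReal t⁻¹ := by
    refine (add_le_add hmiss le_rfl).trans ?_
    rw [← ENNReal.ofReal_add (by positivity) (by positivity)]
    refine ENNReal.ofReal_le_ofReal ?_
    calc c / t + (Y * (X.m / (X.m * t / c)) + V / B / t) = (c * (1 + Y) + V / B) * t⁻¹ := by
          field_simp
          ring
      _ ≤ 1 * t⁻¹ := by gcongr; linarith
      _ = _ := one_mul _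
  refine (measure_mono fun ω hω => ?_).trans ((measure_union_le _ _).trans
    (add_le_add (hfail.trans hsum) (hP (δ / 4) (by positivity))))
  by_contra hnot
  simp only [Set.mem_union, not_or, Set.mem_ofPred_eq, not_not] at hnot
  exact hω (SampleRegular.exact_clustering hM hδ hρ hσ₁ hσ₂ hσ₃ hr₁ hr₂ hT hX hLm hLle hLi hA hreM
    hr hrM hrδ hAr hB1 hC ht hG₀ hRr hα hγ hcw hζ hc₂ htun hθ hnot.2 hnot.1)

variable {d : ℕ}

theorem tendsto_nMin {r : ℝ} (hr : 0 ≤ r) {X : ℕ → MTLExperiment.{u, v, w} d}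
    (h : Tendsto (fun ν => ((X ν).nMin : ℝ) / ((X ν).m : ℝ) ^ r) atTop atTop) :
    Tendsto (fun ν => (X ν).nMin) atTop atTop := by
  refine tendsto_natCast_atTop_iff.1 (tendsto_atTop_mono (fun ν => ?_) h)
  have hm1 : (1 : ℝ) ≤ (X ν).m := by exact_mod_cast (X ν).m_pos
  exact div_le_self (by positivity) (Real.one_le_rpow hm1 hr)

/-- Each entry of the minimum has the form `n_min^e / m`, and diverges once `n_min / m^{1/e}` does.
The lower bound `s(n) ≥ n^{1/4}` for large `n` accounts for the exponent `4`, the other entry for `2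
(r₂ + d) / r₂`. -/
theorem tendsto_tMax {c r₂ : ℝ} (hc : 0 < c) (hr₂ : 2 < r₂) {s : ℕ → ℝ} (hs : ∀ n, 0 < s n)
    (hs_lower : (fun n : ℕ => (n : ℝ) ^ (1 / 4 : ℝ)) =o[atTop] s)
    {X : ℕ → MTLExperiment.{u, v, w} d}
    (h : Tendsto (fun ν => ((X ν).nMin : ℝ) / ((X ν).m : ℝ) ^ (max 4 (2 * (r₂ + d) / r₂)))
      atTop atTop)
    (hmiss : Tendsto (fun ν => (X ν).missProb) atTop (𝓝 0)) :
    Tendsto (fun ν => (X ν).tMax c r₂ s) atTop (𝓝 ∞) := by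
  set r := max 4 (2 * (r₂ + d) / r₂) with hr
  have hr0 : 0 ≤ r := le_trans (by norm_num) (le_max_left _ _)
  have hd : (0 : ℝ) ≤ d := by positivity
  have hkey : ∀ e : ℝ, 0 < e → 1 / e ≤ r → ∀ ν, (((X ν).nMin : ℝ) / ((X ν).m : ℝ) ^ r) ^ e ≤
      ((X ν).m : ℝ)⁻¹ * ((X ν).nMin : ℝ) ^ e := by
    intro e he her ν
    have hm1 : (1 : ℝ) ≤ (X ν).m := by exact_mod_cast (X ν).m_pos
    have h1 : ((X ν).m : ℝ) ≤ (((X ν).m : ℝ) ^ r) ^ e := by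
      rw [← Real.rpow_mul (by positivity)]
      refine Real.self_le_rpow_of_one_le hm1 ?_
      rwa [div_le_iff₀ he] at her
    rw [Real.div_rpow (by positivity) (by positivity), inv_mul_eq_div]
    gcongr
  set e := r₂ / (2 * (r₂ + d)) with he
  have he0 : 0 < e := by positivity
  have hn := tendsto_nMin hr0 h
  have hs' : ∀ᶠ n : ℕ in atTop, (n : ℝ) ^ (1 / 4 : ℝ) ≤ s n := by
    filter_upwards [hs_lower.bound one_pos] with n hn
    rwa [one_mul, Real.norm_of_nonneg (by positivity), Real.norm_of_nonneg (hs n).le] at hn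
  obtain ⟨n₀, hn₀⟩ := eventually_atTop.1 hs'
  have hmain : Tendsto (fun ν => ((X ν).m : ℝ)⁻¹ *
      min (((X ν).nMin : ℝ) ^ e) (⨅ j, s ((X ν).n j))) atTop atTop := by
    refine tendsto_atTop.2 fun B => ?_
    filter_upwards [((tendsto_rpow_atTop he0).comp h).eventually_ge_atTop B,
      ((tendsto_rpow_atTop (show (0 : ℝ) < 1 / 4 by norm_num)).comp h).eventually_ge_atTop B,
      hn.eventually_ge_atTop n₀] with ν h1 h2 h3
    have hm0 : (0 : ℝ) ≤ ((X ν).m : ℝ)⁻¹ := by positivity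
    have : Nonempty (Fin (X ν).m) := ⟨⟨0, (X ν).m_pos⟩⟩
    rw [mul_min_of_nonneg _ _ hm0]
    refine le_min (h1.trans (hkey e he0 ?_ ν)) (h2.trans ((hkey (1 / 4) (by norm_num) ?_ ν).trans ?_))
    · rw [he, one_div_div]; exact le_max_right _ _
    · norm_num [hr]
    · refine mul_le_mul_of_nonneg_left (le_ciInf fun j => ?_) hm0
      calc _ ≤ ((X ν).n j : ℝ) ^ (1 / 4 : ℝ) := by
            gcongr; exact (X ν).nMin_le j
        _ ≤ _ := hn₀ _ (h3.trans ((X ν).nMin_le j))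
  have h1 := ENNReal.tendsto_ofReal_atTop.comp hmain
  have h2 := hmiss.inv
  rw [ENNReal.inv_zero] at h2
  have h3 := ENNReal.Tendsto.const_mul (a := ENNReal.ofReal c) (h1.min h2) (Or.inl (by simp))
  rw [min_self, ENNReal.mul_top (by simpa using hc)] at h3
  exact h3

end MTLExperiment

theorem theorem1 (d : ℕ) (M δ ρ κ σ₁ σ₂ σ₃ σ₄ σ₅ r₁ r₂ : ℝ)
    (hM : 0 < M) (hδ : 0 < δ) (hρ : 0 < ρ) (hκ : 0 < κ)
    (hσ₁ : 0 < σ₁) (hσ₂ : 0 < σ₂) (hσ₃ : 0 < σ₃) (hσ₄ : 0 < σ₄) (hσ₅ : 0 < σ₅)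
    (hr₁ : 2 < r₁) (hr₂ : 2 < r₂)
    (s : ℕ → ℝ) (hs_pos : ∀ n, 0 < s n)
    (hs_lower : (fun n : ℕ => (n : ℝ) ^ (1 / 4 : ℝ)) =o[atTop] s)
    (hs_upper : s =O[atTop] (fun n : ℕ => (n : ℝ) ^ (1 / 2 : ℝ))) :
    ∃ c₁ > (0 : ℝ), ∃ c > (0 : ℝ), ∃ C > (0 : ℝ), ∃ C' > (0 : ℝ),
    -- the range of `t` exhausts `(1, ∞)`
    (∀ X : ℕ → MTLExperiment.{u, v, w} d,
      Tendsto (fun ν => ((X ν).nMin : ℝ) / ((X ν).m : ℝ) ^ (max 4 (2 * (r₂ + d) / r₂)))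
        atTop atTop →
      Tendsto (fun ν => (X ν).missProb) atTop (𝓝 0) →
      Tendsto (fun ν => (X ν).tMax c r₂ s) atTop (𝓝 ∞)) ∧
    ∀ α γ cw : ℝ, 0 < α → α ≤ 1 / 2 → 0 ≤ γ → 0 < cw →
    ∃ c₀ > (0 : ℝ), ∃ c₂ > (0 : ℝ),
    ∀ p : ℝ → ℕ → ℝ≥0, (∀ ε > 0, Tendsto (p ε) atTop (𝓝 0)) →
    ∀ ζ : ℝ, ζ < 1 / 2 →
    -- exact clustering and oracle rate
    (∀ X : MTLExperiment.{u, v, w} d,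
      X.ClusteredTargets δ → X.LossRegular M ρ κ σ₁ σ₂ σ₃ σ₅ r₁ r₂ →
      X.NuisanceRate σ₄ s → X.PilotConsistent α p →
      ∀ τ ε : ℝ, X.Tuned c₀ c₁ c₂ α ζ γ τ ε →
      ∀ θhat : X.Ω → Fin X.m → Vec d, X.IsFusedEstimator cw γ τ ε θhat →
      ∀ t : ℝ, 1 < t → ENNReal.ofReal t < X.tMax c r₂ s →
      X.Pr {ω | ¬ ((∀ j j', θhat ω j = θhat ω j' ↔ X.cluster j = X.cluster j') ∧
          ∀ k j, X.cluster j = k →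
            ‖θhat ω j - X.θstar j‖ ≤
              C * ((X.K : ℝ) ^ (1 / r₁) + X.b s k) * (X.N k : ℝ) ^ (-1 / 2 : ℝ) * t
                + C' * (X.N k : ℝ) ^ (ζ - 1))}
        ≤ ENNReal.ofReal t⁻¹ + p (δ / 4) X.nMin) ∧
    -- the pooled rate `O_P(N_k^{-1/2})` along sequences of experiments
    (∀ X : ℕ → MTLExperiment.{u, v, w} d,
      (∀ ν, (X ν).ClusteredTargets δ) → (∀ ν, (X ν).LossRegular M ρ κ σ₁ σ₂ σ₃ σ₅ r₁ r₂) →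
      (∀ ν, (X ν).NuisanceRate σ₄ s) → (∀ ν, (X ν).PilotConsistent α p) →
      ∀ τ ε : ℕ → ℝ, (∀ ν, (X ν).Tuned c₀ c₁ c₂ α ζ γ (τ ν) (ε ν)) →
      ∀ θhat : ∀ ν, (X ν).Ω → Fin (X ν).m → Vec d,
      (∀ ν, (X ν).IsFusedEstimator cw γ (τ ν) (ε ν) (θhat ν)) →
      Tendsto (fun ν => ((X ν).nMin : ℝ) / ((X ν).m : ℝ) ^ (max 4 (2 * (r₂ + d) / r₂)))
        atTop atTop →
      Tendsto (fun ν => (X ν).missProb) atTop (𝓝 0) →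
      (∃ K₀ : ℕ, ∀ ν, (X ν).K ≤ K₀) →
      ∀ k : ∀ ν, Fin (X ν).K, (∃ B₀ : ℝ, ∀ ν, (X ν).b s (k ν) ≤ B₀) →
      ∀ e : ℝ, 0 < e → ∃ B : ℝ, ∀ᶠ ν in atTop,
        (X ν).Pr {ω | ∃ j, (X ν).cluster j = k ν ∧
            B * ((X ν).N (k ν) : ℝ) ^ (-1 / 2 : ℝ) < ‖θhat ν ω j - (X ν).θstar j‖}
          ≤ ENNReal.ofReal e) := by
  obtain ⟨c, hc, C, hC, G₀, hG₀, hmain⟩ := MTLExperiment.exists_oracle_constants.{u, v, w} d hM hδ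
    hρ hσ₁ hσ₂ hσ₃ hσ₄ hσ₅ hr₁ hr₂ hs_pos (κ := κ)
  -- Since the bias is already absorbed into `C`, the term in `N_k^{ζ-1}` is pure slack and any
  -- positive constant serves for it.
  refine ⟨1, one_pos, c, hc, C, hC, 1, one_pos,
    fun X h hmiss => MTLExperiment.tendsto_tMax hc hr₂ hs_pos hs_lower h hmiss,
    fun α γ cw hα _ hγ hcw => ?_⟩
  have hc₂ : 0 < cw * (δ / 2) ^ (-γ) := by positivity
  refine ⟨(G₀ + 3) / (cw * (δ / 2) ^ (-γ)), by positivity, cw * (δ / 2) ^ (-γ), hc₂,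
    fun p hp ζ hζ => ⟨fun X hT hX hN hP τ ε htun θhat hθ t ht htm => ?_, ?_⟩⟩
  · refine (measure_mono fun ω => mt ?_).trans (hmain α γ cw _ ζ hα hγ hcw rfl hζ p X hT hX hN hP τ ε
      htun θhat hθ t ht htm)
    rintro ⟨h1, h2⟩
    refine ⟨h1, fun k j hj => ?_⟩
    subst hj
    have : 0 ≤ 1 * (X.N (X.cluster j) : ℝ) ^ (ζ - 1) := by positivity
    linarith [h2 j]
  · intro X hT hX hN hP τ ε htun θhat hθ hgrow hmiss ⟨K₀, hK₀⟩ k ⟨B₀, hB₀⟩ e he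
    -- At this `t` the main failure probability `1 / t` is at most `e / 2`; the pilot failure
    -- eventually takes less than the other half, and `t < a` eventually because `a` diverges.
    have ht : 1 < 2 / e + 2 := by have : 0 < 2 / e := by positivity
                                  linarith
    refine ⟨C * ((K₀ : ℝ) ^ (1 / r₁) + B₀) * (2 / e + 2), ?_⟩
    have hnMin := MTLExperiment.tendsto_nMin (le_trans (by norm_num) (le_max_left _ _)) hgrow
    have hp' : ∀ᶠ ν in atTop, (p (δ / 4) (X ν).nMin : ℝ≥0∞) < ENNReal.ofReal (e / 2) :=
      (ENNReal.tendsto_coe.2 ((hp (δ / 4) (by positivity)).comp hnMin)).eventually_lt_const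
        (by simpa using he)
    filter_upwards [hp', (MTLExperiment.tendsto_tMax hc hr₂ hs_pos hs_lower hgrow
      hmiss).eventually_const_lt (show ENNReal.ofReal (2 / e + 2) < ∞ from ENNReal.ofReal_lt_top)]
      with ν h1 h2
    refine (measure_mono fun ω => ?_).trans ((hmain α γ cw _ ζ hα hγ hcw rfl hζ p (X ν) (hT ν) (hX ν)
      (hN ν) (hP ν) _ _ (htun ν) _ (hθ ν) _ ht h2).trans ?_)
    · rintro ⟨j, hj, hlt⟩ ⟨-, hgood⟩
      refine absurd (hgood j) (not_le.2 (lt_of_le_of_lt ?_ hlt))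
      rw [hj]
      have h3 : ((X ν).K : ℝ) ^ (1 / r₁) ≤ (K₀ : ℝ) ^ (1 / r₁) := by
        have := hK₀ ν
        gcongr
      have h4 := hB₀ ν
      calc _ = C * (((X ν).K : ℝ) ^ (1 / r₁) + (X ν).b s (k ν)) * (2 / e + 2) *
            ((X ν).N (k ν) : ℝ) ^ (-1 / 2 : ℝ) := by ring
        _ ≤ _ := by gcongr
    · calc _ ≤ ENNReal.ofReal (e / 2) + ENNReal.ofReal (e / 2) := by
            gcongr
            rw [inv_le_comm₀ (by linarith) (by linarith), inv_div]
            linarith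
        _ = _ := by
            rw [← ENNReal.ofReal_add (by linarith) (by linarith)]
            congr 1; ring
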